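/- Let $M$ be a closed (compact, without boundary) connected $C^\infty$ manifold of dimension $2d$ with a symplectic form $\omega$, and suppose that the class $[\omega]\in H^2(M,\mathbb{R})$ is integral, i.e. lies in the image of $H^2(M,\mathbb{Z})\to H^2(M,\mathbb{R})$. Then there is a smooth $\mathbf{U}(1)$-principal bundle $\pi:P\to M$ such that: 1. There is a connection $A$ on $P$ (a smooth $\mathbf{U}(1)$-invariant one-form with values in $i\mathbb{R}$ such that $A(\partial/\partial\theta)=i$, where $\partial/\partial\theta$ generates the action of $\mathbf{U}(1)$) whose curvature $\Theta=dA$ is $$\Theta=-2\pi i\,(\pi^*\omega).$$ 2. Let moreover $f:M\to M$ be a $C^\infty$ diffeomorphism with $f^*\omega=\omega$, and suppose that $H_1(M,\mathbb{Z})$ has no torsion and that $1$ is not an eigenvalue of the induced linear map $f_*:H_1(M,\mathbb{R})\to H_1(M,\mathbb{R})$. Then the connection $A$ on $P$ with $dA=-2\pi i\,(\pi^*\omega)$ can be chosen so that there is a smooth map $\tilde f:P\to P$ with $$\pi\circ\tilde f=f\circ\pi,\qquad \tilde f(e^{i\theta}p)=e^{i\theta}\tilde f(p)\quad(p\in P,\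 \theta\in\mathbb{R}),\qquad \tilde f^*A=A.$$ -/

import Mathlib

open Set MeasureTheory
open scoped Manifold ContDiff

universe u

noncomputable section

/-! ### Differential forms on manifolds without boundary -/

section Forms

variable {E : Type*} [NormedAddCommGroup E] [NormedSpace ℝ E]
  {H : Type*} [TopologicalSpace H]
  {E' : Type*} [NormedAddCommGroup E'] [NormedSpace ℝ E']
  {H' : Type*} [TopologicalSpace H']

/-- A (not necessarily smooth) differential `k`-form on `M` with values in `F`. -/
abbrev DiffForm (I : ModelWithCorners ℝ E H) (M : Type*) [TopologicalSpace M]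
    [ChartedSpace H M] (k : ℕ) (F : Type*) [NormedAddCommGroup F] [NormedSpace ℝ F] : Type _ :=
  (x : M) → TangentSpace I x [⋀^Fin k]→L[ℝ] F

namespace DiffForm

variable {I : ModelWithCorners ℝ E H} {J : ModelWithCorners ℝ E' H'}
  {M : Type*} [TopologicalSpace M] [ChartedSpace H M]
  {N : Type*} [TopologicalSpace N] [ChartedSpace H' N]
  {F : Type*} [NormedAddCommGroup F] [NormedSpace ℝ F] {k : ℕ}

/-- The pull-back `g^* α` of a form `α` on `N` by a differentiable map `g : M → N`. -/
def pullback (I : ModelWithCorners ℝ E H) (J : ModelWithCorners ℝ E' H')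
    (g : M → N) (α : DiffForm J N k F) : DiffForm I M k F :=
  fun x => (α (g x)).compContinuousLinearMap (mfderiv I J g x)

/-- The expression of a form in the preferred chart at `x₀`: its pull-back by the inverse of the
chart. Only the values on the target of the chart are meaningful. -/
def inChart (α : DiffForm I M k F) (x₀ : M) : E → E [⋀^Fin k]→L[ℝ] F :=
  fun y => (α ((extChartAt I x₀).symm y)).compContinuousLinearMap
    (mfderiv 𝓘(ℝ, E) I (extChartAt I x₀).symm y)

/-- A form is smooth if all its expressions in charts are smooth. -/
def IsSmooth (α : DiffForm I M k F) : Prop :=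
  ∀ x₀ : M, ContDiffOn ℝ ∞ (α.inChart x₀) (extChartAt I x₀).target

/-- The exterior derivative, computed at each point in the preferred chart at that point. -/
def extDeriv (α : DiffForm I M k F) : DiffForm I M (k + 1) F :=
  fun x => (_root_.extDeriv (α.inChart x) (extChartAt I x x)).compContinuousLinearMap
    (mfderiv I 𝓘(ℝ, E) (extChartAt I x) x)

end DiffForm

end Forms

/-! ### Singular cochains, and integrality of the class of a closed two-form -/

section Singular

/-- Singular `n`-simplices of `X`. -/
abbrev SingularSimplex (n : ℕ) (X : Type*) [TopologicalSpace X] : Type _ :=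
  C(stdSimplex ℝ (Fin (n + 1)), X)

variable {X : Type*} [TopologicalSpace X]

/-- The `i`-th face of a singular simplex (opposite to the `i`-th vertex). -/
def SingularSimplex.face {n : ℕ} (i : Fin (n + 2)) (σ : SingularSimplex (n + 1) X) :
    SingularSimplex n X :=
  σ.comp ⟨stdSimplex.map i.succAbove, stdSimplex.continuous_map _⟩

/-- The coboundary of a singular cochain with coefficients in `G`. -/
def singularCoboundary {n : ℕ} {G : Type*} [AddCommGroup G] (c : SingularSimplex n X → G) :
    SingularSimplex (n + 1) X → G :=
  fun σ => ∑ i : Fin (n + 2), (-1 : ℤ) ^ (i : ℕ) • c (σ.face i)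

/-- The closed triangle with vertices `(0,0)`, `(1,0)`, `(0,1)`. -/
def triangle : Set (ℝ × ℝ) := {q | 0 ≤ q.1 ∧ 0 ≤ q.2 ∧ q.1 + q.2 ≤ 1}

/-- The affine identification of the triangle with the standard two-simplex. -/
def triangleToSimplex (q : triangle) : stdSimplex ℝ (Fin 3) :=
  ⟨![1 - q.1.1 - q.1.2, q.1.1, q.1.2], by
    obtain ⟨⟨a, b⟩, ha, hb, hab⟩ := q
    simp only at ha hb hab
    refine ⟨fun i => ?_, ?_⟩
    · fin_cases i
      · simpa using by linarith
      · simpa using ha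
      · simpa using hb
    · simp only [Fin.sum_univ_three, Matrix.cons_val]
      ring⟩

variable {E : Type*} [NormedAddCommGroup E] [NormedSpace ℝ E]
  {H : Type*} [TopologicalSpace H] (I : ModelWithCorners ℝ E H)
  {M : Type*} [TopologicalSpace M] [ChartedSpace H M]

/-- `g` is an extension of the singular two-simplex `σ`, read on the triangle, which is smooth on a
neighbourhood of the triangle. A singular simplex that has such an extension is smooth. -/
def IsSmoothExtension (σ : SingularSimplex 2 M) (g : ℝ × ℝ → M) : Prop :=
  (∀ q : triangle, g q = σ (triangleToSimplex q)) ∧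
    ∃ U : Set (ℝ × ℝ), IsOpen U ∧ triangle ⊆ U ∧ ContMDiffOn 𝓘(ℝ, ℝ × ℝ) I ∞ g U

variable {I}

/-- The integral over the triangle of the pull-back by `g` of a two-form `α`. -/
def triangleIntegral (α : DiffForm I M 2 ℝ) (g : ℝ × ℝ → M) : ℝ :=
  ∫ q in triangle, (α.pullback 𝓘(ℝ, ℝ × ℝ) I g) q ![((1, 0) : ℝ × ℝ), ((0, 1) : ℝ × ℝ)]

/-- The class of `α` in `H²(M, ℝ)` is integral: there is a singular two-cocycle `c` with integer
coefficients whose class in real cohomology is the de Rham class of `α`, that is, on smooth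
singular simplices the cochain `σ ↦ ∫_σ α` and `c` differ by the coboundary of a real
one-cochain `b`. -/
def HasIntegralClass (α : DiffForm I M 2 ℝ) : Prop :=
  ∃ c : SingularSimplex 2 M → ℤ, singularCoboundary c = 0 ∧
    ∃ b : SingularSimplex 1 M → ℝ,
      ∀ (σ : SingularSimplex 2 M) (g : ℝ × ℝ → M), IsSmoothExtension I σ g →
        triangleIntegral α g = (c σ : ℝ) + singularCoboundary b σ

end Singular

/-! ### First homology and the second assumption -/

section Homology

open CategoryTheory AlgebraicTopology

/-- The singular homology functor `H₁(-, R)`. -/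
def singularH1 (R : Type) [CommRing R] : TopCat.{u} ⥤ ModuleCat.{u} R :=
  (singularHomologyFunctor (ModuleCat.{u} R) 1).obj (ModuleCat.of R (ULift.{u} R))

/-- `H₁(M, ℤ)` has no torsion and `1` is not an eigenvalue of `f_*` on `H₁(M, ℝ)`. -/
def HomologyAssumption {M : Type u} [TopologicalSpace M] (f : C(M, M)) : Prop :=
  Module.IsTorsionFree ℤ ((singularH1.{u} ℤ).obj (TopCat.of M)) ∧
    ¬ Module.End.HasEigenvalue ((singularH1.{u} ℝ).map (TopCat.ofHom f)).hom 1

end Homology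

/-! ### Symplectic forms, `U(1)`-principal bundles and connections -/

/-- A symplectic form: a smooth, closed, nondegenerate two-form. -/
structure IsSymplecticForm {E : Type*} [NormedAddCommGroup E] [NormedSpace ℝ E]
    {H : Type*} [TopologicalSpace H] {I : ModelWithCorners ℝ E H}
    {M : Type*} [TopologicalSpace M] [ChartedSpace H M] (Ω : DiffForm I M 2 ℝ) : Prop where
  smooth : Ω.IsSmooth
  closed : Ω.extDeriv = 0
  nondegenerate : ∀ (x : M) (v : TangentSpace I x),
    (∀ w : TangentSpace I x, Ω x ![v, w] = 0) → v = 0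

/-- The model of the total space of a circle bundle over an `n`-dimensional manifold. -/
abbrev bundleModel (n : ℕ) :
    ModelWithCorners ℝ (EuclideanSpace ℝ (Fin n) × EuclideanSpace ℝ (Fin 1))
      (ModelProd (EuclideanSpace ℝ (Fin n)) (EuclideanSpace ℝ (Fin 1))) :=
  (𝓡 n).prod (𝓡 1)

/-- A smooth `U(1)`-principal bundle over the `n`-dimensional manifold `M`. -/
structure CircleBundle (n : ℕ) (M : Type u) [TopologicalSpace M]
    [ChartedSpace (EuclideanSpace ℝ (Fin n)) M] where
  /-- the total space -/
  P : Type u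
  [topP : TopologicalSpace P]
  [chartedP : ChartedSpace (ModelProd (EuclideanSpace ℝ (Fin n)) (EuclideanSpace ℝ (Fin 1))) P]
  [manifoldP : IsManifold (bundleModel n) ∞ P]
  [t2P : T2Space P]
  /-- the action of `U(1)` -/
  [actionP : MulAction Circle P]
  [smoothAction : ContMDiffSMul (𝓡 1) (bundleModel n) ∞ Circle P]
  /-- the projection -/
  proj : P → M
  smooth_proj : ContMDiff (bundleModel n) (𝓡 n) ∞ proj
  free : ∀ (z : Circle) (p : P), z • p = p → z = 1
  /-- the fibres of the projection are the orbits of the action -/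
  proj_eq_iff : ∀ p q : P, proj p = proj q ↔ ∃ z : Circle, z • p = q
  /-- near each point there are a smooth section `τ` and a smooth `φ` such that `(x, z) ↦ z • τ x`
  is a diffeomorphism of `U × U(1)` onto `proj ⁻¹' U` with inverse `p ↦ (proj p, φ p)` -/
  locally_trivial : ∀ x : M, ∃ (U : Set M) (τ : M → P) (φ : P → Circle),
    IsOpen U ∧ x ∈ U ∧
    ContMDiffOn (𝓡 n) (bundleModel n) ∞ τ U ∧
    ContMDiffOn (bundleModel n) (𝓡 1) ∞ φ (proj ⁻¹' U) ∧
    (∀ y ∈ U, proj (τ y) = y) ∧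
    ∀ p ∈ proj ⁻¹' U, φ p • τ (proj p) = p

attribute [instance] CircleBundle.topP CircleBundle.chartedP CircleBundle.manifoldP
  CircleBundle.t2P CircleBundle.actionP CircleBundle.smoothAction

namespace CircleBundle

variable {n : ℕ} {M : Type u} [TopologicalSpace M] [ChartedSpace (EuclideanSpace ℝ (Fin n)) M]

/-- The vector field `∂/∂θ` on the total space that generates the action of `U(1)`: the velocity at
`θ = 0` of the curve `e^{iθ} • p`, which lives in the tangent space at `e^{i0} • p = p`. -/
def generator (B : CircleBundle n M) (p : B.P) : TangentSpace (bundleModel n) p :=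
  let v : TangentSpace (bundleModel n) (Circle.exp 0 • p) :=
    mfderiv 𝓘(ℝ, ℝ) (bundleModel n) (fun θ : ℝ => Circle.exp θ • p) 0 (1 : ℝ)
  v

/-- A connection: a smooth invariant one-form with values in `iℝ ⊆ ℂ`, normalized by
`A(∂/∂θ) = i`. -/
structure IsConnection (B : CircleBundle n M) (A : DiffForm (bundleModel n) B.P 1 ℂ) : Prop where
  smooth : A.IsSmooth
  imaginary : ∀ (p : B.P) (v : TangentSpace (bundleModel n) p), (A p ![v]).re = 0
  invariant : ∀ z : Circle,
    A.pullback (bundleModel n) (bundleModel n) (fun p : B.P => z • p) = A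
  normalized : ∀ p : B.P, A p ![B.generator p] = Complex.I

/-- `A` is a connection whose curvature `dA` equals `-2πi π^* Ω`. -/
def IsPrequantumConnection (B : CircleBundle n M) (Ω : DiffForm (𝓡 n) M 2 ℝ)
    (A : DiffForm (bundleModel n) B.P 1 ℂ) : Prop :=
  B.IsConnection A ∧
    ∀ (p : B.P) (v w : TangentSpace (bundleModel n) p),
      A.extDeriv p ![v, w] = -Complex.I * (2 * Real.pi) *
        ((Ω.pullback (bundleModel n) (𝓡 n) B.proj p ![v, w] : ℝ) : ℂ)

/-- `F` is a smooth equivariant lift of `f` that preserves the connection `A`. -/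
structure IsPrequantumMap (B : CircleBundle n M) (A : DiffForm (bundleModel n) B.P 1 ℂ)
    (f : M → M) (F : B.P → B.P) : Prop where
  smooth : ContMDiff (bundleModel n) (bundleModel n) ∞ F
  lift : ∀ p : B.P, B.proj (F p) = f (B.proj p)
  equivariant : ∀ (θ : ℝ) (p : B.P), F (Circle.exp θ • p) = Circle.exp θ • F p
  preserves : A.pullback (bundleModel n) (bundleModel n) F = A

end CircleBundle

end

/-! On a ball in the preferred chart at `i` the closed form ω has the radial primitive `a i` of the
Poincaré lemma. Integrality gives a real one-cochain `b` with ∫_σ ω ≡ (δb)(σ) mod ℤ for smooth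
triangles σ. The cone over a smooth path γ in the ball is a smooth triangle with radial sides, and
the integral of ω over it is ∫_γ a_i (`integral_coneMap`). With B_i(x) = exp(2πi b(radial path to
x)) this becomes exp(2πi ∫_γ a_i) = exp(2πi b(γ)) B_i(γ(0)) / B_i(γ(1)), the holonomy condition of
`IsPotential`. Nothing is known about continuity of b or B_i, but the ratio B_i/B_j changes along
short segments by the holonomy of a_j - a_i. Hence it is smooth with logarithmic derivative 2πi(a_j
- a_i) (`smooth_of_holonomy`). These ratios are the transition functions of a circle bundle, and the
local forms ζ⁻¹dζ - 2πi a_i agree on overlaps and define a connection with curvature -2πi π^*ω.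

For the lift, f^*ω = ω makes b∘f - b mod ℤ a cocycle on small smooth paths; it measures the flat
difference between the pulled-back connection and the original one. Its local primitives define a
singular cocycle with values in ℝ/ℤ (`exists_cocycle_of_locallyConstant`), that is, up to a
coboundary, a homomorphism H₁(M,ℤ) → ℝ/ℤ. H₁(M,ℤ) is finitely generated (`finite_homology_one`) and
torsion free, so the homomorphism lifts to ℝ and gives a functional θ on H₁(M,ℝ). As f_* - 1 is
injective, ε∘f_* - ε = -θ has a solution ε (`exists_real_cocycle`). Adding to the a_i a closed form
in the class ε, and to b a cocycle in this class, kills the obstruction while the B_i, and so the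
bundle, stay the same. What remains is a function u to U(1) with u(γ(1)) = u(γ(0)) exp(2πi(b(f∘γ) -
b(γ))), and fibre multiplication by B_i u / (B_j∘f) is the lift.

One computation (`contMDiffAt_transitionFun_symm`, `IsBundleLift.pullback_localConnection`) serves
three times: with f = id, u = 1 for the transition functions and the gluing of the connection, with
f = id, u = z for its invariance, and with the given f for the lift. -/

set_option linter.unusedSectionVars false

noncomputable section

/-! ### Singular chains and the tautological cocycle with values in H₁ -/

section SingularChains
open CategoryTheory AlgebraicTopology
variable (R : Type) [CommRing R] (X : TopCat.{u})

/-- The singular chain complex. -/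
abbrev singChains : ChainComplex (ModuleCat.{u} R) ℕ :=
  (TopCat.toSSet.obj X).chainComplex (ModuleCat.of R (ULift.{u} R))

variable {X}

/-- A singular simplex as a simplex of the singular simplicial set. -/
def SingularSimplex.toSSet {n : ℕ} (σ : SingularSimplex n X) :
    (TopCat.toSSet.obj X).obj (.op (.mk n)) :=
  (X.toSSetObjEquiv (.op (.mk n))).symm σ

def singBasis {n : ℕ} (σ : SingularSimplex n X) : (singChains R X).X n :=
  (SSet.ιChainComplex (TopCat.toSSet.obj X) (R := ModuleCat.of R (ULift.{u} R)) σ.toSSet)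
    (ULift.up (1 : R))

theorem singBasis_d {n : ℕ} (σ : SingularSimplex (n+1) X) :
   ((singChains R X).d (n+1) n) (singBasis R σ) = ∑ i : Fin (n+2), (-1 : ℤ)^(i:ℕ) • singBasis R (σ.face i) := by
  have := SSet.ιChainComplex_d (TopCat.toSSet.obj X) (R := ModuleCat.of R (ULift.{u} R)) σ.toSSet
  have h2 := congrArg (fun φ => φ.hom (ULift.up (1:R))) this
  rw [ModuleCat.hom_sum, LinearMap.sum_apply] at h2
  exact h2

theorem singBasis_map {Y : TopCat.{u}} (f : X ⟶ Y) {n : ℕ} (σ : SingularSimplex n X) :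
    ((SSet.chainComplexMap (TopCat.toSSet.map f) (ModuleCat.of R (ULift.{u} R))).f n)
      (singBasis R σ) = singBasis R (X := Y) (f.hom.comp σ) := by
  have := SSet.ι_chainComplexMap_f (f := TopCat.toSSet.map f) (R := ModuleCat.of R (ULift.{u} R))
    (x := σ.toSSet)
  exact congrArg (fun φ => φ.hom (ULift.up (1:R))) this

variable {R}

theorem singChains_hom_ext {n : ℕ} {A : ModuleCat.{u} R} {f g : (singChains R X).X n ⟶ A}
    (h : ∀ σ : SingularSimplex n X, f (singBasis R σ) = g (singBasis R σ)) : f = g := by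
  refine SSet.chainComplex_hom_ext fun x => ?_
  obtain ⟨σ, rfl⟩ : ∃ σ : SingularSimplex n X, σ.toSSet = x :=
    (X.toSSetObjEquiv (.op (.mk n))).symm.surjective x
  ext r
  have hr : r = r.down • (ULift.up (1:R)) := by ext; simp
  rw [hr, map_smul, map_smul]
  exact congrArg _ (h σ)

/-- The chain module is a coproduct of copies of `R` indexed by simplices. Together with
`singChains_hom_ext` this lets cochains and morphisms out of the chain modules be used
interchangeably. -/
theorem exists_singChains_hom {n : ℕ} {A : ModuleCat.{u} R} (k : SingularSimplex n X → A) :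
    ∃ f : (singChains R X).X n ⟶ A, ∀ σ, f (singBasis R σ) = k σ := by
  let t : ∀ x : (TopCat.toSSet.obj X).obj (.op (.mk n)), ModuleCat.of R (ULift.{u} R) ⟶ A := fun x =>
    ModuleCat.ofHom ((LinearMap.toSpanSingleton R A (k (X.toSSetObjEquiv (.op (.mk n)) x))).comp
      ULift.moduleEquiv.toLinearMap)
  refine ⟨((TopCat.toSSet.obj X).isColimitChainComplexXCofan _ n).desc (Limits.Cofan.mk A t),
    fun σ => ?_⟩
  have h := ((TopCat.toSSet.obj X).isColimitChainComplexXCofan _ n).fac (Limits.Cofan.mk A t)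
    ⟨σ.toSSet⟩
  have h2 := congrArg (fun φ => φ.hom (ULift.up (1:R))) h
  refine h2.trans ?_
  show (1 : R) • k _ = _
  rw [one_smul]
  exact congrArg k ((X.toSSetObjEquiv (.op (.mk n))).apply_symm_apply σ)


theorem stdSimplex_map_succAbove_self {n : ℕ} (i : Fin (n + 1)) (t : stdSimplex ℝ (Fin n)) :
    stdSimplex.map i.succAbove t i = 0 := by
  rw [stdSimplex.map_coe, FunOnFinite.linearMap_apply_apply]
  simp [Fin.succAbove_ne]

theorem stdSimplex_map_succAbove_succAbove {n : ℕ} (i : Fin (n + 1)) (t : stdSimplex ℝ (Fin n))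
    (j : Fin n) : stdSimplex.map i.succAbove t (i.succAbove j) = t j := by
  rw [stdSimplex.map_coe, FunOnFinite.linearMap_apply_apply]
  simp [Finset.filter_eq']

/-- The singular one-simplex given by a path. -/
def pathSimplex {X : Type*} [TopologicalSpace X] (ψ : C(ℝ, X)) : SingularSimplex 1 X :=
  ψ.comp ⟨fun t => t 1, (continuous_apply 1).comp continuous_subtype_val⟩

theorem pathSimplex_face_zero {X : Type*} [TopologicalSpace X] (ψ : C(ℝ, X)) :
    (pathSimplex ψ).face 0 = ContinuousMap.const _ (ψ 1) := by
  ext t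
  obtain rfl : t = default := Subsingleton.elim _ _
  refine congrArg ψ ((stdSimplex_map_succAbove_succAbove 0 _ 0).trans ?_)
  simp

theorem pathSimplex_face_one {X : Type*} [TopologicalSpace X] (ψ : C(ℝ, X)) :
    (pathSimplex ψ).face 1 = ContinuousMap.const _ (ψ 0) := by
  ext t
  exact congrArg ψ (stdSimplex_map_succAbove_self 1 _)

theorem exists_simplex_of_faces {X : Type*} [TopologicalSpace X] [PathConnectedSpace X]
    (x y : X) : ∃ γ : SingularSimplex 1 X,
      γ.face 0 = ContinuousMap.const _ y ∧ γ.face 1 = ContinuousMap.const _ x := by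
  let p : Path x y := PathConnectedSpace.somePath _ _
  let ψ : C(ℝ, X) := ⟨p.extend, p.continuous_extend⟩
  refine ⟨pathSimplex ψ, ?_, ?_⟩
  · rw [pathSimplex_face_zero]
    congr 1
    exact p.extend_one
  · rw [pathSimplex_face_one]
    congr 1
    exact p.extend_zero

theorem singularCoboundary_hom {n : ℕ} {A : ModuleCat.{u} R} (k : (singChains R X).X n ⟶ A) :
    singularCoboundary (fun σ : SingularSimplex n X => k (singBasis R σ)) =
      fun σ => ((singChains R X).d (n + 1) n ≫ k) (singBasis R σ) := by
  funext σ
  simp only [ModuleCat.hom_comp, LinearMap.comp_apply, singBasis_d, map_sum, map_zsmul]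
  rfl

theorem d_comp_eq_zero_iff {n : ℕ} {A : ModuleCat.{u} R} (k : (singChains R X).X n ⟶ A) :
    singularCoboundary (fun σ : SingularSimplex n X => k (singBasis R σ)) = 0 ↔
      (singChains R X).d (n + 1) n ≫ k = 0 := by
  rw [singularCoboundary_hom]
  refine ⟨fun h => singChains_hom_ext fun σ => congrFun h σ, fun h => ?_⟩
  rw [h]
  rfl

variable [PathConnectedSpace X]

/-- `P` sends a point to minus a path from a fixed base point to it; the contributions of the base
point cancel in `P` of a boundary. -/
theorem exists_coneHom : ∃ P : (singChains R X).X 0 ⟶ (singChains R X).X 1,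
    (singChains R X).d 1 0 ≫ P ≫ (singChains R X).d 1 0 = - (singChains R X).d 1 0 := by
  choose p hp0 hp1 using exists_simplex_of_faces (Classical.arbitrary X)
  obtain ⟨P, hP⟩ := exists_singChains_hom (R := R)
    (fun x : SingularSimplex 0 X => - singBasis R (p (x default)))
  have hc : ∀ x : SingularSimplex 0 X, ContinuousMap.const _ (x default) = x := fun x => by
    ext t
    obtain rfl : t = default := Subsingleton.elim _ _
    rfl
  refine ⟨P, singChains_hom_ext fun σ => ?_⟩
  have e1 : ∀ σ : SingularSimplex 1 X, (singChains R X).d 1 0 (singBasis R σ) =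
      singBasis R (σ.face 0) - singBasis R (σ.face 1) := by
    intro σ
    rw [singBasis_d]
    simp [Fin.sum_univ_two, sub_eq_add_neg]
  simp only [ModuleCat.hom_comp, LinearMap.comp_apply, ModuleCat.hom_neg, LinearMap.neg_apply, e1,
    map_sub, hP, map_neg, hp0, hp1, hc]
  abel

/-- A path is closed up through the base point, which makes this a projection onto the one-cycles.
-/
def cycleProj : (singChains R X).X 1 ⟶ (singChains R X).X 1 :=
  𝟙 _ + (singChains R X).d 1 0 ≫ exists_coneHom.choose

theorem cycleProj_d : cycleProj (R := R) (X := X) ≫ (singChains R X).d 1 0 = 0 := by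
  simp [cycleProj, exists_coneHom.choose_spec]

/-- This extends the class map from cycles to all one-chains, so that it can serve as a universal
one-cocycle. -/
def tautHom : (singChains R X).X 1 ⟶ (singChains R X).homology 1 :=
  (singChains R X).liftCycles cycleProj 0 (by simp) cycleProj_d ≫ (singChains R X).homologyπ 1

theorem iCycles_tautHom :
    (singChains R X).iCycles 1 ≫ tautHom (R := R) (X := X) = (singChains R X).homologyπ 1 := by
  have : (singChains R X).iCycles 1 ≫ (singChains R X).liftCycles cycleProj 0 (by simp) cycleProj_d
      = 𝟙 _ := by
    rw [← cancel_mono ((singChains R X).iCycles 1)]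
    simp [cycleProj]
  rw [tautHom]
  erw [reassoc_of% this]

theorem d_tautHom : (singChains R X).d 2 1 ≫ tautHom (R := R) (X := X) = 0 := by
  rw [← HomologicalComplex.toCycles_i]
  rw [Category.assoc]
  erw [iCycles_tautHom]
  exact HomologicalComplex.toCycles_comp_homologyπ _ _ _

variable (R X) in
/-- The tautological one-cocycle with values in the first homology. -/
def tautCocycle (γ : SingularSimplex 1 X) : (singChains R X).homology 1 :=
  tautHom (R := R) (X := X) (singBasis R γ)

theorem singularCoboundary_tautCocycle : singularCoboundary (tautCocycle R X) = 0 :=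
  (d_comp_eq_zero_iff _).2 d_tautHom

/-- A cocycle descends to a map `φ` on homology, and `tautHom ≫ φ` is `cycleProj ≫ k`, which differs
from `k` by the coboundary term in the definition of `cycleProj`. -/
theorem exists_eq_comp_iCycles {A : ModuleCat.{u} R} (k : (singChains R X).X 1 ⟶ A)
    (hk : (singChains R X).d 2 1 ≫ k = 0) : ∃ φ : (singChains R X).homology 1 ⟶ A,
      (singChains R X).homologyπ 1 ≫ φ = (singChains R X).iCycles 1 ≫ k ∧
      k = tautHom ≫ φ - (singChains R X).d 1 0 ≫ exists_coneHom.choose ≫ k := by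
  refine ⟨(singChains R X).homologyι 1 ≫ (singChains R X).descOpcycles k 2 (by simp) hk, ?_, ?_⟩
  · erw [HomologicalComplex.homology_π_ι_assoc]
    simp
  · rw [tautHom]
    erw [Category.assoc]
    erw [HomologicalComplex.homology_π_ι_assoc]
    simp [cycleProj]

/-- This is the part H¹(X, A) = Hom(H₁(X), A) of universal coefficients, in terms of cochains. -/
theorem exists_eq_comp_tautCocycle {A : Type u} [AddCommGroup A] [Module R A]
    (k : SingularSimplex 1 X → A) (hk : singularCoboundary k = 0) :
    ∃ (φ : (singChains R X).homology 1 →ₗ[R] A) (u : SingularSimplex 0 X → A),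
      ∀ γ, k γ = φ (tautCocycle R X γ) + singularCoboundary u γ := by
  obtain ⟨k', hk'⟩ := exists_singChains_hom (R := R) (A := ModuleCat.of R A) k
  obtain rfl : (fun γ => k' (singBasis R γ)) = k := funext hk'
  obtain ⟨φ, -, h⟩ := exists_eq_comp_iCycles k' ((d_comp_eq_zero_iff k').1 hk)
  refine ⟨φ.hom, fun x => - (exists_coneHom.choose ≫ k') (singBasis R x), fun γ => ?_⟩
  have h1 := singularCoboundary_hom (-(exists_coneHom.choose ≫ k'))
  have h2 := congrFun h1 γ
  have h3 := congrArg (fun f => f.hom (singBasis R γ)) h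
  refine h3.trans ?_
  refine Eq.trans ?_ (congrArg (fun a => φ.hom (tautCocycle R X γ) + a) h2.symm)
  simp only [ModuleCat.hom_comp, ModuleCat.hom_neg,
    LinearMap.comp_apply, LinearMap.neg_apply, sub_eq_add_neg]
  rfl

/-- A coboundary vanishes on cycles, where the tautological cocycle is the surjection onto homology.
-/
theorem eq_zero_of_comp_tautCocycle_eq {A : Type u} [AddCommGroup A] [Module R A]
    (φ : (singChains R X).homology 1 →ₗ[R] A) (u : SingularSimplex 0 X → A)
    (h : ∀ γ, φ (tautCocycle R X γ) = singularCoboundary u γ) : φ = 0 := by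
  obtain ⟨u', hu'⟩ := exists_singChains_hom (R := R) (A := ModuleCat.of R A) u
  obtain rfl : (fun γ => u' (singBasis R γ)) = u := funext hu'
  obtain ⟨Φ, rfl⟩ : ∃ Φ : (singChains R X).homology 1 ⟶ ModuleCat.of R A, Φ.hom = φ :=
    ⟨ModuleCat.ofHom φ, rfl⟩
  have h1 : tautHom ≫ Φ = (singChains R X).d 1 0 ≫ u' :=
    singChains_hom_ext fun γ => (h γ).trans (congrFun (singularCoboundary_hom u') γ)
  have h3 : Φ = 0 := by
    rw [← cancel_epi ((singChains R X).homologyπ 1), ← iCycles_tautHom, Category.assoc, h1]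
    simp
  rw [h3, ModuleCat.hom_zero]

/-- The two cocycles induce the same map on homology, by naturality of the class of a cycle; the
coboundary comes from the choice of paths to the base point. -/
theorem tautCocycle_comp (f : X ⟶ X) {A : Type u} [AddCommGroup A] [Module R A]
    (φ : (singularH1.{u} R).obj X →ₗ[R] A) : ∃ u : SingularSimplex 0 X → A,
      ∀ γ, φ (tautCocycle R X (f.hom.comp γ)) =
        φ (((singularH1.{u} R).map f).hom (tautCocycle R X γ)) + singularCoboundary u γ := by
  let F : singChains R X ⟶ singChains R X :=
    SSet.chainComplexMap (TopCat.toSSet.map f) (ModuleCat.of R (ULift.{u} R))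
  obtain ⟨Φ, hΦ⟩ : ∃ Φ : (singChains R X).homology 1 ⟶ ModuleCat.of R A, Φ.hom = φ :=
    ⟨ModuleCat.ofHom φ, rfl⟩
  let k : (singChains R X).X 1 ⟶ ModuleCat.of R A := F.f 1 ≫ tautHom ≫ Φ
  have hk : (singChains R X).d 2 1 ≫ k = 0 := by
    rw [← HomologicalComplex.Hom.comm_assoc, reassoc_of% d_tautHom (R := R) (X := X)]
    simp
  obtain ⟨φ', h1, h2⟩ := exists_eq_comp_iCycles k hk
  have h3 : φ' = HomologicalComplex.homologyMap F 1 ≫ Φ := by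
    rw [← cancel_epi ((singChains R X).homologyπ 1), h1,
      HomologicalComplex.homologyπ_naturality_assoc, ← iCycles_tautHom, Category.assoc,
      HomologicalComplex.cyclesMap_i_assoc]
  refine ⟨fun x => - (exists_coneHom.choose ≫ k) (singBasis R x), fun γ => ?_⟩
  have e1 := singularCoboundary_hom (-(exists_coneHom.choose ≫ k))
  have e2 := congrFun e1 γ
  have e3 := congrArg (fun f => f.hom (singBasis R γ)) h2
  have e4 : k.hom (singBasis R γ) = φ (tautCocycle R X (f.hom.comp γ)) := by
    rw [← hΦ]
    exact congrArg (fun x => Φ.hom ((tautHom (R := R) (X := X)).hom x)) (singBasis_map R f γ)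
  rw [← e4]
  refine e3.trans ?_
  refine Eq.trans ?_ (congrArg (fun a => φ _ + a) e2.symm)
  rw [h3, ← hΦ]
  simp only [ModuleCat.hom_comp, ModuleCat.hom_neg,
    LinearMap.comp_apply, LinearMap.neg_apply, sub_eq_add_neg]
  rfl

end SingularChains

/-! ### One-cocycles and their local primitives -/

section Cocycles

open Filter Topology

variable {X : Type*} [TopologicalSpace X] {G : Type*} [AddCommGroup G]

theorem singularCoboundary_zero_apply (u : SingularSimplex 0 X → G) (γ : SingularSimplex 1 X) :
    singularCoboundary u γ = u (γ.face 0) - u (γ.face 1) := by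
  simp [singularCoboundary, Fin.sum_univ_two, sub_eq_add_neg]

theorem singularCoboundary_one_apply (k : SingularSimplex 1 X → G) (σ : SingularSimplex 2 X) :
    singularCoboundary k σ = k (σ.face 0) - k (σ.face 1) + k (σ.face 2) := by
  simp [singularCoboundary, Fin.sum_univ_three, sub_eq_add_neg]

theorem face_face_zero_zero (σ : SingularSimplex 2 X) : (σ.face 0).face 0 = (σ.face 1).face 0 := by
  ext t
  simp only [SingularSimplex.face, ContinuousMap.comp_apply, ContinuousMap.coe_mk,
    stdSimplex.map_comp_apply]
  congr 2

theorem face_face_two_zero (σ : SingularSimplex 2 X) : (σ.face 2).face 0 = (σ.face 0).face 1 := by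
  ext t
  simp only [SingularSimplex.face, ContinuousMap.comp_apply, ContinuousMap.coe_mk,
    stdSimplex.map_comp_apply]
  congr 2
  ext i
  fin_cases i; rfl

theorem face_face_two_one (σ : SingularSimplex 2 X) : (σ.face 2).face 1 = (σ.face 1).face 1 := by
  ext t
  simp only [SingularSimplex.face, ContinuousMap.comp_apply, ContinuousMap.coe_mk,
    stdSimplex.map_comp_apply]
  congr 2
  ext i
  fin_cases i; rfl

theorem singularCoboundary_singularCoboundary (u : SingularSimplex 0 X → G) :
    singularCoboundary (singularCoboundary u) = 0 := by
  funext σ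
  simp only [singularCoboundary_one_apply, singularCoboundary_zero_apply, face_face_zero_zero,
    face_face_two_zero, face_face_two_one]
  simp

theorem singularCoboundary_sub {n : ℕ} (k l : SingularSimplex n X → G) :
    singularCoboundary (k - l) = singularCoboundary k - singularCoboundary l := by
  funext σ
  simp [singularCoboundary, smul_sub]

theorem singularCoboundary_map {n : ℕ} {G' : Type*} [AddCommGroup G'] (φ : G →+ G')
    (k : SingularSimplex n X → G) :
    singularCoboundary (fun γ => φ (k γ)) = fun σ => φ (singularCoboundary k σ) := by
  funext σ
  simp [singularCoboundary]

theorem cocycle_const {k : SingularSimplex 1 X → G} (hk : singularCoboundary k = 0) (x : X) :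
    k (ContinuousMap.const _ x) = 0 := by
  have h := congrFun hk (ContinuousMap.const _ x)
  rw [singularCoboundary_one_apply] at h
  have e : ∀ i, SingularSimplex.face i (ContinuousMap.const _ x : SingularSimplex 2 X) =
    ContinuousMap.const _ x := fun i => rfl
  simpa [e] using h

/-- The piece of a path between two parameters, as a singular simplex. -/
def pathSegment (ψ : C(ℝ, X)) (a b : ℝ) : SingularSimplex 1 X :=
  ψ.comp ⟨fun t => t 0 * a + t 1 * b, by
    have h : ∀ i : Fin 2, Continuous fun t : stdSimplex ℝ (Fin 2) => t i := fun i =>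
      (continuous_apply i).comp continuous_subtype_val
    exact ((h 0).mul continuous_const).add ((h 1).mul continuous_const)⟩

/-- The three segments are the faces of the affine triangle with vertices `a`, `b`, `c` in ℝ, mapped
by `ψ`. -/
theorem cocycle_pathSegment_add {k : SingularSimplex 1 X → G} (hk : singularCoboundary k = 0)
    (ψ : C(ℝ, X)) (a b c : ℝ) :
    k (pathSegment ψ a c) = k (pathSegment ψ a b) + k (pathSegment ψ b c) := by
  let σ : SingularSimplex 2 X := ψ.comp ⟨fun t => t 0 * a + t 1 * b + t 2 * c, by
    have h : ∀ i : Fin 3, Continuous fun t : stdSimplex ℝ (Fin 3) => t i := fun i =>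
      (continuous_apply i).comp continuous_subtype_val
    exact (((h 0).mul continuous_const).add ((h 1).mul continuous_const)).add
      ((h 2).mul continuous_const)⟩
  have e0 : σ.face 0 = pathSegment ψ b c := by
    ext t
    refine congrArg ψ ?_
    have h0 := stdSimplex_map_succAbove_self 0 t
    have h1 := stdSimplex_map_succAbove_succAbove 0 t 0
    have h2 := stdSimplex_map_succAbove_succAbove 0 t 1
    simp only [ContinuousMap.coe_mk] at h0 h1 h2 ⊢
    erw [h0, h1, h2]
    ring
  have e1 : σ.face 1 = pathSegment ψ a c := by
    ext t
    refine congrArg ψ ?_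
    have h0 := stdSimplex_map_succAbove_self 1 t
    have h1 := stdSimplex_map_succAbove_succAbove 1 t 0
    have h2 := stdSimplex_map_succAbove_succAbove 1 t 1
    simp only [ContinuousMap.coe_mk] at h0 h1 h2 ⊢
    erw [h0, h1, h2]
    ring
  have e2 : σ.face 2 = pathSegment ψ a b := by
    ext t
    refine congrArg ψ ?_
    have h0 := stdSimplex_map_succAbove_self 2 t
    have h1 := stdSimplex_map_succAbove_succAbove 2 t 0
    have h2 := stdSimplex_map_succAbove_succAbove 2 t 1
    simp only [ContinuousMap.coe_mk] at h0 h1 h2 ⊢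
    erw [h0, h1, h2]
    ring
  have h := congrFun hk σ
  rw [singularCoboundary_one_apply, e0, e1, e2] at h
  have h' : k (pathSegment ψ b c) - k (pathSegment ψ a c) + k (pathSegment ψ a b) = 0 := h
  rw [← sub_eq_zero, ← neg_eq_zero, ← h']
  abel

theorem exists_pathSegment_eq (γ : SingularSimplex 1 X) : ∃ ψ : C(ℝ, X), pathSegment ψ 0 1 = γ := by
  refine ⟨⟨fun s => γ (stdSimplexHomeomorphUnitInterval.symm (projIcc 0 1 zero_le_one s)),
    by fun_prop⟩, ?_⟩
  ext t
  refine congrArg γ ?_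
  rw [Homeomorph.symm_apply_eq]
  have : t 0 * 0 + t 1 * 1 = (stdSimplexHomeomorphUnitInterval t : ℝ) := by
    rw [mul_zero, mul_one, zero_add]
    rfl
  simp only [ContinuousMap.coe_mk]
  rw [this, projIcc_val]

/-- A one-cocycle that vanishes on small paths is zero. -/
theorem cocycle_eq_zero_of_small {k : SingularSimplex 1 X → G} (hk : singularCoboundary k = 0)
    (hs : ∀ x, ∃ V ∈ 𝓝 x, ∀ γ : SingularSimplex 1 X, (∀ t, γ t ∈ V) → k γ = 0) : k = 0 := by
  funext γ
  obtain ⟨ψ, rfl⟩ := exists_pathSegment_eq γ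
  -- By additivity the change between nearby parameters is the value of `k` on a small segment,
  -- which is zero.
  have hc : IsLocallyConstant fun s => k (pathSegment ψ 0 s) := by
    rw [IsLocallyConstant.iff_eventually_eq]
    intro s₀
    obtain ⟨V, hV, hkV⟩ := hs (ψ s₀)
    obtain ⟨ε, hε, hb⟩ := Metric.mem_nhds_iff.1 (ψ.continuous.continuousAt.preimage_mem_nhds hV)
    filter_upwards [Metric.ball_mem_nhds s₀ hε] with s hs
    rw [cocycle_pathSegment_add hk ψ 0 s₀ s, add_eq_left, hkV]
    intro t
    refine hb ((convex_ball s₀ ε) (Metric.mem_ball_self hε) hs (t.2.1 0) (t.2.1 1) ?_)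
    exact (Fin.sum_univ_two _).symm.trans t.2.2
  have h := hc.apply_eq_of_preconnectedSpace 1 0
  have h0 : pathSegment ψ 0 0 = ContinuousMap.const _ (ψ 0) := by
    ext t
    exact congrArg ψ (by simp)
  simpa [h0, cocycle_const hk] using h

/-- A function that differs from local functions `g i` by constants exists along any continuous map
from a simply connected space. -/
theorem exists_lift_of_locallyConstant (U : X → Set X) (hU : ∀ i, IsOpen (U i))
    (hxU : ∀ x, x ∈ U x) (g : X → X → G)
    (hg : ∀ i j, ∀ x ∈ U i ∩ U j, ∀ᶠ y in 𝓝 x, g i y - g j y = g i x - g j x)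
    {A : Type*} [TopologicalSpace A] [SimplyConnectedSpace A] [LocallyPathConnectedSpace A]
    (σ : C(A, X)) : ∃ z : A → G, ∀ t₀ i, σ t₀ ∈ U i →
      ∀ᶠ t in 𝓝 t₀, z t - g i (σ t) = z t₀ - g i (σ t₀) := by
  let _ : TopologicalSpace G := ⊥
  have : DiscreteTopology G := ⟨rfl⟩
  -- The local functions are glued to a covering space with discrete fibre `G`; the change of
  -- coordinates is continuous exactly because `g i - g j` is locally constant.
  let Z : FiberBundleCore X X G :=
    { baseSet := U
      isOpen_baseSet := hU
      indexAt := id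
      mem_baseSet_at := hxU
      coordChange := fun i j x v => v + (g i x - g j x)
      coordChange_self := by simp
      continuousOn_coordChange := by
        rintro i j ⟨x, v⟩ ⟨hx, -⟩
        refine ContinuousAt.continuousWithinAt ?_
        refine continuousAt_snd.add ?_
        refine ContinuousAt.comp (f := Prod.fst) (g := fun y => g i y - g j y) ?_ continuousAt_fst
        exact (continuousAt_const (y := g i x - g j x)).congr
          ((hg i j x hx).mono fun y hy => hy.symm)
      coordChange_comp := by
        intro i j k x _ v
        show v + (g i x - g j x) + (g j x - g k x) = v + (g i x - g k x)
        abel }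
  have cov : IsCoveringMap (Bundle.TotalSpace.proj : Z.TotalSpace → X) :=
    FiberBundle.isCoveringMap
  obtain ⟨a₀⟩ : Nonempty A := inferInstance
  obtain ⟨Γ, ⟨-, hΓ⟩, -⟩ := cov.existsUnique_continuousMap_lifts σ a₀ ⟨σ a₀, (0 : G)⟩ rfl
  have hΓ' : ∀ t, (Γ t).proj = σ t := fun t => congrFun hΓ t
  -- With this choice the fibre coordinate of the lift `Γ` in chart `i` is `z - g i ∘ σ`. It is
  -- continuous into a discrete space, hence locally constant.
  refine ⟨fun t => (show G from (Γ t).2) + g (Γ t).proj (Γ t).proj, fun t₀ i hi => ?_⟩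
  have hc : ContinuousAt (fun t => (Z.localTriv i (Γ t)).2) t₀ := by
    refine continuousAt_snd.comp (ContinuousAt.comp (f := Γ) ?_ Γ.continuous.continuousAt)
    refine (Z.localTriv i).continuousAt ?_
    rw [Z.mem_localTriv_source, hΓ']
    exact hi
  have := hc.eventually_mem (isOpen_discrete ({(Z.localTriv i (Γ t₀)).2} : Set G)|>.mem_nhds rfl)
  filter_upwards [this] with t ht
  have key : ∀ t, (Z.localTriv i (Γ t)).2 =
      (show G from (Γ t).2) + g (Γ t).proj (Γ t).proj - g i (σ t) := by
    intro t
    rw [← hΓ' t]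
    exact (add_sub_assoc _ _ _).symm
  rw [mem_singleton_iff, key, key] at ht
  exact ht

instance (n : ℕ) : LocallyPathConnectedSpace (stdSimplex ℝ (Fin (n + 1))) :=
  (convex_stdSimplex ℝ _).locallyPathConnectedSpace

instance (n : ℕ) : ContractibleSpace (stdSimplex ℝ (Fin (n + 1))) :=
  (convex_stdSimplex ℝ _).contractibleSpace ⟨_, single_mem_stdSimplex ℝ 0⟩

/-- The difference of two lifts is locally constant on a connected space, so increments do not
depend on the lift. -/
theorem eq_of_locally_eq_sub (U : X → Set X) (hxU : ∀ x, x ∈ U x) (g : X → X → G)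
    {A : Type*} [TopologicalSpace A] [PreconnectedSpace A] (σ : C(A, X)) {z z' : A → G}
    (hz : ∀ t₀ i, σ t₀ ∈ U i → ∀ᶠ t in 𝓝 t₀, z t - g i (σ t) = z t₀ - g i (σ t₀))
    (hz' : ∀ t₀ i, σ t₀ ∈ U i → ∀ᶠ t in 𝓝 t₀, z' t - g i (σ t) = z' t₀ - g i (σ t₀))
    (s t : A) : z s - z t = z' s - z' t := by
  have hc : IsLocallyConstant fun t => z t - z' t := by
    rw [IsLocallyConstant.iff_eventually_eq]
    intro t₀
    filter_upwards [hz t₀ _ (hxU _), hz' t₀ _ (hxU _)] with t h1 h2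
    have h3 := congrArg₂ (· - ·) h1 h2
    simpa using h3
  have h := hc.apply_eq_of_preconnectedSpace s t
  rw [sub_eq_sub_iff_add_eq_add] at h ⊢
  rw [h, add_comm]

/-- Local functions whose differences are locally constant are the local primitives of a
one-cocycle. -/
theorem exists_cocycle_of_locallyConstant (U : X → Set X) (hU : ∀ i, IsOpen (U i))
    (hxU : ∀ x, x ∈ U x) (g : X → X → G)
    (hg : ∀ i j, ∀ x ∈ U i ∩ U j, ∀ᶠ y in 𝓝 x, g i y - g j y = g i x - g j x) :
    ∃ k : SingularSimplex 1 X → G, singularCoboundary k = 0 ∧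
      ∀ i (γ : SingularSimplex 1 X), (∀ t, γ t ∈ U i) →
        k γ = g i (γ (stdSimplex.vertex 1)) - g i (γ (stdSimplex.vertex 0)) := by
  choose z hz using fun γ : SingularSimplex 1 X => exists_lift_of_locallyConstant U hU hxU g hg γ
  refine ⟨fun γ => z γ (stdSimplex.vertex 1) - z γ (stdSimplex.vertex 0), ?_, ?_⟩
  · funext σ
    -- One lift over the whole triangle computes the increments on all three faces, and these
    -- telescope.
    obtain ⟨w, hw⟩ := exists_lift_of_locallyConstant U hU hxU g hg σ
    have key : ∀ i, z (σ.face i) (stdSimplex.vertex 1) - z (σ.face i) (stdSimplex.vertex 0) =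
        w (stdSimplex.vertex (i.succAbove 1)) - w (stdSimplex.vertex (i.succAbove 0)) := by
      intro i
      rw [← stdSimplex.map_vertex (S := ℝ) i.succAbove, ← stdSimplex.map_vertex (S := ℝ) i.succAbove]
      refine eq_of_locally_eq_sub U hxU g (σ.face i) (hz _)
        (z' := fun t => w (stdSimplex.map i.succAbove t)) (fun t₀ j hj => ?_) _ _
      exact (stdSimplex.continuous_map (S := ℝ) i.succAbove).continuousAt.eventually (hw _ j hj)
    rw [singularCoboundary_one_apply, key, key, key]
    have e : ((2 : Fin 3).succAbove (1 : Fin 2)) = 1 := rfl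
    have e' : ((1 : Fin 3).succAbove (1 : Fin 2)) = 2 := rfl
    have e'' : ((0 : Fin 3).succAbove (1 : Fin 2)) = 2 := rfl
    have f : ((2 : Fin 3).succAbove (0 : Fin 2)) = 0 := rfl
    have f' : ((1 : Fin 3).succAbove (0 : Fin 2)) = 0 := rfl
    have f'' : ((0 : Fin 3).succAbove (0 : Fin 2)) = 1 := rfl
    rw [e, e', e'', f, f', f'']
    simp
  · intro i γ hγ
    exact eq_of_locally_eq_sub U hxU g γ (hz γ) (z' := fun t => g i (γ t))
      (fun t₀ j hj => γ.continuous.continuousAt.eventually (hg i j _ ⟨hγ t₀, hj⟩)) _ _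

end Cocycles

/-! ### Local primitives of cocycles on a coned cover -/

section LocalPrimitives

open Filter Topology

/-- An open cover with paths `r i y`, for `y ∈ U i`, over which all paths in `U i` can be coned. -/
structure IsConedCover {X : Type*} [TopologicalSpace X] (U : X → Set X)
    (r : X → X → SingularSimplex 1 X) : Prop where
  isOpen : ∀ i, IsOpen (U i)
  mem : ∀ x, x ∈ U x
  cone : ∀ i (γ : SingularSimplex 1 X), (∀ t, γ t ∈ U i) → ∃ σ : SingularSimplex 2 X,
    σ.face 0 = γ ∧ σ.face 1 = r i (γ (stdSimplex.vertex 1)) ∧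
      σ.face 2 = r i (γ (stdSimplex.vertex 0))

variable {X : Type*} [TopologicalSpace X] {U : X → Set X} {r : X → X → SingularSimplex 1 X}
  {G : Type*} [AddCommGroup G]

theorem IsConedCover.cocycle_eq (hU : IsConedCover U r) {k : SingularSimplex 1 X → G}
    (hk : singularCoboundary k = 0) (i : X) (γ : SingularSimplex 1 X) (hγ : ∀ t, γ t ∈ U i) :
    k γ = k (r i (γ (stdSimplex.vertex 1))) - k (r i (γ (stdSimplex.vertex 0))) := by
  obtain ⟨σ, h0, h1, h2⟩ := hU.cone i γ hγ
  have h := congrFun hk σ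
  rw [singularCoboundary_one_apply, h0, h1, h2] at h
  rw [← sub_eq_zero]
  refine Eq.trans ?_ h
  abel

/-- The function `k` on paths in the intersection of two members of a cover is the difference of
local primitives, so these differ by a locally constant function. -/
theorem eventually_sub_eq_sub [LocallyPathConnectedSpace X] {g g' : X → G} {V : Set X}
    (hV : IsOpen V) {k : SingularSimplex 1 X → G}
    (hg : ∀ γ : SingularSimplex 1 X, (∀ t, γ t ∈ V) →
      k γ = g (γ (stdSimplex.vertex 1)) - g (γ (stdSimplex.vertex 0)))
    (hg' : ∀ γ : SingularSimplex 1 X, (∀ t, γ t ∈ V) →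
      k γ = g' (γ (stdSimplex.vertex 1)) - g' (γ (stdSimplex.vertex 0)))
    {x : X} (hx : x ∈ V) : ∀ᶠ y in 𝓝 x, g y - g' y = g x - g' x := by
  obtain ⟨W, ⟨hW, hWc⟩, hWV⟩ := (path_connected_basis x).mem_iff.1 (hV.mem_nhds hx)
  filter_upwards [hW] with y hy
  obtain ⟨p, hp⟩ := hWc.joinedIn x (mem_of_mem_nhds hW) y hy
  let γ : SingularSimplex 1 X := (⟨p, p.continuous⟩ : C(unitInterval, X)).comp
    ⟨stdSimplexHomeomorphUnitInterval, stdSimplexHomeomorphUnitInterval.continuous⟩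
  have h1 : γ (stdSimplex.vertex 1) = y := p.target
  have h0 : γ (stdSimplex.vertex 0) = x := p.source
  have hγ : ∀ t, γ t ∈ V := fun t => hWV (hp _)
  have h := (hg γ hγ).symm.trans (hg' γ hγ)
  rw [h1, h0] at h
  rw [sub_eq_sub_iff_sub_eq_sub]
  exact h

/-- On the overlap the values on radial paths of either kind are primitives of the same cocycle. -/
theorem IsConedCover.locallyConstant [LocallyPathConnectedSpace X] (hU : IsConedCover U r)
    {k : SingularSimplex 1 X → G} (hk : singularCoboundary k = 0) (i j : X) {x : X}
    (hx : x ∈ U i ∩ U j) :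
    ∀ᶠ y in 𝓝 x, k (r i y) - k (r j y) = k (r i x) - k (r j x) :=
  eventually_sub_eq_sub (g := fun y => k (r i y)) (g' := fun y => k (r j y))
    ((hU.isOpen i).inter (hU.isOpen j))
    (fun γ hγ => hU.cocycle_eq hk i γ fun t => (hγ t).1)
    (fun γ hγ => hU.cocycle_eq hk j γ fun t => (hγ t).2) hx

theorem finite_image_of_locallyConstant {Y : Type*} {K : Set X} (hK : IsCompact K) {g : X → Y}
    (hg : ∀ x ∈ K, ∀ᶠ y in 𝓝 x, g y = g x) : (g '' K).Finite := by
  let _ : TopologicalSpace Y := ⊥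
  have : DiscreteTopology Y := ⟨rfl⟩
  refine (hK.image_of_continuousOn fun x hx => ContinuousAt.continuousWithinAt ?_).finite_of_discrete
  exact (continuousAt_const (y := g x)).congr ((hg x hx).mono fun y hy => hy.symm)

theorem face_zero_eq (γ : SingularSimplex 1 X) :
    γ.face 0 = ContinuousMap.const _ (γ (stdSimplex.vertex 1)) := by
  ext t
  obtain rfl : t = stdSimplex.vertex 0 := Subsingleton.elim _ _
  exact congrArg γ (stdSimplex.map_vertex _ _)

theorem face_one_eq (γ : SingularSimplex 1 X) :
    γ.face 1 = ContinuousMap.const _ (γ (stdSimplex.vertex 0)) := by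
  ext t
  obtain rfl : t = stdSimplex.vertex 0 := Subsingleton.elim _ _
  exact congrArg γ (stdSimplex.map_vertex _ _)

theorem singularCoboundary_eq_vertex (u : SingularSimplex 0 X → G) (γ : SingularSimplex 1 X) :
    singularCoboundary u γ = u (ContinuousMap.const _ (γ (stdSimplex.vertex 1))) -
      u (ContinuousMap.const _ (γ (stdSimplex.vertex 0))) := by
  rw [singularCoboundary_zero_apply, face_zero_eq, face_one_eq]

end LocalPrimitives

/-! ### Finiteness of H₁ and the cohomological equation for f -/

section Homology

open CategoryTheory Filter Topology

variable {X : TopCat.{u}} [T2Space X] [CompactSpace X] [LocallyPathConnectedSpace X]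
  [PathConnectedSpace X] {U : X → Set X} {r : X → X → SingularSimplex 1 X}

/-- The tautological cocycle has radial primitives on finitely many compact sets that cover `X`. On
overlaps these differ by locally constant functions, which take finitely many values, and the values
generate H₁. -/
theorem finite_homology_one (R : Type) [CommRing R] (hU : IsConedCover U r) :
    Module.Finite R ((singChains R X).homology 1) := by
  choose K hK hKU hKc using fun x : X =>
    LocallyCompactSpace.local_compact_nhds x (U x) ((hU.isOpen x).mem_nhds (hU.mem x))
  obtain ⟨T, hT⟩ := CompactSpace.elim_nhds_subcover (fun x => interior (K x))
    fun x => interior_mem_nhds.2 (hK x)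
  let h := tautCocycle R X
  have hh : singularCoboundary h = 0 := singularCoboundary_tautCocycle
  let s : Set ((singChains R X).homology 1) :=
    ⋃ i ∈ T, ⋃ j ∈ T, (fun y => h (r i y) - h (r j y)) '' (K i ∩ K j)
  have hs : s.Finite := by
    refine T.finite_toSet.biUnion fun i _ => T.finite_toSet.biUnion fun j _ => ?_
    exact finite_image_of_locallyConstant ((hKc i).inter (hKc j)) fun y hy =>
      hU.locallyConstant hh i j ⟨hKU i hy.1, hKU j hy.2⟩
  let S := Submodule.span R s
  have hTx : ∀ y, ∃ i ∈ T, y ∈ interior (K i) := fun y => by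
    have : y ∈ ⋃ x ∈ T, interior (K x) := hT ▸ mem_univ y
    simpa using this
  choose c hcT hc using hTx
  let q : (singChains R X).homology 1 →ₗ[R] _ := S.mkQ
  have hq : ∀ i ∈ T, ∀ y ∈ K i, q (h (r i y)) = q (h (r (c y) y)) := fun i hi y hy => by
    refine (Submodule.Quotient.eq S).2 (Submodule.subset_span ?_)
    simp only [s, mem_iUnion]
    exact ⟨i, hi, c y, hcT y, y, ⟨hy, interior_subset (hc y)⟩, rfl⟩
  let u : SingularSimplex 0 X → _ := fun x => q (h (r (c (x default)) (x default)))
  -- Modulo the span of the transition values, the local primitives fit together to the global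
  -- function `u`. So the cocycle becomes a coboundary in the quotient, which forces the quotient
  -- map to be zero.
  have key : (fun γ => q (h γ)) - singularCoboundary u = 0 := by
    refine cocycle_eq_zero_of_small ?_ fun x => ⟨interior (K (c x)),
      isOpen_interior.mem_nhds (hc x), fun γ hγ => ?_⟩
    · rw [singularCoboundary_sub, singularCoboundary_singularCoboundary, sub_zero]
      have := singularCoboundary_map q.toAddMonoidHom h
      rw [hh] at this
      refine this.trans ?_
      funext σ
      exact map_zero q
    · have h1 := hU.cocycle_eq hh (c x) γ fun t => hKU _ (interior_subset (hγ t))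
      rw [Pi.sub_apply, singularCoboundary_eq_vertex, h1, map_sub,
        hq _ (hcT x) _ (interior_subset (hγ _)), hq _ (hcT x) _ (interior_subset (hγ _))]
      exact sub_self _
  have hq0 : q = 0 := eq_zero_of_comp_tautCocycle_eq q u fun γ => sub_eq_zero.1 (congrFun key γ)
  refine ⟨(Submodule.fg_def).2 ⟨s, hs, ?_⟩⟩
  have : LinearMap.ker S.mkQ = ⊤ := by
    rw [show S.mkQ = 0 from hq0, LinearMap.ker_zero]
  rwa [Submodule.ker_mkQ] at this

/-- A flat circle-valued class becomes a coboundary after adding `f^* e - e` for a suitable real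
cocycle `e`. -/
theorem exists_real_cocycle (hU : IsConedCover U r) (f : C(X, X)) (hf : HomologyAssumption f)
    (κ : X → X → AddCircle (1 : ℝ))
    (hκ : ∀ i j, ∀ x ∈ U i ∩ U j, ∀ᶠ y in 𝓝 x, κ i y - κ j y = κ i x - κ j x) :
    ∃ e : SingularSimplex 1 X → ℝ, singularCoboundary e = 0 ∧ ∃ u : X → AddCircle (1 : ℝ),
      ∀ i (γ : SingularSimplex 1 X), (∀ t, γ t ∈ U i) →
        κ i (γ (stdSimplex.vertex 1)) - κ i (γ (stdSimplex.vertex 0)) +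
          ((e (f.comp γ) - e γ : ℝ) : AddCircle (1 : ℝ)) =
        u (γ (stdSimplex.vertex 1)) - u (γ (stdSimplex.vertex 0)) := by
  obtain ⟨k, hk, hkγ⟩ := exists_cocycle_of_locallyConstant U hU.isOpen hU.mem κ hκ
  -- lift the circle-valued cocycle to a real one
  obtain ⟨φ, u₁, h₁⟩ := exists_eq_comp_tautCocycle (R := ℤ) (A := ULift.{u} (AddCircle (1 : ℝ)))
    (fun γ => ULift.up (k γ)) (by
      have := singularCoboundary_map
        (AddEquiv.ulift.{0, u} (α := AddCircle (1 : ℝ))).symm.toAddMonoidHom k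
      rw [hk] at this
      exact this)
  -- Finitely generated and torsion free over ℤ implies free, hence projective; this lifts `φ`
  -- through ℝ → ℝ/ℤ.
  have : Module.Finite ℤ ((singChains ℤ X).homology 1) := finite_homology_one ℤ hU
  have : Module.IsTorsionFree ℤ ((singChains ℤ X).homology 1) := hf.1
  have : Module.Free ℤ ((singChains ℤ X).homology 1) := Module.free_of_finite_type_torsion_free'
  let mk : ULift.{u} ℝ →ₗ[ℤ] ULift.{u} (AddCircle (1 : ℝ)) :=
    AddMonoidHom.toIntLinearMap
      { toFun := fun x => ULift.up (x.down : AddCircle (1 : ℝ))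
        map_zero' := rfl
        map_add' := fun _ _ => rfl }
  have hmk : Function.Surjective mk := by
    rintro ⟨x⟩
    obtain ⟨y, rfl⟩ := QuotientAddGroup.mk_surjective x
    exact ⟨⟨y⟩, rfl⟩
  obtain ⟨Φ, hΦ⟩ := Module.projective_lifting_property mk φ hmk
  -- The lifted homomorphism, seen as a real cocycle, is represented by a functional on real
  -- homology, where the eigenvalue assumption applies.
  obtain ⟨θ, u₂, h₂⟩ := exists_eq_comp_tautCocycle (R := ℝ) (A := ULift.{u} ℝ)
    (fun γ => Φ (tautCocycle ℤ X γ)) (by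
      have := singularCoboundary_map Φ.toAddMonoidHom (tautCocycle ℤ X)
      rw [singularCoboundary_tautCocycle] at this
      refine this.trans ?_
      funext σ
      exact map_zero Φ)
  let F : (singChains ℝ X).homology 1 →ₗ[ℝ] (singChains ℝ X).homology 1 :=
    ((singularH1.{u} ℝ).map (TopCat.ofHom f)).hom
  have hF : LinearMap.ker (F - LinearMap.id) = ⊥ := by
    by_contra hne
    refine hf.2 ?_
    rw [Module.End.hasEigenvalue_iff, Module.End.eigenspace_def]
    rw [one_smul]
    exact hne
  -- Over a field the injective map `F - 1` has a left inverse, and `-θ ∘ g` then solves the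
  -- equation for `ε`.
  obtain ⟨g, hg⟩ := (F - LinearMap.id).exists_leftInverse_of_injective hF
  let ε := -(θ.comp g)
  have hε : ∀ a, ε (F a) - ε a = - θ a := fun a => by
    rw [← map_sub]
    exact congrArg (fun b => - θ b) (LinearMap.congr_fun hg a)
  obtain ⟨u₃, h₃⟩ := tautCocycle_comp (R := ℝ) (X := X) (TopCat.ofHom f) ε
  refine ⟨fun γ => (ε (tautCocycle ℝ X γ)).down, ?_, fun x =>
    (u₁ (ContinuousMap.const _ x)).down +
      ((u₂ (ContinuousMap.const _ x)).down + (u₃ (ContinuousMap.const _ x)).down : ℝ),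
    fun i γ hγ => ?_⟩
  · have := singularCoboundary_map
      (AddEquiv.ulift.{0, u} (α := ℝ).toAddMonoidHom.comp ε.toAddMonoidHom) (tautCocycle ℝ X)
    rw [singularCoboundary_tautCocycle] at this
    refine this.trans ?_
    funext σ
    exact map_zero (AddEquiv.ulift.{0, u} (α := ℝ).toAddMonoidHom.comp ε.toAddMonoidHom)
  · rw [← hkγ i γ hγ]
    have a1 := congrArg ULift.down (h₁ γ)
    have a2 := congrArg ULift.down (h₂ γ)
    have a3 := congrArg ULift.down (h₃ γ)
    have a4 := congrArg ULift.down (hε (tautCocycle ℝ X γ))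
    have a5 : ((Φ (tautCocycle ℤ X γ)).down : AddCircle (1 : ℝ)) = (φ (tautCocycle ℤ X γ)).down :=
      congrArg ULift.down (LinearMap.congr_fun hΦ (tautCocycle ℤ X γ))
    rw [singularCoboundary_eq_vertex] at a1 a2 a3
    simp only [ULift.add_down, ULift.sub_down, ULift.neg_down] at a1 a2 a3 a4
    have a6 : (ε (tautCocycle ℝ X (f.comp γ))).down - (ε (tautCocycle ℝ X γ)).down =
        - (Φ (tautCocycle ℤ X γ)).down +
        (((u₂ (ContinuousMap.const _ (γ (stdSimplex.vertex 1)))).down +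
          (u₃ (ContinuousMap.const _ (γ (stdSimplex.vertex 1)))).down) -
        ((u₂ (ContinuousMap.const _ (γ (stdSimplex.vertex 0)))).down +
          (u₃ (ContinuousMap.const _ (γ (stdSimplex.vertex 0)))).down)) := by
      have a7 : (ε (tautCocycle ℝ X (f.comp γ))).down = (ε (F (tautCocycle ℝ X γ))).down + _ := a3
      linarith
    rw [a6, a1, ← a5]
    simp only [AddCircle.coe_add, AddCircle.coe_sub, AddCircle.coe_neg]
    abel

end Homology

/-! ### Smoothness of integrals that depend on a parameter -/

section ParametricIntegral

open Filter Topology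

variable {E F : Type*} [NormedAddCommGroup E] [NormedSpace ℝ E] [FiniteDimensional ℝ E]
  [NormedAddCommGroup F] [NormedSpace ℝ F]

theorem hasFDerivAt_parametric_integral {K : E × ℝ → F} {O : Set (E × ℝ)}
    (hO : IsOpen O) (hK : ContDiffOn ℝ 1 K O) {y : E} (hy : ∀ t ∈ Icc (0 : ℝ) 1, (y, t) ∈ O) :
    HasFDerivAt (fun y => ∫ t in (0 : ℝ)..1, K (y, t))
      (∫ t in (0 : ℝ)..1, (fderiv ℝ K (y, t)).comp (.inl ℝ E ℝ)) y := by
  have hK' : ContinuousOn (fun p => (fderiv ℝ K p).comp (.inl ℝ E ℝ)) O :=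
    (hK.continuousOn_fderiv_of_isOpen hO le_rfl).clm_comp continuousOn_const
  -- A compact tube around `{y} × [0,1]` inside `O` gives a uniform bound on the derivative, as
  -- domination requires.
  obtain ⟨W, J, hW, hJ, hyW, hIJ, hWJ⟩ := generalized_tube_lemma (isCompact_singleton (x := y))
    (isCompact_Icc (a := (0 : ℝ)) (b := 1)) hO (by
      rintro ⟨y', t⟩ ⟨rfl, ht⟩
      exact hy t ht)
  obtain ⟨ε, hε, hb⟩ := Metric.nhds_basis_closedBall.mem_iff.1
    (hW.mem_nhds (hyW (mem_singleton y)))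
  have hsub : ∀ y' ∈ Metric.closedBall y ε, ∀ t ∈ Icc (0 : ℝ) 1, (y', t) ∈ O := fun y' hy' t ht =>
    hWJ ⟨hb hy', hIJ ht⟩
  obtain ⟨C, hC⟩ := ((isCompact_closedBall y ε).prod (isCompact_Icc (a := (0 : ℝ)) (b := 1)))
    |>.exists_bound_of_continuousOn (hK'.mono fun p hp => hsub p.1 hp.1 p.2 hp.2)
  have hcont : ∀ y' ∈ Metric.closedBall y ε, ContinuousOn (fun t => K (y', t)) (Icc 0 1) :=
    fun y' hy' => hK.continuousOn.comp (by fun_prop) fun t ht => hsub y' hy' t ht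
  have hI : uIoc (0 : ℝ) 1 ⊆ Icc 0 1 := by
    rw [uIoc_of_le zero_le_one]; exact Ioc_subset_Icc_self
  refine intervalIntegral.hasFDerivAt_integral_of_dominated_of_fderiv_le
    (F := fun y t => K (y, t)) (bound := fun _ => C) (s := Metric.closedBall y ε)
    (F' := fun y t => (fderiv ℝ K (y, t)).comp (.inl ℝ E ℝ))
    (Metric.closedBall_mem_nhds y hε) ?_ ?_ ?_ ?_ ?_ ?_
  · filter_upwards [Metric.closedBall_mem_nhds y hε] with y' hy'
    exact ((hcont y' hy').mono hI).aestronglyMeasurable measurableSet_uIoc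
  · refine ContinuousOn.intervalIntegrable ?_
    rw [uIcc_of_le zero_le_one]
    exact hcont y (Metric.mem_closedBall_self hε.le)
  · refine ContinuousOn.aestronglyMeasurable ?_ measurableSet_uIoc
    exact hK'.comp (by fun_prop) fun t ht => hy t (hI ht)
  · exact ae_of_all _ fun t ht y' hy' => hC (y', t) ⟨hy', hI ht⟩
  · exact intervalIntegrable_const
  · refine ae_of_all _ fun t ht y' hy' => ?_
    have h1 : HasFDerivAt K (fderiv ℝ K (y', t)) (y', t) :=
      ((hK.contDiffAt (hO.mem_nhds (hsub y' hy' t (hI ht)))).differentiableAt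
        one_ne_zero).hasFDerivAt
    exact h1.comp y' (hasFDerivAt_prodMk_left y' t)

/-- The derivative is an integral of the same kind with values in `E →L[ℝ] F`, so the induction on
the order must vary `F`; this is why `E` and `F` share a universe. -/
theorem contDiffOn_parametric_integral {E F : Type u} [NormedAddCommGroup E] [NormedSpace ℝ E]
    [FiniteDimensional ℝ E] [NormedAddCommGroup F] [NormedSpace ℝ F] {K : E × ℝ → F}
    {O : Set (E × ℝ)} {W : Set E} (hO : IsOpen O) (hK : ContDiffOn ℝ ∞ K O) (hW : IsOpen W)
    (hWO : ∀ y ∈ W, ∀ t ∈ Icc (0 : ℝ) 1, (y, t) ∈ O) :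
    ContDiffOn ℝ ∞ (fun y => ∫ t in (0 : ℝ)..1, K (y, t)) W := by
  rw [contDiffOn_infty]
  intro n
  induction n generalizing F with
  | zero =>
    refine contDiffOn_zero.2 fun y hy => ContinuousAt.continuousWithinAt ?_
    exact (hasFDerivAt_parametric_integral hO (hK.of_le (by simp)) (hWO y hy)).continuousAt
  | succ n ih =>
    have h1 : ∀ y ∈ W, HasFDerivAt (fun y => ∫ t in (0 : ℝ)..1, K (y, t))
      (∫ t in (0 : ℝ)..1, (fderiv ℝ K (y, t)).comp (.inl ℝ E ℝ)) y := fun y hy =>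
        hasFDerivAt_parametric_integral hO (hK.of_le (by simp)) (hWO y hy)
    rw [Nat.cast_succ]
    refine (contDiffOn_succ_iff_fderiv_of_isOpen hW).2
      ⟨fun y hy => (h1 y hy).differentiableAt.differentiableWithinAt, by simp, ?_⟩
    have h2 : ContDiffOn ℝ ∞ (fun p => (fderiv ℝ K p).comp (.inl ℝ E ℝ)) O :=
      (hK.fderiv_of_isOpen hO (by simp)).clm_comp contDiffOn_const
    exact (ih h2).congr fun y hy => (h1 y hy).fderiv

end ParametricIntegral

/-! ### The Poincaré lemma for two-forms on a ball -/

section RadialPrimitive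

open Filter Topology

variable {E : Type} [NormedAddCommGroup E] [NormedSpace ℝ E] 

/-- Currying of two-forms. -/
def curryTwoForm : (E [⋀^Fin 2]→L[ℝ] ℝ) →L[ℝ] E →L[ℝ] E [⋀^Fin 1]→L[ℝ] ℝ :=
  (ContinuousAlternatingMap.curryLeftLI (𝕜 := ℝ) (E := E) (F := ℝ)
    (n := 1)).toContinuousLinearMap

/-- The radial primitive of a two-form. -/
def radialPrimitive (θ : E → E [⋀^Fin 2]→L[ℝ] ℝ) (c : E) (y : E) : E [⋀^Fin 1]→L[ℝ] ℝ :=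
  ∫ t in (0 : ℝ)..1, t • (θ (c + t • (y - c))).curryLeft (y - c)

theorem add_smul_sub_mem_ball {c y : E} {R t : ℝ} (hy : y ∈ Metric.ball c R) (ht : t ∈ Icc (0 : ℝ) 1) :
    c + t • (y - c) ∈ Metric.ball c R :=
  (convex_ball c R).add_smul_sub_mem
    (Metric.mem_ball_self (Metric.nonempty_ball.1 ⟨y, hy⟩)) hy ht

variable {θ : E → E [⋀^Fin 2]→L[ℝ] ℝ} {c : E} {R : ℝ}

theorem isOpen_radialDomain (c : E) (R : ℝ) :
    IsOpen {p : E × ℝ | c + p.2 • (p.1 - c) ∈ Metric.ball c R} :=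
  Metric.isOpen_ball.preimage (by fun_prop)

theorem contDiffOn_radialIntegrand (hθ : ContDiffOn ℝ ∞ θ (Metric.ball c R)) :
    ContDiffOn ℝ ∞ (fun p : E × ℝ => p.2 • (θ (c + p.2 • (p.1 - c))).curryLeft (p.1 - c))
      {p : E × ℝ | c + p.2 • (p.1 - c) ∈ Metric.ball c R} := by
  have h1 : ContDiffOn ℝ ∞ (fun p : E × ℝ => θ (c + p.2 • (p.1 - c)))
      {p : E × ℝ | c + p.2 • (p.1 - c) ∈ Metric.ball c R} :=
    hθ.comp (ContDiff.contDiffOn (by fun_prop)) fun p hp => hp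
  have h2 := (ContinuousLinearMap.contDiff (F := E →L[ℝ] E [⋀^Fin 1]→L[ℝ] ℝ)
    (curryTwoForm (E := E)) (n := ∞)).comp_contDiffOn h1
  have h3 : ContDiff ℝ ∞ fun p : E × ℝ => p.1 - c := by fun_prop
  exact (contDiff_snd.contDiffOn).smul (h2.clm_apply h3.contDiffOn)

theorem contDiffOn_radialPrimitive [FiniteDimensional ℝ E] (hθ : ContDiffOn ℝ ∞ θ (Metric.ball c R)) :
    ContDiffOn ℝ ∞ (radialPrimitive θ c) (Metric.ball c R) :=
  contDiffOn_parametric_integral (isOpen_radialDomain c R) (contDiffOn_radialIntegrand hθ)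
    Metric.isOpen_ball fun _ hy _ ht => add_smul_sub_mem_ball hy ht

theorem radialPrimitive_apply (hθ : ContDiffOn ℝ ∞ θ (Metric.ball c R)) {y : E}
    (hy : y ∈ Metric.ball c R) (v : E) :
    radialPrimitive θ c y ![v] = ∫ t in (0 : ℝ)..1, t * θ (c + t • (y - c)) ![y - c, v] := by
  have hc : ContinuousOn (fun t : ℝ => t • (θ (c + t • (y - c))).curryLeft (y - c)) (uIcc 0 1) := by
    rw [uIcc_of_le zero_le_one]
    exact (contDiffOn_radialIntegrand hθ).continuousOn.comp (f := fun t : ℝ => (y, t))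
      (by fun_prop) fun t ht => add_smul_sub_mem_ball hy ht
  exact ((ContinuousAlternatingMap.apply ℝ E ℝ ![v]).intervalIntegral_comp_comm
    hc.intervalIntegrable).symm

variable [FiniteDimensional ℝ E]

/-- The derivative of the integrand is read off along the line `y + s • u`; its two terms come from
moving the base point of `θ` and from moving the radial argument. -/
theorem fderiv_radialPrimitive_apply (hθ : ContDiffOn ℝ ∞ θ (Metric.ball c R)) {y : E}
    (hy : y ∈ Metric.ball c R) (u v : E) :
    fderiv ℝ (fun y => radialPrimitive θ c y ![v]) y u = ∫ t in (0 : ℝ)..1,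
      (t * (t * (fderiv ℝ θ (c + t • (y - c)) u ![y - c, v]) + θ (c + t • (y - c)) ![u, v])) := by
  have hO := isOpen_radialDomain c R
  have hK : ContDiffOn ℝ ∞ (fun p : E × ℝ => p.2 * θ (c + p.2 • (p.1 - c)) ![p.1 - c, v])
      {p : E × ℝ | c + p.2 • (p.1 - c) ∈ Metric.ball c R} :=
    (ContinuousAlternatingMap.apply ℝ E ℝ ![v]).contDiff.comp_contDiffOn
      (contDiffOn_radialIntegrand hθ)
  have h1 := hasFDerivAt_parametric_integral hO (hK.of_le (by simp))
    (y := y) fun t ht => add_smul_sub_mem_ball hy ht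
  have h2 : (fun y => radialPrimitive θ c y ![v]) =ᶠ[𝓝 y]
      fun y => ∫ t in (0 : ℝ)..1, t * θ (c + t • (y - c)) ![y - c, v] := by
    filter_upwards [Metric.isOpen_ball.mem_nhds hy] with z hz using radialPrimitive_apply hθ hz v
  rw [h2.fderiv_eq, h1.fderiv]
  have hc : ContinuousOn (fun t : ℝ => (fderiv ℝ (fun p : E × ℝ => p.2 * θ (c + p.2 • (p.1 - c))
      ![p.1 - c, v]) (y, t)).comp (.inl ℝ E ℝ)) (uIcc 0 1) := by
    rw [uIcc_of_le zero_le_one]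
    refine ContinuousOn.clm_comp ?_ continuousOn_const
    exact (hK.continuousOn_fderiv_of_isOpen hO (by simp)).comp (f := fun t : ℝ => (y, t))
      (by fun_prop) fun t ht => add_smul_sub_mem_ball hy ht
  refine ((ContinuousLinearMap.apply ℝ ℝ u).intervalIntegral_comp_comm
    hc.intervalIntegrable).symm.trans ?_
  refine intervalIntegral.integral_congr fun t ht => ?_
  rw [uIcc_of_le zero_le_one] at ht
  have hz := add_smul_sub_mem_ball hy ht
  have d1 : HasFDerivAt θ (fderiv ℝ θ (c + t • (y - c))) (c + t • (y - c)) :=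
    ((hθ.contDiffAt (Metric.isOpen_ball.mem_nhds hz)).differentiableAt (by simp)).hasFDerivAt
  have d2 : HasDerivAt (fun s : ℝ => c + t • (y + s • u - c)) (t • u) 0 := by
    have := ((((hasDerivAt_id (0 : ℝ)).smul_const u).const_add y).sub_const c).const_smul t
    simpa using this.const_add c
  have d3 : HasDerivAt (fun s : ℝ => θ (c + t • (y + s • u - c)))
      (fderiv ℝ θ (c + t • (y - c)) (t • u)) 0 :=
    HasFDerivAt.comp_hasDerivAt (f := fun s : ℝ => c + t • (y + s • u - c)) 0 (by simpa using d1) d2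
  have d4 : HasDerivAt (fun s : ℝ => y + s • u - c) u 0 := by
    simpa using ((((hasDerivAt_id (0 : ℝ)).smul_const u).const_add y).sub_const c)
  have d5 : HasDerivAt (fun s : ℝ => curryTwoForm (θ (c + t • (y + s • u - c))))
      (curryTwoForm (fderiv ℝ θ (c + t • (y - c)) (t • u))) 0 :=
    HasFDerivAt.comp_hasDerivAt (F := E [⋀^Fin 2]→L[ℝ] ℝ) (E := E →L[ℝ] E [⋀^Fin 1]→L[ℝ] ℝ)
      (0 : ℝ) (ContinuousLinearMap.hasFDerivAt (F := E →L[ℝ] E [⋀^Fin 1]→L[ℝ] ℝ) curryTwoForm) d3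
  have d6 := ((ContinuousAlternatingMap.apply ℝ E ℝ ![v]).hasFDerivAt.comp_hasDerivAt (0 : ℝ)
    (d5.clm_apply d4)).const_mul t
  have e1 : HasFDerivAt (fun p : E × ℝ => p.2 * θ (c + p.2 • (p.1 - c)) ![p.1 - c, v])
      (fderiv ℝ (fun p : E × ℝ => p.2 * θ (c + p.2 • (p.1 - c)) ![p.1 - c, v]) (y, t)) (y, t) :=
    ((hK.contDiffAt (hO.mem_nhds hz)).differentiableAt (by simp)).hasFDerivAt
  have e2 : HasDerivAt (fun s : ℝ => (y + s • u, t)) (u, (0 : ℝ)) 0 := by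
    have h : HasDerivAt (fun s : ℝ => y + s • u) u 0 := by
      simpa using (((hasDerivAt_id (0 : ℝ)).smul_const u).const_add y)
    exact h.prodMk (hasDerivAt_const _ _)
  have e3 := HasFDerivAt.comp_hasDerivAt (f := fun s : ℝ => (y + s • u, t)) 0
    (by simp only [zero_smul, add_zero]; exact e1) e2
  have e4 := e3.unique d6
  refine Eq.trans ?_ (e4.trans ?_)
  · rfl
  · rw [zero_smul, add_zero, map_smul]
    rfl

/-- **Poincaré lemma** for two-forms on a ball. -/
theorem extDeriv_radialPrimitive (hθ : ContDiffOn ℝ ∞ θ (Metric.ball c R))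
    (hd : ∀ y ∈ Metric.ball c R, extDeriv θ y = 0) {y : E} (hy : y ∈ Metric.ball c R) :
    extDeriv (radialPrimitive θ c) y = θ y := by
  have hdiff : DifferentiableAt ℝ (radialPrimitive θ c) y :=
    ((contDiffOn_radialPrimitive hθ).contDiffAt (Metric.isOpen_ball.mem_nhds hy)).differentiableAt
      (by simp)
  ext v
  obtain ⟨u, v, rfl⟩ : ∃ u w, v = ![u, w] := ⟨v 0, v 1, by ext i; fin_cases i <;> rfl⟩
  have hz := fun t (ht : t ∈ Icc (0 : ℝ) 1) => add_smul_sub_mem_ball hy ht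
  have dz : ∀ t ∈ Icc (0 : ℝ) 1, HasFDerivAt θ (fderiv ℝ θ (c + t • (y - c))) (c + t • (y - c)) :=
    fun t ht => ((hθ.contDiffAt (Metric.isOpen_ball.mem_nhds (hz t ht))).differentiableAt
      (by simp)).hasFDerivAt
  have e1 : extDeriv (radialPrimitive θ c) y ![u, v] =
      fderiv ℝ (fun y => radialPrimitive θ c y ![v]) y u -
        fderiv ℝ (fun y => radialPrimitive θ c y ![u]) y v := by
    rw [extDeriv_apply hdiff, Fin.sum_univ_two]
    have r0 : (0 : Fin 2).removeNth ![u, v] = ![v] := by ext i; fin_cases i; rfl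
    have r1 : (1 : Fin 2).removeNth ![u, v] = ![u] := by ext i; fin_cases i; rfl
    rw [r0, r1]
    simp [sub_eq_add_neg]
  -- This is dθ = 0, evaluated on the radial vector, `u` and `v`.
  have hcl : ∀ t ∈ Icc (0 : ℝ) 1, fderiv ℝ θ (c + t • (y - c)) (y - c) ![u, v] =
      fderiv ℝ θ (c + t • (y - c)) u ![y - c, v] - fderiv ℝ θ (c + t • (y - c)) v ![y - c, u] := by
    intro t ht
    have h := DFunLike.congr_fun (hd _ (hz t ht)) ![y - c, u, v]
    rw [extDeriv_apply (dz t ht).differentiableAt, Fin.sum_univ_three] at h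
    have r0 : (0 : Fin 3).removeNth ![y - c, u, v] = ![u, v] := by ext i; fin_cases i <;> rfl
    have r1 : (1 : Fin 3).removeNth ![y - c, u, v] = ![y - c, v] := by ext i; fin_cases i <;> rfl
    have r2 : (2 : Fin 3).removeNth ![y - c, u, v] = ![y - c, u] := by ext i; fin_cases i <;> rfl
    rw [r0, r1, r2] at h
    have f : ∀ w : Fin 2 → E, fderiv ℝ (fun z => θ z w) (c + t • (y - c)) =
        (ContinuousAlternatingMap.apply ℝ E ℝ w).comp (fderiv ℝ θ (c + t • (y - c))) := fun w =>
      ((ContinuousAlternatingMap.apply ℝ E ℝ w).hasFDerivAt.comp _ (dz t ht)).fderiv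
    rw [f, f, f] at h
    have h' : fderiv ℝ θ (c + t • (y - c)) (y - c) ![u, v] -
      fderiv ℝ θ (c + t • (y - c)) u ![y - c, v] + fderiv ℝ θ (c + t • (y - c)) v ![y - c, u] = 0 := by
      simpa [sub_eq_add_neg] using h
    linarith
  have hswap : ∀ t : ℝ, θ (c + t • (y - c)) ![v, u] = - θ (c + t • (y - c)) ![u, v] := fun t => by
    have := (θ (c + t • (y - c))).toAlternatingMap.map_swap ![u, v] (i := 0) (j := 1) (by decide)
    refine Eq.trans ?_ this
    refine congrArg _ ?_
    ext i; fin_cases i <;> rfl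
  have hline : ContinuousOn (fun t : ℝ => c + t • (y - c)) (Icc 0 1) := by fun_prop
  have hcθ : ∀ w, ContinuousOn (fun t : ℝ => θ (c + t • (y - c)) w) (Icc 0 1) := fun w =>
    (ContinuousAlternatingMap.apply ℝ E ℝ w).continuous.comp_continuousOn
      (hθ.continuousOn.comp hline hz)
  have hcD : ∀ u w, ContinuousOn (fun t : ℝ => fderiv ℝ θ (c + t • (y - c)) u w) (Icc 0 1) :=
    fun u w => (ContinuousAlternatingMap.apply ℝ E ℝ w).continuous.comp_continuousOn
      (((hθ.continuousOn_fderiv_of_isOpen Metric.isOpen_ball (by simp)).comp hline hz).clm_apply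
        continuousOn_const)
  have hint : ∀ u v : E, IntervalIntegrable (fun t : ℝ => t * (t * (fderiv ℝ θ (c + t • (y - c)) u
      ![y - c, v]) + θ (c + t • (y - c)) ![u, v])) volume 0 1 := fun u v => by
    refine ContinuousOn.intervalIntegrable ?_
    rw [uIcc_of_le zero_le_one]
    exact continuousOn_id.mul ((continuousOn_id.mul (hcD _ _)).add (hcθ _))
  rw [e1, fderiv_radialPrimitive_apply hθ hy, fderiv_radialPrimitive_apply hθ hy,
    ← intervalIntegral.integral_sub (hint u v) (hint v u)]
  -- By closedness the antisymmetrized integrand is the derivative of t² θ(c + t(y - c))(u, v),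
  -- whose increment from 0 to 1 is θ_y(u, v).
  have hFTC := intervalIntegral.integral_eq_sub_of_hasDerivAt
    (f := fun t : ℝ => t ^ 2 * θ (c + t • (y - c)) ![u, v])
    (f' := fun t : ℝ => (2 * t) * θ (c + t • (y - c)) ![u, v] +
      t ^ 2 * fderiv ℝ θ (c + t • (y - c)) (y - c) ![u, v]) (a := 0) (b := 1) (fun t ht => by
      rw [uIcc_of_le zero_le_one] at ht
      have d2 : HasDerivAt (fun s : ℝ => c + s • (y - c)) (y - c) t := by
        simpa using ((hasDerivAt_id t).smul_const (y - c)).const_add c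
      have d3 : HasDerivAt (fun s : ℝ => θ (c + s • (y - c)) ![u, v])
          (fderiv ℝ θ (c + t • (y - c)) (y - c) ![u, v]) t :=
        (ContinuousAlternatingMap.apply ℝ E ℝ ![u, v]).hasFDerivAt.comp_hasDerivAt t
          (HasFDerivAt.comp_hasDerivAt (f := fun s : ℝ => c + s • (y - c)) t (dz t ht) d2)
      have d4 : HasDerivAt (fun s : ℝ => s ^ 2) (2 * t) t := by simpa using hasDerivAt_pow 2 t
      exact d4.mul d3) (by
      refine ContinuousOn.intervalIntegrable ?_
      rw [uIcc_of_le zero_le_one]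
      exact ((continuousOn_const.mul continuousOn_id).mul (hcθ _)).add
        ((continuousOn_id.pow 2).mul (hcD _ _)))
  simp only [one_pow, one_mul, one_smul, add_sub_cancel, ne_eq, OfNat.ofNat_ne_zero,
    not_false_eq_true, zero_pow, zero_mul, sub_zero] at hFTC
  rw [← hFTC]
  refine intervalIntegral.integral_congr fun t ht => ?_
  rw [uIcc_of_le zero_le_one] at ht
  simp only [hcl t ht, hswap]
  ring

end RadialPrimitive

/-- One-forms as linear maps. -/
def oneFormEquiv (E F : Type*) [NormedAddCommGroup E] [NormedSpace ℝ E] [NormedAddCommGroup F]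
    [NormedSpace ℝ F] : (E →L[ℝ] F) ≃ₗᵢ[ℝ] (E [⋀^Fin 1]→L[ℝ] F) :=
  ContinuousAlternatingMap.ofSubsingletonLIE (𝕜 := ℝ) (0 : Fin 1)

theorem oneFormEquiv_symm_apply {E F : Type*} [NormedAddCommGroup E] [NormedSpace ℝ E]
    [NormedAddCommGroup F] [NormedSpace ℝ F] (α : E [⋀^Fin 1]→L[ℝ] F) (v : E) :
    (oneFormEquiv E F).symm α v = α ![v] := by
  rw [← (oneFormEquiv E F).apply_symm_apply α, LinearIsometryEquiv.symm_apply_apply]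
  rfl

/-! ### Smooth cones over curves and Stokes' theorem for them -/

section Cone

open Filter Topology

/-- A smooth step function which vanishes on `(-∞, 1/3]` and equals one on `[2/3, ∞)`. -/
def coneStep (r : ℝ) : ℝ := Real.smoothTransition (3 * r - 1)

theorem coneStep_mem (r : ℝ) : coneStep r ∈ Icc (0 : ℝ) 1 :=
  ⟨Real.smoothTransition.nonneg _, Real.smoothTransition.le_one _⟩

theorem contDiff_coneStep : ContDiff ℝ ∞ coneStep :=
  Real.smoothTransition.contDiff.comp (by fun_prop)

theorem coneStep_of_le {r : ℝ} (h : r ≤ 1 / 3) : coneStep r = 0 :=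
  Real.smoothTransition.zero_of_nonpos (by linarith)

@[simp] theorem coneStep_zero : coneStep 0 = 0 := coneStep_of_le (by norm_num)

@[simp] theorem coneStep_one : coneStep 1 = 1 :=
  Real.smoothTransition.one_of_one_le (by norm_num)

variable {E : Type} [NormedAddCommGroup E] [NormedSpace ℝ E]

/-- The cone with apex `c` over the curve `Y`, as a map of the triangle. -/
def coneMap (c : E) (Y : ℝ → E) (q : ℝ × ℝ) : E :=
  c + coneStep (q.1 + q.2) • (Y (q.2 / (q.1 + q.2)) - c)

theorem coneMap_eq_apex (c : E) (Y : ℝ → E) {q : ℝ × ℝ} (h : q.1 + q.2 < 1 / 3) :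
    coneMap c Y q = c := by
  simp [coneMap, coneStep_of_le h.le]

theorem coneMap_mem_ball {c : E} {R : ℝ} {Y : ℝ → E} (hY : ∀ s ∈ Icc (0 : ℝ) 1, Y s ∈ Metric.ball c R)
    {q : ℝ × ℝ} (hq : q ∈ triangle) : coneMap c Y q ∈ Metric.ball c R := by
  obtain ⟨h1, h2, h3⟩ := hq
  refine add_smul_sub_mem_ball (hY _ ⟨by positivity, ?_⟩) (coneStep_mem _)
  exact div_le_one_of_le₀ (by linarith) (by linarith)

/-- The quotient is singular only at the apex, and near the apex the flat step function makes the
cone constant. -/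
theorem continuous_coneMap (c : E) {Y : ℝ → E} (hY : Continuous Y) : Continuous (coneMap c Y) := by
  refine continuous_iff_continuousAt.2 fun q => ?_
  rcases lt_or_ge (q.1 + q.2) (1 / 3) with h | h
  · have : coneMap c Y =ᶠ[𝓝 q] fun _ => c := by
      have ho : IsOpen {q : ℝ × ℝ | q.1 + q.2 < 1 / 3} := isOpen_lt (by fun_prop) (by fun_prop)
      filter_upwards [ho.mem_nhds h] with p hp using coneMap_eq_apex c Y hp
    exact continuousAt_const.congr this.symm
  · have h0 : q.1 + q.2 ≠ 0 := by linarith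
    have h1 : ContinuousAt (fun q : ℝ × ℝ => q.2 / (q.1 + q.2)) q := by fun_prop (disch := exact h0)
    have h2 : ContinuousAt (fun q : ℝ × ℝ => Y (q.2 / (q.1 + q.2))) q :=
      ContinuousAt.comp (f := fun q : ℝ × ℝ => q.2 / (q.1 + q.2)) hY.continuousAt h1
    have h3 : Continuous fun q : ℝ × ℝ => coneStep (q.1 + q.2) :=
      contDiff_coneStep.continuous.comp (by fun_prop)
    exact continuousAt_const.add (h3.continuousAt.smul (h2.sub continuousAt_const))

/-- The domain on which the cone over a curve which is smooth on `J` is smooth. -/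
def coneDomain (J : Set ℝ) : Set (ℝ × ℝ) :=
  {q | q.1 + q.2 < 1 / 3} ∪ {q | 0 < q.1 + q.2 ∧ q.2 / (q.1 + q.2) ∈ J}

theorem isOpen_coneDomain_right {J : Set ℝ} (hJ : IsOpen J) :
    IsOpen {q : ℝ × ℝ | 0 < q.1 + q.2 ∧ q.2 / (q.1 + q.2) ∈ J} := by
  have h0 : IsOpen {q : ℝ × ℝ | 0 < q.1 + q.2} := isOpen_lt (by fun_prop) (by fun_prop)
  refine ContinuousOn.isOpen_inter_preimage (f := fun q : ℝ × ℝ => q.2 / (q.1 + q.2)) ?_ h0 hJ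
  intro q hq
  have : q.1 + q.2 ≠ 0 := (ne_of_gt hq)
  exact ContinuousAt.continuousWithinAt (by fun_prop (disch := exact this))

theorem isOpen_coneDomain {J : Set ℝ} (hJ : IsOpen J) : IsOpen (coneDomain J) :=
  (isOpen_lt (by fun_prop) (by fun_prop)).union (isOpen_coneDomain_right hJ)

theorem triangle_subset_coneDomain {J : Set ℝ} (hJ : Icc 0 1 ⊆ J) : triangle ⊆ coneDomain J := by
  rintro q ⟨h1, h2, h3⟩
  rcases lt_or_ge (q.1 + q.2) (1 / 3) with h | h
  · exact Or.inl h
  · exact Or.inr ⟨by linarith, hJ ⟨by positivity, div_le_one_of_le₀ (by linarith) (by linarith)⟩⟩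

theorem contDiffOn_coneMap_right (c : E) {Y : ℝ → E} {J : Set ℝ} (hY : ContDiffOn ℝ ∞ Y J) :
    ContDiffOn ℝ ∞ (coneMap c Y) {q : ℝ × ℝ | 0 < q.1 + q.2 ∧ q.2 / (q.1 + q.2) ∈ J} := by
  have h1 : ContDiffOn ℝ ∞ (fun q : ℝ × ℝ => q.2 / (q.1 + q.2))
      {q : ℝ × ℝ | 0 < q.1 + q.2 ∧ q.2 / (q.1 + q.2) ∈ J} :=
    contDiffOn_snd.div (by fun_prop) fun q hq => ne_of_gt hq.1
  have h2 := hY.comp h1 fun q hq => hq.2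
  have h3 : ContDiff ℝ ∞ fun q : ℝ × ℝ => coneStep (q.1 + q.2) :=
    contDiff_coneStep.comp (by fun_prop)
  exact contDiffOn_const.add (h3.contDiffOn.smul (h2.sub contDiffOn_const))

theorem contDiffOn_coneMap (c : E) {Y : ℝ → E} {J : Set ℝ} (hJ : IsOpen J)
    (hY : ContDiffOn ℝ ∞ Y J) : ContDiffOn ℝ ∞ (coneMap c Y) (coneDomain J) := by
  have ho : IsOpen {q : ℝ × ℝ | q.1 + q.2 < 1 / 3} := isOpen_lt (by fun_prop) (by fun_prop)
  rintro q (hq | hq)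
  · refine ContDiffAt.contDiffWithinAt ((contDiffAt_const (c := c)).congr_of_eventuallyEq ?_)
    filter_upwards [ho.mem_nhds hq] with p hp using coneMap_eq_apex c Y hp
  · exact ((contDiffOn_coneMap_right c hY).contDiffAt
      ((isOpen_coneDomain_right hJ).mem_nhds hq)).contDiffWithinAt

theorem fderiv_coneMap_apply (c : E) {Y : ℝ → E} {J : Set ℝ} (hJ : IsOpen J)
    (hY : ContDiffOn ℝ ∞ Y J) {q : ℝ × ℝ} (h0 : 0 < q.1 + q.2) (hs : q.2 / (q.1 + q.2) ∈ J)
    (w : ℝ × ℝ) : fderiv ℝ (coneMap c Y) q w =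
      coneStep (q.1 + q.2) • ((w.2 * (q.1 + q.2) - q.2 * (w.1 + w.2)) / (q.1 + q.2) ^ 2) •
        deriv Y (q.2 / (q.1 + q.2)) +
      (deriv coneStep (q.1 + q.2) * (w.1 + w.2)) • (Y (q.2 / (q.1 + q.2)) - c) := by
  have h1 : HasFDerivAt (coneMap c Y) (fderiv ℝ (coneMap c Y) q) q :=
    (((contDiffOn_coneMap_right c hY).contDiffAt
      ((isOpen_coneDomain_right hJ).mem_nhds ⟨h0, hs⟩)).differentiableAt (by simp)).hasFDerivAt
  have hline : HasDerivAt (fun t : ℝ => q + t • w) w 0 := by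
    simpa using ((hasDerivAt_id (0 : ℝ)).smul_const w).const_add q
  have h2 := HasFDerivAt.comp_hasDerivAt (f := fun t : ℝ => q + t • w) 0 (by simpa using h1) hline
  have ha : HasDerivAt (fun t : ℝ => q.2 + t * w.2) w.2 0 := by
    simpa using ((hasDerivAt_id (0 : ℝ)).mul_const w.2).const_add q.2
  have hb : HasDerivAt (fun t : ℝ => q.1 + t * w.1 + (q.2 + t * w.2)) (w.1 + w.2) 0 := by
    have h := ((hasDerivAt_id (0 : ℝ)).mul_const w.1).const_add q.1
    rw [one_mul] at h
    exact h.add ha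
  have hd := ha.div hb (by simpa using h0.ne')
  have hY' : HasDerivAt Y (deriv Y (q.2 / (q.1 + q.2))) (q.2 / (q.1 + q.2)) :=
    ((hY.contDiffAt (hJ.mem_nhds hs)).differentiableAt (by simp)).hasDerivAt
  have hc : HasDerivAt coneStep (deriv coneStep (q.1 + q.2)) (q.1 + q.2) :=
    ((contDiff_coneStep.differentiable (by simp)) _).hasDerivAt
  have h3 := HasDerivAt.scomp (h := fun t : ℝ => (q.2 + t * w.2) / (q.1 + t * w.1 + (q.2 + t * w.2)))
    0 (by simp only [zero_mul, add_zero]; exact hY') hd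
  have h4 := HasDerivAt.comp (h := fun t : ℝ => q.1 + t * w.1 + (q.2 + t * w.2)) 0
    (by simp only [zero_mul, add_zero]; exact hc) hb
  have h5 := (h4.smul (h3.sub_const c)).const_add c
  have h6 := h2.unique h5
  simpa using h6

theorem twoForm_apply_combination (θ : E [⋀^Fin 2]→L[ℝ] ℝ) (a b a' b' : ℝ) (u v : E) :
    θ ![a • u + b • v, a' • u + b' • v] = (a * b' - b * a') * θ ![u, v] := by
  have hadd : ∀ x y z : E, θ.curryLeft (x + y) ![z] = θ.curryLeft x ![z] + θ.curryLeft y ![z] := by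
    intro x y z; simp
  have hadd1 : ∀ x y z : E, θ ![x + y, z] = θ ![x, z] + θ ![y, z] := hadd
  have hsm1 : ∀ (a : ℝ) (x z : E), θ ![a • x, z] = a * θ ![x, z] := fun a x z => by
    have : θ.curryLeft (a • x) ![z] = a * θ.curryLeft x ![z] := by simp
    exact this
  have hswap : ∀ u v : E, θ ![v, u] = - θ ![u, v] := fun u v => by
    have := θ.toAlternatingMap.map_swap ![u, v] (i := 0) (j := 1) (by decide)
    refine Eq.trans ?_ this
    refine congrArg _ ?_
    ext i; fin_cases i <;> rfl
  have hself : ∀ u : E, θ ![u, u] = 0 := fun u => by have := hswap u u; linarith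
  rw [hadd1, hsm1, hsm1, hswap _ u, hswap _ v, hadd1, hadd1, hsm1, hsm1, hsm1, hsm1, hself, hself,
    hswap u v]
  ring

/-- The parametrization of the triangle by the position on the base and the distance from the
apex. -/
def coneParam (p : ℝ × ℝ) : ℝ × ℝ := (p.2 * (1 - p.1), p.2 * p.1)

theorem coneParam_image : coneParam '' (Icc 0 1 ×ˢ Ioc 0 1) = triangle \ {0} := by
  ext q
  constructor
  · rintro ⟨⟨s, r⟩, ⟨⟨hs0, hs1⟩, hr0, hr1⟩, rfl⟩
    simp only at hs0 hs1 hr0 hr1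
    refine ⟨⟨mul_nonneg hr0.le (sub_nonneg.2 hs1), mul_nonneg hr0.le hs0, ?_⟩, fun h => ?_⟩
    · simp only [coneParam]; linarith
    · have h1 := congrArg Prod.fst h
      have h2 := congrArg Prod.snd h
      simp only [coneParam, Prod.fst_zero, Prod.snd_zero] at h1 h2
      linarith
  · rintro ⟨⟨h1, h2, h3⟩, h0⟩
    have hr : 0 < q.1 + q.2 := by
      rcases (add_nonneg h1 h2).lt_or_eq with h | h
      · exact h
      · exact absurd (Prod.ext (by simp; linarith) (by simp; linarith)) h0
    refine ⟨(q.2 / (q.1 + q.2), q.1 + q.2), ⟨⟨by positivity,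
      div_le_one_of_le₀ (by linarith) (by linarith)⟩, hr, h3⟩, ?_⟩
    ext <;> simp only [coneParam] <;> field_simp
    ring

theorem coneParam_injOn : InjOn coneParam (Icc 0 1 ×ˢ Ioc 0 1) := by
  rintro ⟨s, r⟩ ⟨-, hr, -⟩ ⟨s', r'⟩ - h
  have h1 := congrArg Prod.fst h
  have h2 := congrArg Prod.snd h
  simp only [coneParam] at h1 h2 hr
  obtain rfl : r = r' := by linarith
  obtain rfl : s = s' := mul_left_cancel₀ hr.ne' h2
  rfl

/-- The derivative of `coneParam`. -/
def coneParamDeriv (p : ℝ × ℝ) : ℝ × ℝ →L[ℝ] ℝ × ℝ :=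
  LinearMap.toContinuousLinearMap
    (Matrix.toLin (Module.Basis.finTwoProd ℝ) (Module.Basis.finTwoProd ℝ)
      !![-p.2, 1 - p.1; p.2, p.1])

theorem hasFDerivAt_coneParam (p : ℝ × ℝ) : HasFDerivAt coneParam (coneParamDeriv p) p := by
  rw [coneParamDeriv, Matrix.toLin_finTwoProd_toContinuousLinearMap]
  have h : HasFDerivAt (fun p : ℝ × ℝ => 1 - p.1) (-ContinuousLinearMap.fst ℝ ℝ ℝ) p :=
    hasFDerivAt_fst.const_sub 1
  have h1 := (hasFDerivAt_snd (𝕜 := ℝ) (E := ℝ) (F := ℝ) (p := p)).mul h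
  have h2 := (hasFDerivAt_snd (𝕜 := ℝ) (E := ℝ) (F := ℝ) (p := p)).mul (hasFDerivAt_fst (p := p))
  refine (HasFDerivAt.prodMk h1 h2).congr_fderiv ?_
  ext <;> simp

theorem det_coneParamDeriv (p : ℝ × ℝ) : (coneParamDeriv p).det = -p.2 := by
  rw [coneParamDeriv, LinearMap.det_toContinuousLinearMap, LinearMap.det_toLin,
    Matrix.det_fin_two_of]
  ring

/-- The integral of a two-form over the cone on a curve is the integral of the radial primitive
along the curve. -/
theorem integral_coneMap {θ : E → E [⋀^Fin 2]→L[ℝ] ℝ} {c : E} {R : ℝ} [CompleteSpace E]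
    (hθ : ContDiffOn ℝ ∞ θ (Metric.ball c R)) {Y : ℝ → E} {J : Set ℝ} (hJ : IsOpen J)
    (hJ1 : Icc 0 1 ⊆ J) (hY : ContDiffOn ℝ ∞ Y J) (hYR : ∀ s ∈ Icc (0 : ℝ) 1, Y s ∈ Metric.ball c R) :
    ∫ q in triangle, θ (coneMap c Y q) ![fderiv ℝ (coneMap c Y) q (1, 0),
      fderiv ℝ (coneMap c Y) q (0, 1)] =
    ∫ s in (0 : ℝ)..1, radialPrimitive θ c (Y s) ![deriv Y s] := by
  -- The apex, where `coneParam` collapses a whole edge, has measure zero.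
  have hae : triangle =ᵐ[volume] coneParam '' (Icc 0 1 ×ˢ Ioc 0 1) := by
    rw [coneParam_image]
    exact (sdiff_null_ae_eq_self (measure_singleton _)).symm
  have hmeas : MeasurableSet (Icc (0 : ℝ) 1 ×ˢ Ioc (0 : ℝ) 1) :=
    measurableSet_Icc.prod measurableSet_Ioc
  rw [setIntegral_congr_set hae, integral_image_eq_integral_abs_det_fderiv_smul volume hmeas
    (fun p _ => (hasFDerivAt_coneParam p).hasFDerivWithinAt) coneParam_injOn]
  have hY0 : ContinuousOn Y (Icc 0 1) := hY.continuousOn.mono hJ1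
  have hY1 : ContinuousOn (deriv Y) (Icc 0 1) :=
    (hY.continuousOn_deriv_of_isOpen hJ (by simp)).mono hJ1
  have hcs := contDiff_coneStep.continuous
  have hcd : Continuous (deriv coneStep) := contDiff_coneStep.continuous_deriv (by simp)
  -- The Jacobian `r` cancels the factor 1/r from differentiating the position on the base. The two
  -- partial derivatives are combinations of the radial vector and `deriv Y`, in this orientation.
  have key : ∀ p ∈ Icc (0 : ℝ) 1 ×ˢ Ioc (0 : ℝ) 1, |(coneParamDeriv p).det| •
      θ (coneMap c Y (coneParam p)) ![fderiv ℝ (coneMap c Y) (coneParam p) (1, 0),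
        fderiv ℝ (coneMap c Y) (coneParam p) (0, 1)] =
      (coneStep p.2 * θ (c + coneStep p.2 • (Y p.1 - c)) ![Y p.1 - c, deriv Y p.1]) *
        deriv coneStep p.2 := by
    rintro ⟨s, r⟩ ⟨hs, hr0, hr1⟩
    simp only at hs hr0 hr1
    have e1 : (coneParam (s, r)).1 + (coneParam (s, r)).2 = r := by simp [coneParam]; ring
    have e2 : (coneParam (s, r)).2 / r = s := by simp only [coneParam]; field_simp
    have e3 : (coneParam (s, r)).2 = r * s := rfl
    rw [fderiv_coneMap_apply c hJ hY (by rw [e1]; exact hr0) (by rw [e1, e2]; exact hJ1 hs),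
      fderiv_coneMap_apply c hJ hY (by rw [e1]; exact hr0) (by rw [e1, e2]; exact hJ1 hs),
      coneMap, e1, e2, e3, det_coneParamDeriv]
    simp only [← mul_smul]
    rw [add_comm (_ • deriv Y s), add_comm (_ • deriv Y s), twoForm_apply_combination, abs_neg,
      abs_of_pos hr0, smul_eq_mul]
    field_simp
    ring
  rw [setIntegral_congr_fun hmeas key]
  have hcont : ContinuousOn (fun p : ℝ × ℝ => (coneStep p.2 *
      θ (c + coneStep p.2 • (Y p.1 - c)) ![Y p.1 - c, deriv Y p.1]) * deriv coneStep p.2)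
      (Icc (0 : ℝ) 1 ×ˢ Icc (0 : ℝ) 1) := by
    have hYp : ContinuousOn (fun p : ℝ × ℝ => Y p.1) (Icc (0 : ℝ) 1 ×ˢ Icc (0 : ℝ) 1) :=
      hY0.comp continuousOn_fst fun p hp => hp.1
    have hYd : ContinuousOn (fun p : ℝ × ℝ => deriv Y p.1) (Icc (0 : ℝ) 1 ×ˢ Icc (0 : ℝ) 1) :=
      hY1.comp continuousOn_fst fun p hp => hp.1
    have hst : ContinuousOn (fun p : ℝ × ℝ => coneStep p.2) (Icc (0 : ℝ) 1 ×ˢ Icc (0 : ℝ) 1) :=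
      (hcs.comp continuous_snd).continuousOn
    have hth : ContinuousOn (fun p : ℝ × ℝ => θ (c + coneStep p.2 • (Y p.1 - c)))
        (Icc (0 : ℝ) 1 ×ˢ Icc (0 : ℝ) 1) :=
      hθ.continuousOn.comp (continuousOn_const.add (hst.smul (hYp.sub continuousOn_const)))
        fun p hp => add_smul_sub_mem_ball (hYR _ hp.1) (coneStep_mem _)
    have hcur : ContinuousOn (fun p : ℝ × ℝ => curryTwoForm (θ (c + coneStep p.2 • (Y p.1 - c)))
        (Y p.1 - c)) (Icc (0 : ℝ) 1 ×ˢ Icc (0 : ℝ) 1) :=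
      ((curryTwoForm (E := E)).continuous.comp_continuousOn hth).clm_apply
        (hYp.sub continuousOn_const)
    have hcur2 := ContinuousOn.clm_apply (f := fun p : ℝ × ℝ =>
      (oneFormEquiv E ℝ).symm (curryTwoForm (θ (c + coneStep p.2 • (Y p.1 - c))) (Y p.1 - c)))
      ((oneFormEquiv E ℝ).symm.continuous.comp_continuousOn hcur)
      hYd
    refine (hst.mul (hcur2.congr fun p _ => ?_)).mul (hcd.comp continuous_snd).continuousOn
    exact (oneFormEquiv_symm_apply (curryTwoForm (θ (c + coneStep p.2 • (Y p.1 - c))) (Y p.1 - c))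
      (deriv Y p.1)).symm
  have hint := (hcont.integrableOn_compact (isCompact_Icc.prod isCompact_Icc)
    (μ := volume)).mono_set (prod_mono_right Ioc_subset_Icc_self :
      Icc (0 : ℝ) 1 ×ˢ Ioc (0 : ℝ) 1 ⊆ _)
  rw [Measure.volume_eq_prod] at hint ⊢
  rw [setIntegral_prod _ hint, integral_Icc_eq_integral_Ioc,
    ← intervalIntegral.integral_of_le zero_le_one]
  refine intervalIntegral.integral_congr fun s hs => ?_
  rw [uIcc_of_le zero_le_one] at hs
  simp only
  rw [← intervalIntegral.integral_of_le zero_le_one, radialPrimitive_apply hθ (hYR s hs)]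
  -- Substituting t = `coneStep r` removes the step function and leaves the integral that defines
  -- the radial primitive.
  have := intervalIntegral.integral_comp_mul_deriv' (a := 0) (b := 1) (f := coneStep)
    (f' := deriv coneStep) (g := fun t => t * θ (c + t • (Y s - c)) ![Y s - c, deriv Y s])
    (fun r _ => ((contDiff_coneStep.differentiable (by simp)) r).hasDerivAt) hcd.continuousOn ?_
  · simpa using this
  · refine ContinuousOn.mono (s := Icc 0 1) ?_ (image_subset_iff.2 fun r _ => coneStep_mem r)
    refine continuousOn_id.mul ((ContinuousAlternatingMap.apply ℝ E ℝ _).continuous.comp_continuousOn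
      (hθ.continuousOn.comp (by fun_prop) fun t ht => add_smul_sub_mem_ball (hYR s hs) ht))

end Cone

/-! ### Balls in charts, radial paths and cones -/

section ChartBalls

open Filter Topology

variable (n : ℕ) {M : Type u} [TopologicalSpace M]
  [ChartedSpace (EuclideanSpace ℝ (Fin n)) M]

theorem exists_ball_subset_target (i : M) :
    ∃ R > 0, Metric.ball (extChartAt (𝓡 n) i i) R ⊆ (extChartAt (𝓡 n) i).target :=
  Metric.isOpen_iff.1 (isOpen_extChartAt_target i) _ (mem_extChartAt_target i)

/-- The radius of a ball in the target of the preferred chart at `i`. -/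
def chartRadius (i : M) : ℝ := (exists_ball_subset_target n i).choose

/-- The image of `i` in its preferred chart. -/
def chartCenter (i : M) : EuclideanSpace ℝ (Fin n) := extChartAt (𝓡 n) i i

/-- A ball in the target of the preferred chart at `i`. -/
abbrev chartBall (i : M) : Set (EuclideanSpace ℝ (Fin n)) :=
  Metric.ball (chartCenter n i) (chartRadius n i)

theorem chartBall_subset_target (i : M) : chartBall n i ⊆ (extChartAt (𝓡 n) i).target :=
  (exists_ball_subset_target n i).choose_spec.2

/-- The neighbourhood of `i` which corresponds to a ball in the preferred chart. -/
def chartNhd (i : M) : Set M := (extChartAt (𝓡 n) i).source ∩ extChartAt (𝓡 n) i ⁻¹' chartBall n i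

theorem isOpen_chartNhd (i : M) : IsOpen (chartNhd n i) :=
  isOpen_extChartAt_preimage' i Metric.isOpen_ball

theorem mem_chartNhd (i : M) : i ∈ chartNhd n i :=
  ⟨mem_extChartAt_source i, Metric.mem_ball_self (exists_ball_subset_target n i).choose_spec.1⟩

variable {n}

theorem extChartAt_symm_mem_chartNhd {i : M} {y : EuclideanSpace ℝ (Fin n)} (hy : y ∈ chartBall n i) :
    (extChartAt (𝓡 n) i).symm y ∈ chartNhd n i := by
  have h := chartBall_subset_target n i hy
  exact ⟨(extChartAt (𝓡 n) i).map_target h, by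
    rw [mem_preimage, (extChartAt (𝓡 n) i).right_inv h]; exact hy⟩

theorem extChartAt_right_inv_of_mem {i : M} {y : EuclideanSpace ℝ (Fin n)} (hy : y ∈ chartBall n i) :
    extChartAt (𝓡 n) i ((extChartAt (𝓡 n) i).symm y) = y :=
  (extChartAt (𝓡 n) i).right_inv (chartBall_subset_target n i hy)

theorem continuous_extChartAt_symm_comp {X : Type*} [TopologicalSpace X] {i : M}
    {Y : X → EuclideanSpace ℝ (Fin n)} (hY : Continuous Y) (h : ∀ x, Y x ∈ chartBall n i) :
    Continuous fun x => (extChartAt (𝓡 n) i).symm (Y x) :=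
  ((continuousOn_extChartAt_symm i).mono (chartBall_subset_target n i)).comp_continuous hY h

open Classical in
/-- The radial path from (near) `i` to `y` in the preferred chart at `i`. -/
def chartRadial (n : ℕ) {M : Type u} [TopologicalSpace M]
    [ChartedSpace (EuclideanSpace ℝ (Fin n)) M] (i y : M) : SingularSimplex 1 M :=
  if h : y ∈ chartNhd n i then
    pathSimplex ⟨fun r => (extChartAt (𝓡 n) i).symm
      (chartCenter n i + coneStep r • (extChartAt (𝓡 n) i y - chartCenter n i)),
      continuous_extChartAt_symm_comp
        (continuous_const.add (contDiff_coneStep.continuous.smul continuous_const))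
        fun r => add_smul_sub_mem_ball h.2 (coneStep_mem r)⟩
  else ContinuousMap.const _ y

theorem chartRadial_apply {i y : M} (hy : y ∈ chartNhd n i) (t : stdSimplex ℝ (Fin 2)) :
    chartRadial n i y t = (extChartAt (𝓡 n) i).symm
      (chartCenter n i + coneStep (t 1) • (extChartAt (𝓡 n) i y - chartCenter n i)) := by
  rw [chartRadial, dif_pos hy]
  rfl

/-- A path in a chart ball is the base of a cone with radial sides, and the cone is smooth if the
path is. -/
theorem exists_cone (i : M) (γ : SingularSimplex 1 M) (hγ : ∀ t, γ t ∈ chartNhd n i) :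
    ∃ σ : SingularSimplex 2 M, σ.face 0 = γ ∧
      σ.face 1 = chartRadial n i (γ (stdSimplex.vertex 1)) ∧
      σ.face 2 = chartRadial n i (γ (stdSimplex.vertex 0)) ∧
      ∀ Y : ℝ → EuclideanSpace ℝ (Fin n),
        (∀ t : stdSimplex ℝ (Fin 2), extChartAt (𝓡 n) i (γ t) = Y (t 1)) →
        ∀ q : triangle, (extChartAt (𝓡 n) i).symm (coneMap (chartCenter n i) Y q) =
          σ (triangleToSimplex q) := by
  -- The simplex is built from the continuous extension of the path that is constant outside [0,1].
  -- A smooth `Y` agrees with it on [0,1] and so gives the same cone on the triangle.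
  let Z : ℝ → EuclideanSpace ℝ (Fin n) := fun s =>
    extChartAt (𝓡 n) i (γ (stdSimplexHomeomorphUnitInterval.symm (projIcc 0 1 zero_le_one s)))
  have hZc : Continuous Z := by
    refine (continuousOn_extChartAt i).comp_continuous (by fun_prop) fun s => (hγ _).1
  have hZ : ∀ t : stdSimplex ℝ (Fin 2), Z (t 1) = extChartAt (𝓡 n) i (γ t) := fun t => by
    refine congrArg _ (congrArg γ ?_)
    rw [Homeomorph.symm_apply_eq]
    exact projIcc_val zero_le_one (stdSimplexHomeomorphUnitInterval t)
  have hZb : ∀ s, Z s ∈ chartBall n i := fun s => (hγ _).2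
  have hcb : ∀ q, coneMap (chartCenter n i) Z q ∈ chartBall n i := fun q =>
    add_smul_sub_mem_ball (hZb _) (coneStep_mem _)
  have hcoord : ∀ j : Fin 3, Continuous fun t : stdSimplex ℝ (Fin 3) => t j := fun j =>
    (continuous_apply j).comp continuous_subtype_val
  let σ : SingularSimplex 2 M := ⟨fun t => (extChartAt (𝓡 n) i).symm
    (coneMap (chartCenter n i) Z (t 1, t 2)), continuous_extChartAt_symm_comp
      ((continuous_coneMap _ hZc).comp ((hcoord 1).prodMk (hcoord 2))) fun t => hcb _⟩
  have hsum : ∀ t : stdSimplex ℝ (Fin 2), t 0 + t 1 = 1 := fun t => by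
    have := t.2.2
    rwa [Fin.sum_univ_two] at this
  refine ⟨σ, ?_, ?_, ?_, ?_⟩
  · ext t
    have h1 := stdSimplex_map_succAbove_succAbove 0 t 0
    have h2 := stdSimplex_map_succAbove_succAbove 0 t 1
    change (extChartAt (𝓡 n) i).symm (coneMap (chartCenter n i) Z
      (stdSimplex.map (Fin.succAbove 0) t 1, stdSimplex.map (Fin.succAbove 0) t 2)) = γ t
    erw [h1, h2]
    rw [coneMap]
    simp only [hsum, coneStep_one, one_smul, div_one, add_sub_cancel]
    rw [hZ, (extChartAt (𝓡 n) i).left_inv (hγ t).1]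
  · ext t
    have h1 := stdSimplex_map_succAbove_self 1 t
    have h2 := stdSimplex_map_succAbove_succAbove 1 t 1
    change (extChartAt (𝓡 n) i).symm (coneMap (chartCenter n i) Z
      (stdSimplex.map (Fin.succAbove 1) t 1, stdSimplex.map (Fin.succAbove 1) t 2)) = _
    erw [h1, h2, chartRadial_apply (hγ _)]
    rw [coneMap]
    simp only [zero_add]
    -- At the apex the meaningless quotient 0/0 is harmless because `coneStep 0 = 0`.
    rcases eq_or_ne (t 1) 0 with h | h
    · simp [h]
    · have := hZ (stdSimplex.vertex 1)
      rw [show (stdSimplex.vertex (S := ℝ) (1 : Fin 2)) 1 = 1 by simp] at this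
      rw [div_self h, this]
  · ext t
    have h1 := stdSimplex_map_succAbove_self 2 t
    have h2 := stdSimplex_map_succAbove_succAbove 2 t 1
    change (extChartAt (𝓡 n) i).symm (coneMap (chartCenter n i) Z
      (stdSimplex.map (Fin.succAbove 2) t 1, stdSimplex.map (Fin.succAbove 2) t 2)) = _
    erw [h1, h2, chartRadial_apply (hγ _)]
    rw [coneMap]
    have := hZ (stdSimplex.vertex 0)
    rw [show (stdSimplex.vertex (S := ℝ) (0 : Fin 2)) 1 = 0 by simp] at this
    simp only [add_zero, zero_div, this]
  · rintro Y hY ⟨q, h1, h2, h3⟩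
    have hs : q.2 / (q.1 + q.2) ∈ Icc (0 : ℝ) 1 :=
      ⟨by positivity, div_le_one_of_le₀ (by linarith) (by linarith)⟩
    have : Y (q.2 / (q.1 + q.2)) = Z (q.2 / (q.1 + q.2)) := by
      have e := hY (stdSimplexHomeomorphUnitInterval.symm ⟨_, hs⟩)
      have e' : (stdSimplexHomeomorphUnitInterval.symm ⟨_, hs⟩) 1 = q.2 / (q.1 + q.2) :=
        congrArg Subtype.val (stdSimplexHomeomorphUnitInterval.apply_symm_apply ⟨_, hs⟩)
      rw [e'] at e
      rw [← e]
      have := projIcc_of_mem zero_le_one hs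
      simp only [Z, this]
    change _ = (extChartAt (𝓡 n) i).symm (coneMap (chartCenter n i) Z (q.1, q.2))
    simp only [coneMap, this]

theorem isConedCover_chartNhd : IsConedCover (chartNhd n (M := M)) (chartRadial n) where
  isOpen := isOpen_chartNhd n
  mem := mem_chartNhd n
  cone i γ hγ := by
    obtain ⟨σ, h0, h1, h2, -⟩ := exists_cone i γ hγ
    exact ⟨σ, h0, h1, h2⟩

end ChartBalls

theorem two_le_infty : (2 : WithTop ℕ∞) ≤ ∞ :=
  WithTop.coe_le_coe.2 (le_top : (2 : ℕ∞) ≤ ⊤)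

/-! ### Naturality of the exterior derivative on manifolds -/

section FormsInCharts

open Filter Topology

variable {E : Type*} [NormedAddCommGroup E] [NormedSpace ℝ E] {H : Type*} [TopologicalSpace H]
  {I : ModelWithCorners ℝ E H} [I.Boundaryless] {M : Type*} [TopologicalSpace M] [ChartedSpace H M]
  [IsManifold I ∞ M] {F : Type*} [NormedAddCommGroup F] [NormedSpace ℝ F] {k : ℕ}

theorem mdifferentiableAt_extChartAt_symm {i : M} {y : E} (hy : y ∈ (extChartAt I i).target) :
    MDifferentiableAt 𝓘(ℝ, E) I (extChartAt I i).symm y :=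
  ((contMDiffOn_extChartAt_symm (n := ∞) i).contMDiffAt
    ((isOpen_extChartAt_target i).mem_nhds hy)).mdifferentiableAt (by simp)

variable {V : Type*} [NormedAddCommGroup V] [NormedSpace ℝ V]

/-- A form which is pulled back from a vector space, in a chart. -/
theorem DiffForm.inChart_eq_of_pullback {α : DiffForm I M k F} {Φ : M → V}
    {l : V → V [⋀^Fin k]→L[ℝ] F} {i : M} {y : E} (hy : y ∈ (extChartAt I i).target)
    (hΦ : MDifferentiableAt I 𝓘(ℝ, V) Φ ((extChartAt I i).symm y))
    (h : α ((extChartAt I i).symm y) = DiffForm.pullback I 𝓘(ℝ, V) Φ l ((extChartAt I i).symm y)) :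
    α.inChart i y = (l (Φ ((extChartAt I i).symm y))).compContinuousLinearMap
      (fderiv ℝ (Φ ∘ (extChartAt I i).symm) y) := by
  have h1 := mfderiv_comp y hΦ (mdifferentiableAt_extChartAt_symm hy)
  rw [mfderiv_eq_fderiv] at h1
  rw [DiffForm.inChart, h, h1]
  rfl

theorem DiffForm.eq_pullback_inChart (α : DiffForm I M k F) {i x : M}
    (hx : x ∈ (extChartAt I i).source) :
    α x = DiffForm.pullback I 𝓘(ℝ, E) (extChartAt I i) (α.inChart i) x := by
  have hM : IsManifold I 1 M := IsManifold.of_le (n := ∞) (by simp)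
  have hy := (extChartAt I i).map_source hx
  have h1 := mfderivWithin_extChartAt_symm_comp_mfderiv_extChartAt (I := I) hy
  have h2 : (extChartAt I i).symm (extChartAt I i x) = x := (extChartAt I i).left_inv hx
  have h3 := mfderiv_comp x (mdifferentiableAt_extChartAt_symm hy)
    ((contMDiffAt_extChartAt' (n := ∞) (by rwa [extChartAt_source] at hx)).mdifferentiableAt
      (by simp))
  have h4 : ((extChartAt I i).symm ∘ extChartAt I i) =ᶠ[𝓝 x] id := by
    filter_upwards [(isOpen_extChartAt_source i).mem_nhds hx] with z hz
      using (extChartAt I i).left_inv hz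
  rw [h4.mfderiv_eq, mfderiv_id] at h3
  ext v
  change α x v = α ((extChartAt I i).symm (extChartAt I i x)) fun j =>
    (mfderiv 𝓘(ℝ, E) I (extChartAt I i).symm (extChartAt I i x))
      ((mfderiv I 𝓘(ℝ, E) (extChartAt I i) x) (v j))
  have h5 : ∀ w : TangentSpace I x, (mfderiv 𝓘(ℝ, E) I (extChartAt I i).symm (extChartAt I i x))
      ((mfderiv I 𝓘(ℝ, E) (extChartAt I i) x) w) = w := fun w =>
    (DFunLike.congr_fun h3 w).symm
  simp only [h5]
  rw [h2]

/-- In the chart at `x` this is naturality of the exterior derivative between vector spaces. `Φ`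
need not be a chart: besides charts, it is used for the coordinates of the circle bundle in `E × ℂ`.
-/
theorem DiffForm.extDeriv_eq_of_pullback {α : DiffForm I M k F} {Φ : M → V}
    {l : V → V [⋀^Fin k]→L[ℝ] F} {x : M} (hΦn : ∀ᶠ z in 𝓝 x, ContMDiffAt I 𝓘(ℝ, V) ∞ Φ z)
    (hl : DifferentiableAt ℝ l (Φ x))
    (h : ∀ᶠ z in 𝓝 x, α z = DiffForm.pullback I 𝓘(ℝ, V) Φ l z) :
    α.extDeriv x = (_root_.extDeriv l (Φ x)).compContinuousLinearMap (mfderiv I 𝓘(ℝ, V) Φ x) := by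
  have hx := mem_extChartAt_source (I := I) x
  have hy := mem_extChartAt_target (I := I) x
  have hs : (extChartAt I x).symm (extChartAt I x x) = x := (extChartAt I x).left_inv hx
  have ht : Tendsto (extChartAt I x).symm (𝓝 (extChartAt I x x)) (𝓝 x) := by
    have := continuousAt_extChartAt_symm (I := I) x
    rw [ContinuousAt, hs] at this
    exact this
  have h1 : α.inChart x =ᶠ[𝓝 (extChartAt I x x)] fun y =>
      (l ((Φ ∘ (extChartAt I x).symm) y)).compContinuousLinearMap
        (fderiv ℝ (Φ ∘ (extChartAt I x).symm) y) := by
    filter_upwards [ht.eventually h, ht.eventually hΦn,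
      (isOpen_extChartAt_target x).mem_nhds hy] with y h1 h2 h3
    exact DiffForm.inChart_eq_of_pullback h3 (h2.mdifferentiableAt (by simp)) h1
  have hΦs : ContDiffAt ℝ ∞ (Φ ∘ (extChartAt I x).symm) (extChartAt I x x) := by
    rw [← contMDiffAt_iff_contDiffAt]
    refine ContMDiffAt.comp _ (by rw [hs]; exact hΦn.self_of_nhds) ?_
    exact (contMDiffOn_extChartAt_symm (n := ∞) x).contMDiffAt
      ((isOpen_extChartAt_target x).mem_nhds hy)
  have h2 := extDeriv_pullback (f := Φ ∘ (extChartAt I x).symm) (x := extChartAt I x x)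
    (show DifferentiableAt ℝ l _ by simpa [hs] using hl) hΦs (by
      rw [minSmoothness_of_isRCLikeNormedField]; exact two_le_infty)
  rw [DiffForm.extDeriv, h1.extDeriv_eq, h2]
  have h3 := mfderiv_comp x (f := extChartAt I x) (g := Φ ∘ (extChartAt I x).symm)
    (hΦs.differentiableAt (by simp)).mdifferentiableAt
    ((contMDiffAt_extChartAt (I := I) (n := ∞)).mdifferentiableAt (by simp))
  have h4 : ((Φ ∘ (extChartAt I x).symm) ∘ extChartAt I x) =ᶠ[𝓝 x] Φ := by
    filter_upwards [(isOpen_extChartAt_source x).mem_nhds hx] with z hz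
    exact congrArg Φ ((extChartAt I x).left_inv hz)
  rw [h4.mfderiv_eq] at h3
  rw [h3, mfderiv_eq_fderiv]
  simp only [Function.comp_apply, hs]
  rfl

/-- The exterior derivative is defined at each point through the chart centred there; this shows
that any other chart gives the same result, so that closedness holds on a whole chart ball. -/
theorem DiffForm.extDeriv_inChart {α : DiffForm I M k F} (hα : α.IsSmooth)
    {i : M} {y : E} (hy : y ∈ (extChartAt I i).target) :
    _root_.extDeriv (α.inChart i) y =
      (α.extDeriv ((extChartAt I i).symm y)).compContinuousLinearMap
        (mfderiv 𝓘(ℝ, E) I (extChartAt I i).symm y) := by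
  have hx := (extChartAt I i).map_target hy
  have h := DiffForm.extDeriv_eq_of_pullback (α := α) (Φ := extChartAt I i) (l := α.inChart i)
    (x := (extChartAt I i).symm y) (by
      filter_upwards [(isOpen_extChartAt_source i).mem_nhds hx] with z hz
      exact contMDiffAt_extChartAt' (by rwa [extChartAt_source] at hz))
    (by
      rw [(extChartAt I i).right_inv hy]
      exact ((hα i).contDiffAt ((isOpen_extChartAt_target i).mem_nhds hy)).differentiableAt
        (by simp))
    (by
      filter_upwards [(isOpen_extChartAt_source i).mem_nhds hx] with z hz
      exact α.eq_pullback_inChart hz)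
  have h3 := mfderiv_comp y ((contMDiffAt_extChartAt' (I := I) (n := ∞)
    (by rwa [extChartAt_source] at hx)).mdifferentiableAt (by simp))
    (mdifferentiableAt_extChartAt_symm hy)
  have h4 : (extChartAt I i ∘ (extChartAt I i).symm) =ᶠ[𝓝 y] id := by
    filter_upwards [(isOpen_extChartAt_target i).mem_nhds hy] with z hz
      using (extChartAt I i).right_inv hz
  rw [h4.mfderiv_eq, mfderiv_id] at h3
  rw [h, (extChartAt I i).right_inv hy]
  ext v
  change _ = _root_.extDeriv (α.inChart i) y fun j =>
    (mfderiv I 𝓘(ℝ, E) (extChartAt I i) ((extChartAt I i).symm y))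
      ((mfderiv 𝓘(ℝ, E) I (extChartAt I i).symm y) (v j))
  have h5 : ∀ w : TangentSpace 𝓘(ℝ, E) y, (mfderiv I 𝓘(ℝ, E) (extChartAt I i)
      ((extChartAt I i).symm y)) ((mfderiv 𝓘(ℝ, E) I (extChartAt I i).symm y) w) = w := fun w =>
    (DFunLike.congr_fun h3 w).symm
  exact congrArg _ (funext fun j => (h5 (v j)).symm)

theorem DiffForm.extDeriv_inChart_eq_zero {α : DiffForm I M k F} (hα : α.IsSmooth)
    (hd : α.extDeriv = 0) {i : M} {y : E} (hy : y ∈ (extChartAt I i).target) :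
    _root_.extDeriv (α.inChart i) y = 0 := by
  rw [DiffForm.extDeriv_inChart hα hy, hd]
  rfl

end FormsInCharts

/-! ### Integrals over smooth triangles -/

section Triangles

theorem measurableSet_triangle : MeasurableSet triangle :=
  ((isClosed_le continuous_const continuous_fst).inter
    ((isClosed_le continuous_const continuous_snd).inter
      (isClosed_le (continuous_fst.add continuous_snd) continuous_const))).measurableSet

variable {n : ℕ} {M : Type u} [TopologicalSpace M] [ChartedSpace (EuclideanSpace ℝ (Fin n)) M]
  [IsManifold (𝓡 n) ∞ M]

/-- The radial primitive of a two-form in the preferred chart. -/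
def chartPrimitive (α : DiffForm (𝓡 n) M 2 ℝ) (i : M) :
    EuclideanSpace ℝ (Fin n) → EuclideanSpace ℝ (Fin n) [⋀^Fin 1]→L[ℝ] ℝ :=
  radialPrimitive (α.inChart i) (chartCenter n i)

theorem contDiffOn_chartPrimitive {α : DiffForm (𝓡 n) M 2 ℝ} (hα : α.IsSmooth) (i : M) :
    ContDiffOn ℝ ∞ (chartPrimitive α i) (chartBall n i) :=
  contDiffOn_radialPrimitive ((hα i).mono (chartBall_subset_target n i))

theorem extDeriv_chartPrimitive {α : DiffForm (𝓡 n) M 2 ℝ} (hα : α.IsSmooth)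
    (hd : α.extDeriv = 0) (i : M) {y : EuclideanSpace ℝ (Fin n)} (hy : y ∈ chartBall n i) :
    extDeriv (chartPrimitive α i) y = α.inChart i y :=
  extDeriv_radialPrimitive ((hα i).mono (chartBall_subset_target n i))
    (fun _ hz => DiffForm.extDeriv_inChart_eq_zero hα hd (chartBall_subset_target n i hz)) hy

/-- A path in a chart ball with a smooth expression in the chart. -/
structure IsSmoothChartPath (i : M) (γ : SingularSimplex 1 M)
    (Y : ℝ → EuclideanSpace ℝ (Fin n)) : Prop where
  mem : ∀ t, γ t ∈ chartNhd n i
  eq : ∀ t : stdSimplex ℝ (Fin 2), extChartAt (𝓡 n) i (γ t) = Y (t 1)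
  smooth : ∃ J : Set ℝ, IsOpen J ∧ Icc 0 1 ⊆ J ∧ ContDiffOn ℝ ∞ Y J

theorem IsSmoothChartPath.mem_ball {i : M} {γ : SingularSimplex 1 M}
    {Y : ℝ → EuclideanSpace ℝ (Fin n)} (h : IsSmoothChartPath i γ Y) {s : ℝ} (hs : s ∈ Icc (0 : ℝ) 1) :
    Y s ∈ chartBall n i := by
  have e := h.eq (stdSimplexHomeomorphUnitInterval.symm ⟨_, hs⟩)
  have e' : (stdSimplexHomeomorphUnitInterval.symm ⟨_, hs⟩) 1 = s :=
    congrArg Subtype.val (stdSimplexHomeomorphUnitInterval.apply_symm_apply ⟨_, hs⟩)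
  rw [e'] at e
  rw [← e]
  exact (h.mem _).2

/-- A smooth path in a chart ball spans a smooth simplex with radial sides, over which the integral
of a two-form is the integral of the primitive along the path. -/
theorem IsSmoothChartPath.exists_simplex {i : M} {γ : SingularSimplex 1 M}
    {Y : ℝ → EuclideanSpace ℝ (Fin n)} (h : IsSmoothChartPath i γ Y) :
    ∃ (σ : SingularSimplex 2 M) (g : ℝ × ℝ → M), σ.face 0 = γ ∧
      σ.face 1 = chartRadial n i (γ (stdSimplex.vertex 1)) ∧
      σ.face 2 = chartRadial n i (γ (stdSimplex.vertex 0)) ∧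
      IsSmoothExtension (𝓡 n) σ g ∧ ∀ α : DiffForm (𝓡 n) M 2 ℝ, α.IsSmooth →
        triangleIntegral α g = ∫ s in (0 : ℝ)..1, chartPrimitive α i (Y s) ![deriv Y s] := by
  obtain ⟨σ, h0, h1, h2, h3⟩ := exists_cone i γ h.mem
  obtain ⟨J, hJ, hJ1, hY⟩ := h.smooth
  have hG := contDiffOn_coneMap (chartCenter n i) hJ hY
  have hUo : IsOpen (coneDomain J ∩ coneMap (chartCenter n i) Y ⁻¹' chartBall n i) :=
    hG.continuousOn.isOpen_inter_preimage (isOpen_coneDomain hJ) Metric.isOpen_ball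
  have hsub : triangle ⊆ coneDomain J ∩ coneMap (chartCenter n i) Y ⁻¹' chartBall n i := fun q hq =>
    ⟨triangle_subset_coneDomain hJ1 hq, coneMap_mem_ball (fun s hs => h.mem_ball hs) hq⟩
  refine ⟨σ, fun q => (extChartAt (𝓡 n) i).symm (coneMap (chartCenter n i) Y q), h0, h1, h2,
    ⟨h3 Y h.eq, _, hUo, hsub, ?_⟩, fun α hα => ?_⟩
  · exact (contMDiffOn_extChartAt_symm i).comp (hG.mono inter_subset_left).contMDiffOn
      fun q hq => chartBall_subset_target n i hq.2
  · rw [chartPrimitive, ← integral_coneMap ((hα i).mono (chartBall_subset_target n i)) hJ hJ1 hY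
      fun s hs => h.mem_ball hs]
    have hm := measurableSet_triangle
    refine setIntegral_congr_fun hm fun q hq => ?_
    have hq' := hsub hq
    have hd : DifferentiableAt ℝ (coneMap (chartCenter n i) Y) q :=
      (hG.contDiffAt ((isOpen_coneDomain hJ).mem_nhds hq'.1)).differentiableAt (by simp)
    have hc := mfderiv_comp q (mdifferentiableAt_extChartAt_symm (I := 𝓡 n) (i := i)
      (chartBall_subset_target n i hq'.2)) hd.mdifferentiableAt
    rw [mfderiv_eq_fderiv] at hc
    simp only [DiffForm.pullback, DiffForm.inChart]
    change α _ (fun j => mfderiv 𝓘(ℝ, ℝ × ℝ) (𝓡 n) ((extChartAt (𝓡 n) i).symm ∘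
      coneMap (chartCenter n i) Y) q _) = _
    rw [hc]
    refine congrArg (α _) ?_
    ext1 j
    fin_cases j <;> rfl

theorem triangleIntegral_comp {α : DiffForm (𝓡 n) M 2 ℝ} {f : M → M}
    (hf : ContMDiff (𝓡 n) (𝓡 n) ∞ f) (hα : α.pullback (𝓡 n) (𝓡 n) f = α)
    {σ : SingularSimplex 2 M} {g : ℝ × ℝ → M} (hg : IsSmoothExtension (𝓡 n) σ g) :
    triangleIntegral α (f ∘ g) = triangleIntegral α g := by
  obtain ⟨-, U, hU, hUt, hgU⟩ := hg
  have hm := measurableSet_triangle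
  refine setIntegral_congr_fun hm fun q hq => ?_
  have hc := mfderiv_comp q ((hf (g q)).mdifferentiableAt (by simp))
    ((hgU.contMDiffAt (hU.mem_nhds (hUt hq))).mdifferentiableAt (by simp))
  have h := congrFun hα (g q)
  simp only [DiffForm.pullback] at h ⊢
  rw [hc, ← h]
  rfl

end Triangles

/-! ### Circle-valued functions with prescribed holonomy -/

section Holonomy

open Filter Topology

/-- The point of the circle with angle `2πt`. -/
def unitExp (t : ℝ) : Circle := Circle.exp (2 * Real.pi * t)

@[simp] theorem unitExp_zero : unitExp 0 = 1 := by simp [unitExp]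

theorem unitExp_add (s t : ℝ) : unitExp (s + t) = unitExp s * unitExp t := by
  rw [unitExp, mul_add, Circle.exp_add]; rfl

theorem unitExp_neg (t : ℝ) : unitExp (-t) = (unitExp t)⁻¹ := by
  rw [unitExp, mul_neg, Circle.exp_neg]; rfl

theorem unitExp_sub (s t : ℝ) : unitExp (s - t) = unitExp s * (unitExp t)⁻¹ := by
  rw [sub_eq_add_neg, unitExp_add, unitExp_neg]

theorem unitExp_intCast (k : ℤ) : unitExp k = 1 := by
  rw [unitExp, mul_comm, Circle.exp_int_mul_two_pi]

theorem contMDiff_unitExp : ContMDiff 𝓘(ℝ, ℝ) (𝓡 1) ∞ unitExp :=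
  contMDiff_circleExp.comp (contDiff_const.mul contDiff_id).contMDiff

theorem hasDerivAt_unitExp (t : ℝ) : HasDerivAt (fun t => (unitExp t : ℂ))
    (2 * Real.pi * Complex.I * unitExp t) t := by
  have h1 : HasDerivAt (fun t : ℝ => ((2 * Real.pi * t : ℝ) : ℂ) * Complex.I)
      (2 * Real.pi * Complex.I) t := by
    have := (((hasDerivAt_id t).const_mul (2 * Real.pi)).ofReal_comp).mul_const Complex.I
    simpa using this
  have h2 := h1.cexp
  simp only [unitExp, Circle.coe_exp]
  convert h2 using 1
  ring

variable {E : Type} [NormedAddCommGroup E] [NormedSpace ℝ E] [FiniteDimensional ℝ E]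

/-- No continuity of `g` is assumed: near `y` it equals a constant times the exponential of a
parametric integral of `β` along segments from `y`, and this is smooth. -/
theorem smooth_of_holonomy {g : E → Circle} {β : E → E →L[ℝ] ℝ} {W : Set E}
    (hβ : ContDiffOn ℝ ∞ β W) (h : ∀ y ∈ W, ∃ ε > 0, Metric.ball y ε ⊆ W ∧
      ∀ z ∈ Metric.ball y ε, g z = g y * unitExp (∫ s in (0 : ℝ)..1, β (y + s • (z - y)) (z - y)))
    {y : E} (hy : y ∈ W) : ContMDiffAt 𝓘(ℝ, E) (𝓡 1) ∞ g y ∧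
      HasFDerivAt (fun z => (g z : ℂ)) ((β y).smulRight (2 * Real.pi * Complex.I * g y)) y := by
  obtain ⟨ε, hε, hεW, hg⟩ := h y hy
  let N : E → ℝ := fun z => ∫ s in (0 : ℝ)..1, β (y + s • (z - y)) (z - y)
  have hO := isOpen_radialDomain y ε
  have hyb : y ∈ Metric.ball y ε := Metric.mem_ball_self hε
  have hK : ContDiffOn ℝ ∞ (fun p : E × ℝ => β (y + p.2 • (p.1 - y)) (p.1 - y))
      {p : E × ℝ | y + p.2 • (p.1 - y) ∈ Metric.ball y ε} := by
    refine ContDiffOn.clm_apply (f := fun p : E × ℝ => β (y + p.2 • (p.1 - y))) ?_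
      (ContDiff.contDiffOn (by fun_prop))
    exact hβ.comp (ContDiff.contDiffOn (by fun_prop)) fun p hp => hεW hp
  have hN : ContDiffOn ℝ ∞ N (Metric.ball y ε) :=
    contDiffOn_parametric_integral hO hK Metric.isOpen_ball
      fun z hz t ht => add_smul_sub_mem_ball hz ht
  have hgN : g =ᶠ[𝓝 y] fun z => g y * unitExp (N z) := by
    filter_upwards [Metric.isOpen_ball.mem_nhds hyb] with z hz using hg z hz
  have hNy : N y = 0 := by simp [N]
  constructor
  · refine ContMDiffAt.congr_of_eventuallyEq ?_ hgN
    refine contMDiffAt_const.mul (contMDiff_unitExp.contMDiffAt.comp y ?_)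
    exact (hN.contDiffAt (Metric.isOpen_ball.mem_nhds hyb)).contMDiffAt
  · have h1 := hasFDerivAt_parametric_integral hO (hK.of_le (by simp))
      (y := y) fun t ht => add_smul_sub_mem_ball hyb ht
    have h2 : HasFDerivAt N (β y) y := by
      refine h1.congr_fderiv ?_
      -- At the base point the argument `z - y` vanishes, so the derivative of `β` does not
      -- contribute.
      have : ∀ s ∈ uIcc (0 : ℝ) 1, (fderiv ℝ (fun p : E × ℝ => β (y + p.2 • (p.1 - y)) (p.1 - y))
          (y, s)).comp (.inl ℝ E ℝ) = β y := fun s hs => by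
        rw [uIcc_of_le zero_le_one] at hs
        have k1 : HasFDerivAt (fun p : E × ℝ => β (y + p.2 • (p.1 - y)) (p.1 - y))
            (fderiv ℝ (fun p : E × ℝ => β (y + p.2 • (p.1 - y)) (p.1 - y)) (y, s)) (y, s) :=
          ((hK.contDiffAt (hO.mem_nhds (add_smul_sub_mem_ball hyb hs))).differentiableAt
            (by simp)).hasFDerivAt
        have k2 : HasFDerivAt (fun z : E => (z, s)) (.inl ℝ E ℝ) y :=
          (hasFDerivAt_id y).prodMk (hasFDerivAt_const s y)
        have k3 := k1.comp y k2
        have k4 : DifferentiableAt ℝ (fun z : E => β (y + s • (z - y))) y := by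
          refine DifferentiableAt.comp (g := β) y ?_ (by fun_prop)
          simpa using ((hβ y hy).contDiffAt (mem_of_superset (Metric.isOpen_ball.mem_nhds hyb)
            hεW)).differentiableAt (by simp)
        have k5 := k4.hasFDerivAt.clm_apply ((hasFDerivAt_id y).sub_const y)
        refine (k3.unique k5).trans ?_
        ext v
        simp
      rw [intervalIntegral.integral_congr this]
      simp
    have h3 := (hasDerivAt_unitExp (N y)).hasFDerivAt.comp y h2
    have h4 : HasFDerivAt (fun z => ((g y : ℂ) * unitExp (N z))) _ y := h3.const_mul (g y : ℂ)
    refine (h4.congr_of_eventuallyEq (hgN.mono fun z hz => ?_)).congr_fderiv ?_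
    · simp only [hz, Circle.coe_mul]
    · ext v
      simp [hNy]
      ring

end Holonomy

/-! ### Potentials, transition functions and their logarithmic derivatives -/

section Potentials

open Filter Topology

variable {n : ℕ} {M : Type u} [TopologicalSpace M] [ChartedSpace (EuclideanSpace ℝ (Fin n)) M]

/-- Local potentials `a` of the two-form `α`, and functions `B`, with which the path function `b`
computes the holonomy of smooth paths. -/
structure IsPotential (α : DiffForm (𝓡 n) M 2 ℝ)
    (a : M → EuclideanSpace ℝ (Fin n) → EuclideanSpace ℝ (Fin n) [⋀^Fin 1]→L[ℝ] ℝ)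
    (B : M → M → Circle) (b : SingularSimplex 1 M → ℝ) : Prop where
  smooth : ∀ i, ContDiffOn ℝ ∞ (a i) (chartBall n i)
  extDeriv : ∀ i, ∀ y ∈ chartBall n i, extDeriv (a i) y = α.inChart i y
  holonomy : ∀ i γ Y, IsSmoothChartPath i γ Y →
    unitExp (∫ s in (0 : ℝ)..1, a i (Y s) ![deriv Y s]) =
      unitExp (b γ) * B i (γ (stdSimplex.vertex 0)) * (B i (γ (stdSimplex.vertex 1)))⁻¹

/-- Circle-valued functions whose differences along small smooth paths are the holonomies of
`f^* α - α`. -/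
def IsHolonomyRatio (n : ℕ) {M : Type u} [TopologicalSpace M]
    [ChartedSpace (EuclideanSpace ℝ (Fin n)) M] (b : SingularSimplex 1 M → ℝ) (f : C(M, M))
    (u : M → Circle) : Prop :=
  ∀ i j γ Y Z, IsSmoothChartPath (n := n) i γ Y → IsSmoothChartPath (n := n) j (f.comp γ) Z →
    u (γ (stdSimplex.vertex 1)) = u (γ (stdSimplex.vertex 0)) * unitExp (b (f.comp γ) - b γ)

theorem isHolonomyRatio_one (b : SingularSimplex 1 M → ℝ) :
    IsHolonomyRatio n b (ContinuousMap.id M) fun _ => 1 := by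
  intro i j γ Y Z _ _
  simp

variable {α : DiffForm (𝓡 n) M 2 ℝ}
  {a : M → EuclideanSpace ℝ (Fin n) → EuclideanSpace ℝ (Fin n) [⋀^Fin 1]→L[ℝ] ℝ}
  {B : M → M → Circle} {b : SingularSimplex 1 M → ℝ} {f : C(M, M)} {u : M → Circle}

/-- The expression of the map `f` in charts. -/
def chartExpr (n : ℕ) {M : Type u} [TopologicalSpace M]
    [ChartedSpace (EuclideanSpace ℝ (Fin n)) M] (f : C(M, M)) (i j : M) :
    EuclideanSpace ℝ (Fin n) → EuclideanSpace ℝ (Fin n) :=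
  fun y => extChartAt (𝓡 n) j (f ((extChartAt (𝓡 n) i).symm y))

/-- The domain of the expression of the map `f` in charts. -/
def chartDomain (n : ℕ) {M : Type u} [TopologicalSpace M]
    [ChartedSpace (EuclideanSpace ℝ (Fin n)) M] (f : C(M, M)) (i j : M) :
    Set (EuclideanSpace ℝ (Fin n)) :=
  chartBall n i ∩ (fun y => f ((extChartAt (𝓡 n) i).symm y)) ⁻¹' chartNhd n j

theorem isOpen_chartDomain (f : C(M, M)) (i j : M) : IsOpen (chartDomain n f i j) :=
  (f.continuous.comp_continuousOn ((continuousOn_extChartAt_symm i).mono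
    (chartBall_subset_target n i))).isOpen_inter_preimage Metric.isOpen_ball (isOpen_chartNhd n j)

theorem contDiffOn_chartExpr [IsManifold (𝓡 n) ∞ M] (hf : ContMDiff (𝓡 n) (𝓡 n) ∞ f) (i j : M) :
    ContDiffOn ℝ ∞ (chartExpr n f i j) (chartDomain n f i j) := by
  rw [← contMDiffOn_iff_contDiffOn]
  refine (contMDiffOn_extChartAt (n := ∞)).comp (hf.comp_contMDiffOn
    ((contMDiffOn_extChartAt_symm i).mono fun y hy => chartBall_subset_target n i hy.1))
    fun y hy => ?_
  have := hy.2.1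
  rwa [extChartAt_source] at this

/-- The transition function between a trivialization near `i` and one near `j`, along `f`. -/
def transitionFun (B : M → M → Circle) (f : M → M) (u : M → Circle) (i j x : M) : Circle :=
  B i x * u x * (B j (f x))⁻¹

/-- The difference of the potentials, in charts. -/
def potentialDiff (a : M → EuclideanSpace ℝ (Fin n) → EuclideanSpace ℝ (Fin n) [⋀^Fin 1]→L[ℝ] ℝ)
    (f : C(M, M)) (i j : M) (y : EuclideanSpace ℝ (Fin n)) : EuclideanSpace ℝ (Fin n) →L[ℝ] ℝ :=
  ((oneFormEquiv _ _).symm (a j (chartExpr n f i j y))).comp (fderiv ℝ (chartExpr n f i j) y) -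
    (oneFormEquiv _ _).symm (a i y)

theorem potentialDiff_apply (i j : M) (y v : EuclideanSpace ℝ (Fin n)) :
    potentialDiff a f i j y v = a j (chartExpr n f i j y) ![fderiv ℝ (chartExpr n f i j) y v] -
      a i y ![v] := by
  simp [potentialDiff, oneFormEquiv_symm_apply]

theorem chartExpr_mem {i j : M} {y : EuclideanSpace ℝ (Fin n)} (hy : y ∈ chartDomain n f i j) :
    chartExpr n f i j y ∈ chartBall n j := hy.2.2

variable [IsManifold (𝓡 n) ∞ M]

theorem contDiffOn_potentialDiff (ha : IsPotential α a B b) (hf : ContMDiff (𝓡 n) (𝓡 n) ∞ f)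
    (i j : M) : ContDiffOn ℝ ∞ (potentialDiff a f i j) (chartDomain n f i j) := by
  have hT := contDiffOn_chartExpr hf i j
  have e := (oneFormEquiv (EuclideanSpace ℝ (Fin n)) ℝ).symm.contDiff (n := ∞)
  refine ContDiffOn.sub (ContDiffOn.clm_comp ?_ ?_) ?_
  · exact e.comp_contDiffOn ((ha.smooth j).comp hT fun y hy => chartExpr_mem hy)
  · exact hT.fderiv_of_isOpen (isOpen_chartDomain f i j) (by simp)
  · exact e.comp_contDiffOn ((ha.smooth i).mono inter_subset_left)

/-- Straight segments are the test paths: the holonomy conditions at `i` and `j` both apply to them,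
and the radial neighbourhood of `y` is swept out by their end points. -/
theorem exists_smooth_segment (hf : ContMDiff (𝓡 n) (𝓡 n) ∞ f) (i j : M)
    {y : EuclideanSpace ℝ (Fin n)} {ε : ℝ} (hε : Metric.ball y ε ⊆ chartDomain n f i j)
    {z : EuclideanSpace ℝ (Fin n)} (hz : z ∈ Metric.ball y ε) :
    ∃ γ : SingularSimplex 1 M, IsSmoothChartPath i γ (fun s => y + s • (z - y)) ∧
      IsSmoothChartPath j (f.comp γ) (fun s => chartExpr n f i j (y + s • (z - y))) ∧
      γ (stdSimplex.vertex 0) = (extChartAt (𝓡 n) i).symm y ∧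
      γ (stdSimplex.vertex 1) = (extChartAt (𝓡 n) i).symm z := by
  let Y : ℝ → EuclideanSpace ℝ (Fin n) := fun s => y + s • (z - y)
  have hYd : ContDiff ℝ ∞ Y := by fun_prop
  have hYt : ∀ t : stdSimplex ℝ (Fin 2), Y (t 1) ∈ Metric.ball y ε := fun t =>
    add_smul_sub_mem_ball hz (stdSimplexHomeomorphUnitInterval t).2
  have hYs : ∀ s ∈ Icc (0 : ℝ) 1, Y s ∈ Metric.ball y ε := fun s hs => add_smul_sub_mem_ball hz hs
  let J : Set ℝ := Y ⁻¹' Metric.ball y ε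
  have hJ : IsOpen J := Metric.isOpen_ball.preimage hYd.continuous
  let γ : SingularSimplex 1 M := ⟨fun t => (extChartAt (𝓡 n) i).symm (Y (t 1)),
    continuous_extChartAt_symm_comp (hYd.continuous.comp
      ((continuous_apply 1).comp continuous_subtype_val)) fun t => (hε (hYt t)).1⟩
  refine ⟨γ, ⟨fun t => extChartAt_symm_mem_chartNhd (hε (hYt t)).1,
    fun t => extChartAt_right_inv_of_mem (hε (hYt t)).1, J, hJ, hYs, hYd.contDiffOn⟩,
    ⟨fun t => (hε (hYt t)).2, fun t => rfl, J, hJ, hYs,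
      (contDiffOn_chartExpr hf i j).comp hYd.contDiffOn fun s hs => hε hs⟩, ?_, ?_⟩
  · simp [γ, Y]
  · simp [γ, Y]

/-- The holonomy formulas for the segment and its image contain `b γ` and `b (f.comp γ)`; the change
of `u` cancels exactly these, leaving the integrals of the potentials. -/
theorem transitionFun_segment (ha : IsPotential α a B b) (hf : ContMDiff (𝓡 n) (𝓡 n) ∞ f)
    (hu : IsHolonomyRatio n b f u) (i j : M) {y : EuclideanSpace ℝ (Fin n)} {ε : ℝ}
    (hε : Metric.ball y ε ⊆ chartDomain n f i j) {z : EuclideanSpace ℝ (Fin n)}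
    (hz : z ∈ Metric.ball y ε) :
    transitionFun B f u i j ((extChartAt (𝓡 n) i).symm z) =
      transitionFun B f u i j ((extChartAt (𝓡 n) i).symm y) *
        unitExp (∫ s in (0 : ℝ)..1, potentialDiff a f i j (y + s • (z - y)) (z - y)) := by
  have hT := contDiffOn_chartExpr hf i j
  let Y : ℝ → EuclideanSpace ℝ (Fin n) := fun s => y + s • (z - y)
  have hYd : ContDiff ℝ ∞ Y := by fun_prop
  have hYs : ∀ s ∈ Icc (0 : ℝ) 1, Y s ∈ Metric.ball y ε := fun s hs => add_smul_sub_mem_ball hz hs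
  obtain ⟨γ, hγ, hfγ, h0, h1⟩ := exists_smooth_segment hf i j hε hz
  have e1 := ha.holonomy i γ Y hγ
  have e2 := ha.holonomy j _ _ hfγ
  have e3 := hu i j γ _ _ hγ hfγ
  have hY' : ∀ s, deriv Y s = z - y := fun s => by
    have : HasDerivAt Y (z - y) s := by
      have h := ((hasDerivAt_id s).smul_const (z - y)).const_add y
      rwa [one_smul] at h
    exact this.deriv
  have hZ' : ∀ s ∈ Icc (0 : ℝ) 1, deriv (fun s => chartExpr n f i j (Y s)) s =
      fderiv ℝ (chartExpr n f i j) (Y s) (z - y) := fun s hs => by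
    have h := ((hT.contDiffAt ((isOpen_chartDomain f i j).mem_nhds (hε (hYs s hs)))).differentiableAt
      (by simp)).hasFDerivAt
    rw [← hY' s]
    exact (h.comp_hasDerivAt s (hYd.differentiable (by simp) s).hasDerivAt).deriv
  have e4 : ∫ s in (0 : ℝ)..1, potentialDiff a f i j (y + s • (z - y)) (z - y) =
      (∫ s in (0 : ℝ)..1, a j (chartExpr n f i j (Y s)) ![deriv (fun s => chartExpr n f i j (Y s)) s])
        - ∫ s in (0 : ℝ)..1, a i (Y s) ![deriv Y s] := by
    have hc1 : ContinuousOn (fun s => a i (Y s) ![z - y]) (uIcc 0 1) := by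
      rw [uIcc_of_le zero_le_one]
      exact (ContinuousAlternatingMap.apply ℝ _ ℝ _).continuous.comp_continuousOn
        ((ha.smooth i).continuousOn.comp hYd.continuous.continuousOn fun s hs => (hε (hYs s hs)).1)
    have hc2 : ContinuousOn (fun s => potentialDiff a f i j (Y s) (z - y)) (uIcc 0 1) := by
      rw [uIcc_of_le zero_le_one]
      exact ((contDiffOn_potentialDiff ha hf i j).continuousOn.comp hYd.continuous.continuousOn
        fun s hs => hε (hYs s hs)).clm_apply continuousOn_const
    simp only [hY']
    rw [eq_sub_iff_add_eq, ← intervalIntegral.integral_add hc2.intervalIntegrable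
      hc1.intervalIntegrable]
    refine intervalIntegral.integral_congr fun s hs => ?_
    rw [uIcc_of_le zero_le_one] at hs
    rw [potentialDiff_apply, hZ' s hs]
    ring
  rw [e4, unitExp_sub, e1, e2]
  rw [h0, h1, unitExp_sub] at e3
  rw [ContinuousMap.comp_apply, ContinuousMap.comp_apply, h0, h1]
  simp only [transitionFun, e3]
  apply Additive.ofMul.injective
  simp only [ofMul_mul, ofMul_inv]
  abel

/-- Transition functions are smooth, and their logarithmic derivative is the difference of the
potentials. -/
theorem contMDiffAt_transitionFun_symm (ha : IsPotential α a B b)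
    (hf : ContMDiff (𝓡 n) (𝓡 n) ∞ f) (hu : IsHolonomyRatio n b f u) (i j : M)
    {y : EuclideanSpace ℝ (Fin n)} (hy : y ∈ chartDomain n f i j) :
    ContMDiffAt 𝓘(ℝ, EuclideanSpace ℝ (Fin n)) (𝓡 1) ∞
        (fun y => transitionFun B f u i j ((extChartAt (𝓡 n) i).symm y)) y ∧
      HasFDerivAt (fun y => (transitionFun B f u i j ((extChartAt (𝓡 n) i).symm y) : ℂ))
        ((potentialDiff a f i j y).smulRight (2 * Real.pi * Complex.I *
          transitionFun B f u i j ((extChartAt (𝓡 n) i).symm y))) y := by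
  refine smooth_of_holonomy (contDiffOn_potentialDiff ha hf i j) (fun y hy => ?_) hy
  obtain ⟨ε, hε, hb⟩ := Metric.isOpen_iff.1 (isOpen_chartDomain f i j) y hy
  exact ⟨ε, hε, hb, fun z hz => transitionFun_segment ha hf hu i j hb hz⟩

theorem contMDiffOn_transitionFun (ha : IsPotential α a B b)
    (hf : ContMDiff (𝓡 n) (𝓡 n) ∞ f) (hu : IsHolonomyRatio n b f u) (i j : M) :
    ContMDiffOn (𝓡 n) (𝓡 1) ∞ (transitionFun B f u i j) (chartNhd n i ∩ f ⁻¹' chartNhd n j) := by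
  rintro x ⟨hi, hj⟩
  have hx : (extChartAt (𝓡 n) i).symm (extChartAt (𝓡 n) i x) = x := (extChartAt (𝓡 n) i).left_inv hi.1
  have hy : extChartAt (𝓡 n) i x ∈ chartDomain n f i j :=
    ⟨hi.2, by rw [mem_preimage, hx]; exact hj⟩
  have h := (contMDiffAt_transitionFun_symm ha hf hu i j hy).1
  have h2 := h.comp x (contMDiffAt_extChartAt' (n := ∞) (by
    have := hi.1
    rwa [extChartAt_source] at this))
  refine (h2.congr_of_eventuallyEq ?_).contMDiffWithinAt
  filter_upwards [(isOpen_extChartAt_source i).mem_nhds hi.1] with z hz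
  simp only [Function.comp_apply, (extChartAt (𝓡 n) i).left_inv hz]

end Potentials

/-! ### Existence of potentials and their adjustment to f -/

section PotentialConstruction

open Filter Topology

variable {n : ℕ} {M : Type u} [TopologicalSpace M] [ChartedSpace (EuclideanSpace ℝ (Fin n)) M]
  [IsManifold (𝓡 n) ∞ M] {α : DiffForm (𝓡 n) M 2 ℝ}

/-- The radial potentials of a closed form with integral class. -/
theorem isPotential_chartPrimitive (hα : α.IsSmooth) (hd : α.extDeriv = 0)
    {c : SingularSimplex 2 M → ℤ} {b : SingularSimplex 1 M → ℝ}
    (hb : ∀ (σ : SingularSimplex 2 M) (g : ℝ × ℝ → M), IsSmoothExtension (𝓡 n) σ g →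
      triangleIntegral α g = (c σ : ℝ) + singularCoboundary b σ) :
    IsPotential α (chartPrimitive α) (fun i x => unitExp (b (chartRadial n i x))) b where
  smooth := contDiffOn_chartPrimitive hα
  extDeriv i _ hy := extDeriv_chartPrimitive hα hd i hy
  holonomy i γ Y h := by
    obtain ⟨σ, g, h0, h1, h2, hg, hint⟩ := h.exists_simplex
    -- The integer `c σ` disappears under the exponential; the radial sides give the two values of
    -- `B i`.
    rw [← hint α hα, hb σ g hg, singularCoboundary_one_apply, h0, h1, h2, unitExp_add,
      unitExp_intCast, unitExp_add, unitExp_sub]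
    apply Additive.ofMul.injective
    simp only [ofMul_mul, ofMul_inv, ofMul_one]
    abel

theorem extDeriv_fderiv {E : Type} [NormedAddCommGroup E] [NormedSpace ℝ E] {f : E → ℝ} {y : E}
    (hf : ContDiffAt ℝ ∞ f y) : extDeriv (fun z => oneFormEquiv E ℝ (fderiv ℝ f z)) y = 0 := by
  have h : (fun z => oneFormEquiv E ℝ (fderiv ℝ f z)) =
      extDeriv fun z => ContinuousAlternatingMap.constOfIsEmpty ℝ E (Fin 0) (f z) := by
    funext z
    rw [extDeriv_constOfIsEmpty]
    rfl
  have hc : ContDiffAt ℝ ∞ (fun z => ContinuousAlternatingMap.constOfIsEmpty ℝ E (Fin 0) (f z)) y :=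
    (ContinuousAlternatingMap.constOfIsEmptyLIE ℝ E ℝ (Fin 0)).contDiff.contDiffAt.comp y hf
  rw [h]
  exact extDeriv_extDeriv_apply hc (by
    rw [minSmoothness_of_isRCLikeNormedField]; exact two_le_infty)

/-- Local primitives of a real cocycle can be made smooth by adding a global function. -/
theorem exists_smooth_primitive [T2Space M] [CompactSpace M] {e : SingularSimplex 1 M → ℝ}
    (he : singularCoboundary e = 0) : ∃ w : M → ℝ, ∀ i : M,
      ContMDiffOn (𝓡 n) 𝓘(ℝ, ℝ) ∞ (fun x => e (chartRadial n i x) + w x) (chartNhd n i) := by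
  have : LocallyPathConnectedSpace M :=
    ChartedSpace.locallyPathConnectedSpace (EuclideanSpace ℝ (Fin n)) M
  obtain ⟨ρ, hρ⟩ := SmoothPartitionOfUnity.exists_isSubordinate (𝓡 n) (isClosed_univ (X := M))
    (chartNhd n) (isOpen_chartNhd n) fun x _ => mem_iUnion.2 ⟨x, mem_chartNhd n x⟩
  -- Subtracting the average of the local primitives turns each of them into a sum of bump functions
  -- times differences of primitives, and these differences are locally constant.
  refine ⟨fun x => - ∑ᶠ j, ρ j x * e (chartRadial n j x), fun i x hx => ?_⟩
  have h1 : (fun x => e (chartRadial n i x) + - ∑ᶠ j, ρ j x * e (chartRadial n j x)) =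
      fun x => ∑ᶠ j, ρ j x • (e (chartRadial n i x) - e (chartRadial n j x)) := by
    funext y
    have hfin : ∀ g : M → ℝ, (Function.support fun j => ρ j y * g j).Finite := fun g =>
      (ρ.locallyFinite.point_finite y).subset fun j hj => left_ne_zero_of_mul hj
    have h2 := finsum_sub_distrib (hfin fun _ => e (chartRadial n i y))
      (hfin fun j => e (chartRadial n j y))
    simp only [smul_eq_mul, mul_sub]
    rw [h2, ← finsum_mul, ρ.sum_eq_one (mem_univ y), one_mul, sub_eq_add_neg]
  rw [h1]
  refine (ρ.contMDiffAt_finsum (n := ⊤) fun j hj => ?_).contMDiffWithinAt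
  exact (contMDiffAt_const (c := e (chartRadial n i x) - e (chartRadial n j x))).congr_of_eventuallyEq
    (isConedCover_chartNhd.locallyConstant he i j ⟨hx, hρ j hj⟩)

theorem ContinuousOn.oneForm_apply {X E : Type*} [TopologicalSpace X] [NormedAddCommGroup E]
    [NormedSpace ℝ E] {l : X → E [⋀^Fin 1]→L[ℝ] ℝ} {v : X → E} {s : Set X} (hl : ContinuousOn l s)
    (hv : ContinuousOn v s) : ContinuousOn (fun x => l x ![v x]) s := by
  have h := ((oneFormEquiv E ℝ).symm.continuous.comp_continuousOn hl).clm_apply hv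
  exact h.congr fun x _ => (oneFormEquiv_symm_apply (l x) (v x)).symm

/-- Potentials can be changed by a real cocycle. -/
theorem IsPotential.exists_add_cocycle [T2Space M] [CompactSpace M]
    {a : M → EuclideanSpace ℝ (Fin n) → EuclideanSpace ℝ (Fin n) [⋀^Fin 1]→L[ℝ] ℝ}
    {B : M → M → Circle} {b : SingularSimplex 1 M → ℝ} (ha : IsPotential α a B b)
    {e : SingularSimplex 1 M → ℝ} (he : singularCoboundary e = 0) :
    ∃ (a' : M → EuclideanSpace ℝ (Fin n) → EuclideanSpace ℝ (Fin n) [⋀^Fin 1]→L[ℝ] ℝ) (w : M → ℝ),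
      IsPotential α a' B fun γ =>
        b γ + e γ + (w (γ (stdSimplex.vertex 1)) - w (γ (stdSimplex.vertex 0))) := by
  obtain ⟨w, hw⟩ := exists_smooth_primitive (n := n) he
  let S : M → EuclideanSpace ℝ (Fin n) → ℝ := fun i y =>
    e (chartRadial n i ((extChartAt (𝓡 n) i).symm y)) + w ((extChartAt (𝓡 n) i).symm y)
  have hS : ∀ i, ContDiffOn ℝ ∞ (S i) (chartBall n i) := fun i => by
    rw [← contMDiffOn_iff_contDiffOn]
    exact (hw i).comp ((contMDiffOn_extChartAt_symm i).mono (chartBall_subset_target n i))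
      fun y hy => extChartAt_symm_mem_chartNhd hy
  have hSd : ∀ i, ContDiffOn ℝ ∞ (fun y => oneFormEquiv _ ℝ (fderiv ℝ (S i) y)) (chartBall n i) :=
    fun i => (oneFormEquiv _ ℝ).contDiff.comp_contDiffOn
      ((hS i).fderiv_of_isOpen Metric.isOpen_ball (by simp))
  -- The differentials of the smooth primitives `S i` are the local expressions of a closed form in
  -- the class of `e`. Its integral along a path is the value of `e` plus the increment of `w`, so
  -- `B` need not change.
  refine ⟨fun i y => a i y + oneFormEquiv _ ℝ (fderiv ℝ (S i) y), w,
    fun i => (ha.smooth i).add (hSd i), fun i y hy => ?_, fun i γ Y h => ?_⟩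
  · have hn := Metric.isOpen_ball.mem_nhds hy
    rw [extDeriv_fun_add (((ha.smooth i).contDiffAt hn).differentiableAt (by simp))
      (((hSd i).contDiffAt hn).differentiableAt (by simp)), ha.extDeriv i y hy,
      extDeriv_fderiv ((hS i).contDiffAt hn), add_zero]
  · obtain ⟨J, hJ, hJ1, hY⟩ := h.smooth
    have hball : ∀ s ∈ Icc (0 : ℝ) 1, Y s ∈ chartBall n i := fun s hs => h.mem_ball hs
    have hYc : ContinuousOn Y (Icc 0 1) := hY.continuousOn.mono hJ1
    have hY' : ContinuousOn (deriv Y) (Icc 0 1) :=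
      (hY.continuousOn_deriv_of_isOpen hJ (by simp)).mono hJ1
    have hc1 : ContinuousOn (fun s => a i (Y s) ![deriv Y s]) (uIcc 0 1) := by
      rw [uIcc_of_le zero_le_one]
      exact ((ha.smooth i).continuousOn.comp hYc hball).oneForm_apply hY'
    have hc2 : ContinuousOn (fun s => fderiv ℝ (S i) (Y s) (deriv Y s)) (uIcc 0 1) := by
      rw [uIcc_of_le zero_le_one]
      exact (((hS i).continuousOn_fderiv_of_isOpen Metric.isOpen_ball (by simp)).comp hYc
        hball).clm_apply hY'
    have hftc := intervalIntegral.integral_eq_sub_of_hasDerivAt (f := fun s => S i (Y s))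
      (f' := fun s => fderiv ℝ (S i) (Y s) (deriv Y s)) (a := 0) (b := 1) (fun s hs => by
        rw [uIcc_of_le zero_le_one] at hs
        exact ((((hS i).contDiffAt (Metric.isOpen_ball.mem_nhds (hball s hs))).differentiableAt
          (by simp)).hasFDerivAt.comp_hasDerivAt s ((hY.contDiffAt
            (hJ.mem_nhds (hJ1 hs))).differentiableAt (by simp)).hasDerivAt)) hc2.intervalIntegrable
    have hsplit : ∫ s in (0 : ℝ)..1, (a i (Y s) + oneFormEquiv _ ℝ (fderiv ℝ (S i) (Y s))) ![deriv Y s]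
        = (∫ s in (0 : ℝ)..1, a i (Y s) ![deriv Y s]) + (S i (Y 1) - S i (Y 0)) := by
      rw [← hftc, ← intervalIntegral.integral_add hc1.intervalIntegrable hc2.intervalIntegrable]
      rfl
    have hend : ∀ t : stdSimplex ℝ (Fin 2), S i (Y (t 1)) = e (chartRadial n i (γ t)) + w (γ t) :=
      fun t => by
        simp only [S]
        rw [← h.eq t, (extChartAt (𝓡 n) i).left_inv (h.mem t).1]
    have hv1 := hend (stdSimplex.vertex 1)
    have hv0 := hend (stdSimplex.vertex 0)
    rw [show (stdSimplex.vertex (S := ℝ) (1 : Fin 2)) 1 = 1 by simp] at hv1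
    rw [show (stdSimplex.vertex (S := ℝ) (0 : Fin 2)) 1 = 0 by simp] at hv0
    have hc := isConedCover_chartNhd.cocycle_eq he i γ h.mem
    rw [hsplit, hv1, hv0, unitExp_add, ha.holonomy i γ Y h, add_assoc, unitExp_add, hc]
    rw [show ∀ p q r s : ℝ, p + q - (r + s) = p - r + (q - s) by intros; ring]
    apply Additive.ofMul.injective
    simp only [ofMul_mul, ofMul_inv]
    abel

theorem toCircle_coe (t : ℝ) : AddCircle.toCircle (t : AddCircle (1 : ℝ)) = unitExp t := by
  rw [AddCircle.toCircle_apply_mk, div_one]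
  rfl

theorem coe_addCircle_intCast (k : ℤ) : ((k : ℝ) : AddCircle (1 : ℝ)) = 0 := by
  rw [AddCircle.coe_eq_zero_iff]
  exact ⟨k, by simp⟩

/-- The function `b ∘ f - b` modulo integers, on small smooth paths. -/
theorem IsSmoothChartPath.coe_comp_sub {c : SingularSimplex 2 M → ℤ} {b : SingularSimplex 1 M → ℝ}
    (hb : ∀ (σ : SingularSimplex 2 M) (g : ℝ × ℝ → M), IsSmoothExtension (𝓡 n) σ g →
      triangleIntegral α g = (c σ : ℝ) + singularCoboundary b σ) {f : C(M, M)}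
    (hf : ContMDiff (𝓡 n) (𝓡 n) ∞ f) (hfα : α.pullback (𝓡 n) (𝓡 n) f = α) {i : M}
    {γ : SingularSimplex 1 M} {Y : ℝ → EuclideanSpace ℝ (Fin n)} (h : IsSmoothChartPath i γ Y) :
    ((b (f.comp γ) - b γ : ℝ) : AddCircle (1 : ℝ)) =
      ((b (f.comp (chartRadial n i (γ (stdSimplex.vertex 1)))) -
        b (chartRadial n i (γ (stdSimplex.vertex 1))) : ℝ) : AddCircle (1 : ℝ)) -
      ((b (f.comp (chartRadial n i (γ (stdSimplex.vertex 0)))) -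
        b (chartRadial n i (γ (stdSimplex.vertex 0))) : ℝ) : AddCircle (1 : ℝ)) := by
  obtain ⟨σ, g, h0, h1, h2, hg, -⟩ := h.exists_simplex
  -- The integrality relation is applied to the cone and to its image under `f`. The two integrals
  -- agree, so the coboundary of `b ∘ f - b` on the cone is an integer.
  have hfg : IsSmoothExtension (𝓡 n) (f.comp σ) (f ∘ g) := by
    obtain ⟨hg0, U, hU, hUt, hgU⟩ := hg
    exact ⟨fun q => congrArg f (hg0 q), U, hU, hUt, hf.comp_contMDiffOn hgU⟩
  have e1 := hb σ g hg
  have e2 := hb _ _ hfg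
  rw [triangleIntegral_comp hf hfα hg, e1, singularCoboundary_one_apply,
    singularCoboundary_one_apply, h0, h1, h2] at e2
  have f0 : SingularSimplex.face 0 (f.comp σ) = f.comp γ := by rw [← h0]; rfl
  have f1 : SingularSimplex.face 1 (f.comp σ) = f.comp (chartRadial n i (γ (stdSimplex.vertex 1))) := by
    rw [← h1]; rfl
  have f2 : SingularSimplex.face 2 (f.comp σ) = f.comp (chartRadial n i (γ (stdSimplex.vertex 0))) := by
    rw [← h2]; rfl
  rw [f0, f1, f2] at e2
  rw [← sub_eq_zero, ← AddCircle.coe_sub, ← AddCircle.coe_sub]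
  refine Eq.trans ?_ (coe_addCircle_intCast (c σ - c (f.comp σ)))
  congr 1
  push_cast
  linarith

/-- For a map which preserves `α` and satisfies the homological assumption, the potentials can be
chosen so that the holonomies of `α` and `f^* α` differ by a coboundary. -/
theorem exists_potential_isHolonomyRatio [T2Space M] [CompactSpace M] [ConnectedSpace M]
    (hα : α.IsSmooth) (hd : α.extDeriv = 0)
    {c : SingularSimplex 2 M → ℤ} {b : SingularSimplex 1 M → ℝ}
    (hb : ∀ (σ : SingularSimplex 2 M) (g : ℝ × ℝ → M), IsSmoothExtension (𝓡 n) σ g →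
      triangleIntegral α g = (c σ : ℝ) + singularCoboundary b σ) {f : C(M, M)}
    (hf : ContMDiff (𝓡 n) (𝓡 n) ∞ f) (hfα : α.pullback (𝓡 n) (𝓡 n) f = α)
    (hH : HomologyAssumption f) :
    ∃ (a' : M → EuclideanSpace ℝ (Fin n) → EuclideanSpace ℝ (Fin n) [⋀^Fin 1]→L[ℝ] ℝ)
      (b' : SingularSimplex 1 M → ℝ) (v : M → Circle),
      IsPotential α a' (fun i x => unitExp (b (chartRadial n i x))) b' ∧
        IsHolonomyRatio n b' f v := by
  have : LocallyPathConnectedSpace M :=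
    ChartedSpace.locallyPathConnectedSpace (EuclideanSpace ℝ (Fin n)) M
  have : PathConnectedSpace M := pathConnectedSpace_iff_connectedSpace.2 inferInstance
  have hid : ContMDiff (𝓡 n) (𝓡 n) ∞ (ContinuousMap.id M) := contMDiff_id
  obtain ⟨e, he, v, hv⟩ := exists_real_cocycle (X := TopCat.of M)
    (isConedCover_chartNhd (n := n) (M := M)) f hH
    (fun i x => ((b (f.comp (chartRadial n i x)) - b (chartRadial n i x) : ℝ) : AddCircle (1 : ℝ)))
    -- A nearby point is joined to `x` by a segment inside both chart neighbourhoods. The value of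
    -- `b ∘ f - b` on it is the increment of the local function at `i` and also of the one at `j`.
    (fun i j x ⟨hi, hj⟩ => by
      have hx : (extChartAt (𝓡 n) i).symm (extChartAt (𝓡 n) i x) = x :=
        (extChartAt (𝓡 n) i).left_inv hi.1
      have hy : extChartAt (𝓡 n) i x ∈ chartDomain n (ContinuousMap.id M) i j :=
        ⟨hi.2, by rw [mem_preimage, hx]; exact hj⟩
      obtain ⟨ε, hε, hb'⟩ := Metric.isOpen_iff.1 (isOpen_chartDomain (ContinuousMap.id M) i j) _ hy
      filter_upwards [(isOpen_extChartAt_preimage' i Metric.isOpen_ball).mem_nhds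
        ⟨hi.1, Metric.mem_ball_self hε⟩] with z hz
      obtain ⟨γ, h1, h2, h3, h4⟩ := exists_smooth_segment hid i j hb' hz.2
      have k1 := h1.coe_comp_sub hb hf hfα
      have k2 := h2.coe_comp_sub hb hf hfα
      rw [ContinuousMap.id_comp] at k2
      rw [k1, h3, h4, hx, (extChartAt (𝓡 n) i).left_inv hz.1] at k2
      rw [sub_eq_sub_iff_sub_eq_sub]
      exact k2)
  obtain ⟨a', w, ha'⟩ := (isPotential_chartPrimitive hα hd hb).exists_add_cocycle he
  -- The second factor compensates for the coboundary of `w` which was added to `b` together with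
  -- `e`.
  refine ⟨a', _, fun x => AddCircle.toCircle (v x) * unitExp (w (f x) - w x), ha', ?_⟩
  intro i j γ Y Z hY hZ
  have h1 := hv i γ hY.mem
  rw [← hY.coe_comp_sub hb hf hfα, ← AddCircle.coe_add] at h1
  have h2 := congrArg AddCircle.toCircle (eq_sub_iff_add_eq.1 h1)
  rw [AddCircle.toCircle_add, toCircle_coe] at h2
  simp only [ContinuousMap.comp_apply, ← h2]
  rw [mul_assoc, mul_left_comm, mul_assoc, ← unitExp_add, ← unitExp_add]
  congr 2
  ring

end PotentialConstruction

/-! ### Manifold structures glued from local homeomorphisms -/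

section Gluing

open Filter Topology

variable {E : Type*} [NormedAddCommGroup E] [NormedSpace ℝ E] {H : Type*} [TopologicalSpace H]
  {J : ModelWithCorners ℝ E H} {N : Type*} [TopologicalSpace N] [ChartedSpace H N]
  {P : Type*} [TopologicalSpace P] {ι : Type*}

/-- The charted space structure given by local homeomorphisms to a charted space. -/
@[reducible] def gluedChartedSpace (H : Type*) [TopologicalSpace H] {N : Type*} [TopologicalSpace N]
    [ChartedSpace H N] {P : Type*} [TopologicalSpace P] {ι : Type*}
    (T : ι → OpenPartialHomeomorph P N) (idx : P → ι) (hT : ∀ p, p ∈ (T (idx p)).source) :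
    ChartedSpace H P where
  atlas := {c | ∃ i, ∃ e ∈ atlas H N, c = (T i).trans e}
  chartAt p := (T (idx p)).trans (chartAt H (T (idx p) p))
  mem_chart_source p := ⟨hT p, mem_chart_source H _⟩
  chart_mem_atlas p := ⟨_, _, chart_mem_atlas H _, rfl⟩

variable {T : ι → OpenPartialHomeomorph P N} {idx : P → ι} (hT : ∀ p, p ∈ (T (idx p)).source)

theorem contDiffOn_of_contMDiffOn_model {g : H → H} {s : Set H} (hg : ContMDiffOn J J ∞ g s) :
    ContDiffOn ℝ ∞ (J ∘ g ∘ J.symm) (J.symm ⁻¹' s ∩ range J) := by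
  rcases s.eq_empty_or_nonempty with rfl | ⟨x, -⟩
  · simp
  · have := (contMDiffOn_iff.1 hg).2 x x
    simpa [chartAt_self_eq, inter_comm] using this

variable [IsManifold J ∞ N]

/-- A change of glued charts is an inverse chart of `N`, a transition between the `T i`, and a chart
of `N`; all three are smooth. -/
theorem isManifold_gluedChartedSpace
    (hs : ∀ i j, ContMDiffOn J J ∞ ((T i).symm.trans (T j)) ((T i).symm.trans (T j)).source) :
    @IsManifold ℝ _ E _ _ H _ J ∞ P _ (gluedChartedSpace H T idx hT) := by
  let _ := gluedChartedSpace H T idx hT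
  refine isManifold_of_contDiffOn J ∞ P ?_
  rintro _ _ ⟨i, e, he, rfl⟩ ⟨j, e', he', rfl⟩
  refine contDiffOn_of_contMDiffOn_model ?_
  have h1 : ContMDiffOn J J ∞ e.symm e.target :=
    contMDiffOn_symm_of_mem_maximalAtlas (IsManifold.subset_maximalAtlas he)
  have h2 : ContMDiffOn J J ∞ e' e'.source :=
    contMDiffOn_of_mem_maximalAtlas (IsManifold.subset_maximalAtlas he')
  refine (h2.comp ((hs i j).comp (h1.mono ?_) ?_) ?_)
  · rintro x ⟨hx, -⟩
    exact hx.1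
  · rintro x ⟨hx, hx'⟩
    exact ⟨hx.2, hx'.1⟩
  · rintro x ⟨hx, hx'⟩
    exact hx'.2

theorem contMDiffOn_glued
    (hs : ∀ i j, ContMDiffOn J J ∞ ((T i).symm.trans (T j)) ((T i).symm.trans (T j)).source) (i : ι) :
    letI := gluedChartedSpace H T idx hT
    ContMDiffOn J J ∞ (T i) (T i).source := by
  let _ := gluedChartedSpace H T idx hT
  have := isManifold_gluedChartedSpace (J := J) (idx := idx) hT hs
  intro p hp
  have hc : (T i).trans (chartAt H (T i p)) ∈ IsManifold.maximalAtlas J ∞ P :=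
    IsManifold.subset_maximalAtlas ⟨i, _, chart_mem_atlas H _, rfl⟩
  have hps : p ∈ ((T i).trans (chartAt H (T i p))).source := ⟨hp, mem_chart_source H _⟩
  have h1 := (contMDiffOn_of_mem_maximalAtlas hc).contMDiffAt
    (((T i).trans (chartAt H (T i p))).open_source.mem_nhds hps)
  have h2 : ContMDiffAt J J ∞ (chartAt H (T i p)).symm (((T i).trans (chartAt H (T i p))) p) :=
    (contMDiffOn_symm_of_mem_maximalAtlas (IsManifold.chart_mem_maximalAtlas (T i p))).contMDiffAt
      ((chartAt H (T i p)).open_target.mem_nhds ((chartAt H (T i p)).map_source (mem_chart_source H _)))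
  refine ((h2.comp p h1).congr_of_eventuallyEq ?_).contMDiffWithinAt
  filter_upwards [((T i).trans (chartAt H (T i p))).open_source.mem_nhds hps] with q hq
  exact ((chartAt H (T i p)).left_inv hq.2).symm

theorem contMDiffOn_glued_symm
    (hs : ∀ i j, ContMDiffOn J J ∞ ((T i).symm.trans (T j)) ((T i).symm.trans (T j)).source) (i : ι) :
    letI := gluedChartedSpace H T idx hT
    ContMDiffOn J J ∞ (T i).symm (T i).target := by
  let _ := gluedChartedSpace H T idx hT
  have := isManifold_gluedChartedSpace (J := J) (idx := idx) hT hs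
  intro y hy
  have hc : (T i).trans (chartAt H y) ∈ IsManifold.maximalAtlas J ∞ P :=
    IsManifold.subset_maximalAtlas ⟨i, _, chart_mem_atlas H _, rfl⟩
  have hyt : chartAt H y y ∈ ((T i).trans (chartAt H y)).target :=
    ⟨(chartAt H y).map_source (mem_chart_source H _), by
      rw [mem_preimage, (chartAt H y).left_inv (mem_chart_source H _)]; exact hy⟩
  have h1 := (contMDiffOn_symm_of_mem_maximalAtlas hc).contMDiffAt
    (((T i).trans (chartAt H y)).open_target.mem_nhds hyt)
  have h2 : ContMDiffAt J J ∞ (chartAt H y) y :=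
    (contMDiffOn_of_mem_maximalAtlas (IsManifold.chart_mem_maximalAtlas y)).contMDiffAt
      ((chartAt H y).open_source.mem_nhds (mem_chart_source H _))
  refine ((h1.comp y h2).congr_of_eventuallyEq ?_).contMDiffWithinAt
  filter_upwards [(chartAt H y).open_source.mem_nhds (mem_chart_source H y)] with q hq
  exact congrArg _ ((chartAt H y).left_inv hq).symm

end Gluing

/-! ### The circle bundle with transition functions B i / B j -/

section CircleBundleConstruction

open Filter Topology

variable {n : ℕ} {M : Type u} [TopologicalSpace M] [ChartedSpace (EuclideanSpace ℝ (Fin n)) M]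
  [IsManifold (𝓡 n) ∞ M]

/-- Circle-valued functions with smooth quotients. -/
def HasSmoothRatios (n : ℕ) {M : Type u} [TopologicalSpace M]
    [ChartedSpace (EuclideanSpace ℝ (Fin n)) M] (B : M → M → Circle) : Prop :=
  ∀ i j, ContMDiffOn (𝓡 n) (𝓡 1) ∞ (fun x => B i x * (B j x)⁻¹) (chartNhd n i ∩ chartNhd n j)

variable {B : M → M → Circle}

/-- The circle bundle with transition functions `B i / B j`. -/
def circleCore (hB : HasSmoothRatios n B) : FiberBundleCore M M Circle where
  baseSet := chartNhd n
  isOpen_baseSet := isOpen_chartNhd n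
  indexAt := id
  mem_baseSet_at := mem_chartNhd n
  coordChange i j x v := B i x * (B j x)⁻¹ * v
  coordChange_self i x _ v := by simp
  continuousOn_coordChange i j :=
    ((hB i j).continuousOn.comp continuousOn_fst fun p hp => hp.1).mul continuousOn_snd
  coordChange_comp i j k x _ v := by
    apply Additive.ofMul.injective
    simp only [ofMul_mul, ofMul_inv]
    abel

variable (hB : HasSmoothRatios n B)

/-- The total space of `circleCore`. -/
abbrev CircleTotal : Type u := (circleCore hB).TotalSpace

/-- The trivializations. -/
def circleTriv (i : M) : OpenPartialHomeomorph (CircleTotal hB) (M × Circle) :=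
  ((circleCore hB).localTriv i).toOpenPartialHomeomorph

variable {hB}

theorem circleTriv_apply (i : M) (p : CircleTotal hB) :
    circleTriv hB i p = (p.proj, B p.proj p.proj * (B i p.proj)⁻¹ * (show Circle from p.snd)) := rfl

theorem mem_circleTriv_source {i : M} {p : CircleTotal hB} :
    p ∈ (circleTriv hB i).source ↔ p.proj ∈ chartNhd n i := Iff.rfl

theorem mem_circleTriv_self (p : CircleTotal hB) : p ∈ (circleTriv hB p.proj).source :=
  mem_circleTriv_source.2 (mem_chartNhd n p.proj)

theorem mem_circleTriv_target {i : M} {q : M × Circle} :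
    q ∈ (circleTriv hB i).target ↔ q.1 ∈ chartNhd n i :=
  (circleCore hB).mem_localTriv_target i q

theorem circleTriv_transition (i j : M) (q : M × Circle) :
    circleTriv hB j ((circleTriv hB i).symm q) = (q.1, B i q.1 * (B j q.1)⁻¹ * q.2) := by
  have h : (circleTriv hB i).symm q =
    ⟨q.1, (circleCore hB).coordChange i ((circleCore hB).indexAt q.1) q.1 q.2⟩ := rfl
  rw [h, circleTriv_apply]
  refine Prod.ext rfl ?_
  change B q.1 q.1 * (B j q.1)⁻¹ * (B i q.1 * (B q.1 q.1)⁻¹ * q.2) = _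
  apply Additive.ofMul.injective
  simp only [ofMul_mul, ofMul_inv]
  abel

theorem contMDiffOn_circleTriv_transition (i j : M) :
    ContMDiffOn ((𝓡 n).prod (𝓡 1)) ((𝓡 n).prod (𝓡 1)) ∞
      ((circleTriv hB i).symm.trans (circleTriv hB j))
      ((circleTriv hB i).symm.trans (circleTriv hB j)).source := by
  have h : ∀ q ∈ ((circleTriv hB i).symm.trans (circleTriv hB j)).source,
      q.1 ∈ chartNhd n i ∩ chartNhd n j := fun q hq =>
    ⟨mem_circleTriv_target.1 hq.1, mem_circleTriv_source.1 hq.2⟩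
  have h1 : ContMDiffOn ((𝓡 n).prod (𝓡 1)) ((𝓡 n).prod (𝓡 1)) ∞
      (fun q : M × Circle => (q.1, B i q.1 * (B j q.1)⁻¹ * q.2))
      ((circleTriv hB i).symm.trans (circleTriv hB j)).source :=
    contMDiffOn_fst.prodMk (((hB i j).comp contMDiffOn_fst h).mul contMDiffOn_snd)
  exact h1.congr fun q hq => circleTriv_transition i j q

instance : ChartedSpace (ModelProd (EuclideanSpace ℝ (Fin n)) (EuclideanSpace ℝ (Fin 1)))
    (CircleTotal hB) :=
  gluedChartedSpace (ModelProd (EuclideanSpace ℝ (Fin n)) (EuclideanSpace ℝ (Fin 1)))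
    (circleTriv hB) (fun p => p.proj) mem_circleTriv_self

instance : IsManifold (bundleModel n) ∞ (CircleTotal hB) :=
  isManifold_gluedChartedSpace mem_circleTriv_self contMDiffOn_circleTriv_transition

theorem contMDiffOn_circleTriv (i : M) : ContMDiffOn (bundleModel n) ((𝓡 n).prod (𝓡 1)) ∞
    (circleTriv hB i) (circleTriv hB i).source :=
  contMDiffOn_glued mem_circleTriv_self contMDiffOn_circleTriv_transition i

theorem contMDiffOn_circleTriv_symm (i : M) : ContMDiffOn ((𝓡 n).prod (𝓡 1)) (bundleModel n) ∞
    (circleTriv hB i).symm (circleTriv hB i).target :=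
  contMDiffOn_glued_symm mem_circleTriv_self contMDiffOn_circleTriv_transition i

/-- The fibre coordinate in a trivialization. -/
def fibreCoord (hB : HasSmoothRatios n B) (i : M) (p : CircleTotal hB) : Circle :=
  (circleTriv hB i p).2

theorem contMDiffAt_fibreCoord {i : M} {p : CircleTotal hB} (hp : p.proj ∈ chartNhd n i) :
    ContMDiffAt (bundleModel n) (𝓡 1) ∞ (fibreCoord hB i) p :=
  contMDiffAt_snd.comp p ((contMDiffOn_circleTriv i).contMDiffAt
    ((circleTriv hB i).open_source.mem_nhds (mem_circleTriv_source.2 hp)))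

theorem contMDiff_circleProj :
    ContMDiff (bundleModel n) (𝓡 n) ∞ (Bundle.TotalSpace.proj : CircleTotal hB → M) := fun p =>
  contMDiffAt_fst.comp p ((contMDiffOn_circleTriv p.proj).contMDiffAt
    ((circleTriv hB p.proj).open_source.mem_nhds
      (mem_circleTriv_source.2 (mem_chartNhd n p.proj))))

theorem fibreCoord_eq (i j : M) (p : CircleTotal hB) :
    fibreCoord hB j p = B i p.proj * (B j p.proj)⁻¹ * fibreCoord hB i p := by
  have h : ∀ b bi bj v : Circle, b * bj⁻¹ * v = bi * bj⁻¹ * (b * bi⁻¹ * v) := fun b bi bj v => by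
    apply Additive.ofMul.injective
    simp only [ofMul_mul, ofMul_inv]
    abel
  exact h _ _ _ _

theorem ext_fibreCoord (i : M) {p q : CircleTotal hB} (h1 : p.proj = q.proj)
    (h2 : fibreCoord hB i p = fibreCoord hB i q) : p = q := by
  obtain ⟨x, v⟩ := p
  obtain ⟨y, w⟩ := q
  obtain rfl : x = y := h1
  congr 1
  exact mul_left_cancel (G := Circle) (show B x x * (B i x)⁻¹ * (show Circle from v) =
    B x x * (B i x)⁻¹ * (show Circle from w) from h2)

instance [T2Space M] : T2Space (CircleTotal hB) := by
  refine ⟨fun p q hpq => ?_⟩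
  -- Points of one fibre are separated by the fibre coordinate, other points by their projections.
  by_cases h : p.proj = q.proj
  · have h2 : fibreCoord hB p.proj p ≠ fibreCoord hB p.proj q := fun h2 =>
      hpq (ext_fibreCoord _ h h2)
    obtain ⟨U, V, hU, hV, hpU, hqV, hUV⟩ := t2_separation h2
    have hc : ContinuousOn (fibreCoord hB p.proj) (circleTriv hB p.proj).source :=
      continuous_snd.comp_continuousOn (circleTriv hB p.proj).continuousOn
    have hp := mem_circleTriv_source.2 (mem_chartNhd n p.proj)
    refine ⟨_, _, hc.isOpen_inter_preimage (circleTriv hB p.proj).open_source hU,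
      hc.isOpen_inter_preimage (circleTriv hB p.proj).open_source hV, ⟨hp, hpU⟩,
      ⟨mem_circleTriv_source.2 (h ▸ mem_chartNhd n p.proj), hqV⟩, ?_⟩
    exact (hUV.preimage _).mono inter_subset_right inter_subset_right
  · obtain ⟨U, V, hU, hV, hpU, hqV, hUV⟩ := t2_separation h
    have hc : Continuous (Bundle.TotalSpace.proj : CircleTotal hB → M) :=
      contMDiff_circleProj.continuous
    exact ⟨_, _, hU.preimage hc, hV.preimage hc, hpU, hqV, hUV.preimage _⟩

instance : MulAction Circle (CircleTotal hB) where
  smul z p := ⟨p.proj, (z * (show Circle from p.snd) : Circle)⟩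
  one_smul p := by
    obtain ⟨x, v⟩ := p
    exact congrArg (Bundle.TotalSpace.mk x) (one_mul (show Circle from v))
  mul_smul z w p := by
    obtain ⟨x, v⟩ := p
    exact congrArg (Bundle.TotalSpace.mk x) (mul_assoc z w (show Circle from v))

@[simp] theorem proj_smul (z : Circle) (p : CircleTotal hB) : (z • p).proj = p.proj := rfl

theorem fibreCoord_smul (i : M) (z : Circle) (p : CircleTotal hB) :
    fibreCoord hB i (z • p) = z * fibreCoord hB i p := by
  change B p.proj p.proj * (B i p.proj)⁻¹ * (z * (show Circle from p.snd)) =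
    z * (B p.proj p.proj * (B i p.proj)⁻¹ * (show Circle from p.snd))
  exact mul_left_comm _ _ _

/-- Maps into the bundle are smooth if their components are. -/
theorem contMDiffAt_circleTotal {E' H' N : Type*} [NormedAddCommGroup E'] [NormedSpace ℝ E']
    [TopologicalSpace H'] {J : ModelWithCorners ℝ E' H'} [TopologicalSpace N] [ChartedSpace H' N]
    {F : N → CircleTotal hB} {x : N} {i : M}
    (h1 : ContMDiffAt J (𝓡 n) ∞ (fun y => (F y).proj) x) (hi : (F x).proj ∈ chartNhd n i)
    (h2 : ContMDiffAt J (𝓡 1) ∞ (fun y => fibreCoord hB i (F y)) x) :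
    ContMDiffAt J (bundleModel n) ∞ F x := by
  have h3 := h1.prodMk h2
  have h4 := ((contMDiffOn_circleTriv_symm (hB := hB) i).contMDiffAt
    ((circleTriv hB i).open_target.mem_nhds (mem_circleTriv_target (q := ((F x).proj,
      fibreCoord hB i (F x))).2 hi))).comp x h3
  refine h4.congr_of_eventuallyEq ?_
  filter_upwards [h1.continuousAt.eventually ((isOpen_chartNhd n i).mem_nhds hi)] with y hy
  exact ((circleTriv hB i).left_inv (mem_circleTriv_source.2 hy)).symm

instance : ContMDiffSMul (𝓡 1) (bundleModel n) ∞ Circle (CircleTotal hB) where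
  contMDiff_smul := fun q => by
    have h1 : ContMDiffAt ((𝓡 1).prod (bundleModel n)) (𝓡 n) ∞
        (fun y : Circle × CircleTotal hB => y.2.proj) q :=
      contMDiff_circleProj.contMDiffAt.comp q contMDiffAt_snd
    refine contMDiffAt_circleTotal (F := fun y : Circle × CircleTotal hB => y.1 • y.2)
      (i := q.2.proj) h1 (mem_chartNhd n q.2.proj) ?_
    simp only [fibreCoord_smul]
    exact contMDiffAt_fst.mul ((contMDiffAt_fibreCoord (mem_chartNhd n q.2.proj)).comp q
      contMDiffAt_snd)

/-- The circle bundle with transition functions `B i / B j`. -/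
def circleBundle [T2Space M] (hB : HasSmoothRatios n B) : CircleBundle n M where
  P := CircleTotal hB
  proj := Bundle.TotalSpace.proj
  smooth_proj := contMDiff_circleProj
  free z p h := by
    have := congrArg (fibreCoord hB p.proj) h
    rw [fibreCoord_smul] at this
    exact mul_eq_right.1 this
  proj_eq_iff p q := by
    refine ⟨fun h => ⟨fibreCoord hB p.proj q * (fibreCoord hB p.proj p)⁻¹,
      ext_fibreCoord p.proj h ?_⟩, ?_⟩
    · rw [fibreCoord_smul, inv_mul_cancel_right]
    · rintro ⟨z, rfl⟩
      rfl
  locally_trivial x := by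
    refine ⟨chartNhd n x, fun y => (circleTriv hB x).symm (y, 1), fibreCoord hB x,
      isOpen_chartNhd n x, mem_chartNhd n x, ?_, ?_, ?_, ?_⟩
    · exact (contMDiffOn_circleTriv_symm x).comp (contMDiffOn_id.prodMk contMDiffOn_const)
        fun y hy => mem_circleTriv_target.2 hy
    · exact fun p hp => (contMDiffAt_fibreCoord hp).contMDiffWithinAt
    · intro y hy
      rfl
    · intro p hp
      refine ext_fibreCoord x rfl ?_
      rw [fibreCoord_smul]
      have : fibreCoord hB x ((circleTriv hB x).symm (p.proj, 1)) = 1 :=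
        congrArg Prod.snd ((circleTriv hB x).right_inv
          (mem_circleTriv_target (q := (p.proj, 1)).2 hp))
      rw [this, mul_one]

end CircleBundleConstruction

/-! ### The model connection on E × ℂ -/

section ConnectionModel

open Filter Topology

variable {E : Type} [NormedAddCommGroup E] [NormedSpace ℝ E]

/-- The model `ζ⁻¹ dζ - 2πi a` of a connection form, as a linear map. -/
def modelConnection (a : E → E [⋀^Fin 1]→L[ℝ] ℝ) (q : E × ℂ) : E × ℂ →L[ℝ] ℂ :=
  q.2⁻¹ • ContinuousLinearMap.snd ℝ E ℂ - (2 * Real.pi * Complex.I : ℂ) •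
    (Complex.ofRealCLM.comp (((oneFormEquiv E ℝ).symm (a q.1)).comp (.fst ℝ E ℂ)))

theorem modelConnection_apply (a : E → E [⋀^Fin 1]→L[ℝ] ℝ) (q v : E × ℂ) :
    modelConnection a q v = q.2⁻¹ * v.2 - 2 * Real.pi * Complex.I * (a q.1 ![v.1] : ℝ) := by
  simp [modelConnection, oneFormEquiv_symm_apply]

theorem contDiffAt_modelConnection {a : E → E [⋀^Fin 1]→L[ℝ] ℝ} {q : E × ℂ}
    (ha : ContDiffAt ℝ ∞ a q.1) (hq : q.2 ≠ 0) : ContDiffAt ℝ ∞ (modelConnection a) q := by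
  have h1 : ContDiffAt ℝ ∞ (fun q : E × ℂ => q.2⁻¹) q := contDiffAt_snd.inv hq
  have h2 : ContDiffAt ℝ ∞ (fun q : E × ℂ => (oneFormEquiv E ℝ).symm (a q.1)) q :=
    (oneFormEquiv E ℝ).symm.contDiff.contDiffAt.comp q (ha.comp q contDiffAt_fst)
  have h3 : ContDiffAt ℝ ∞ (fun q : E × ℂ =>
      Complex.ofRealCLM.comp (((oneFormEquiv E ℝ).symm (a q.1)).comp (.fst ℝ E ℂ))) q :=
    contDiffAt_const.clm_comp (h2.clm_comp contDiffAt_const)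
  exact (h1.smul contDiffAt_const).sub (h3.const_smul _)

/-- The term ζ⁻¹dζ is closed: its derivative is symmetric in the two vectors and cancels. -/
theorem extDeriv_modelConnection {a : E → E [⋀^Fin 1]→L[ℝ] ℝ} {q : E × ℂ}
    (ha : ContDiffAt ℝ ∞ a q.1) (hq : q.2 ≠ 0) (v w : E × ℂ) :
    extDeriv (fun q => oneFormEquiv (E × ℂ) ℂ (modelConnection a q)) q ![v, w] =
      -(2 * Real.pi * Complex.I) * (extDeriv a q.1 ![v.1, w.1] : ℝ) := by
  have hd : DifferentiableAt ℝ (fun q => oneFormEquiv (E × ℂ) ℂ (modelConnection a q)) q :=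
    ((oneFormEquiv (E × ℂ) ℂ).contDiff.contDiffAt.comp q
      (contDiffAt_modelConnection ha hq)).differentiableAt (n := ∞) (by simp)
  have had : DifferentiableAt ℝ a q.1 := ha.differentiableAt (by simp)
  have r0 : ∀ {V : Type} (v w : V), (0 : Fin 2).removeNth ![v, w] = ![w] := fun v w => by
    ext i; fin_cases i; rfl
  have r1 : ∀ {V : Type} (v w : V), (1 : Fin 2).removeNth ![v, w] = ![v] := fun v w => by
    ext i; fin_cases i; rfl
  rw [extDeriv_apply hd, extDeriv_apply had, Fin.sum_univ_two, Fin.sum_univ_two, r0, r0, r1, r1]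
  have key : ∀ v w : E × ℂ, fderiv ℝ (fun q => oneFormEquiv (E × ℂ) ℂ (modelConnection a q) ![w]) q v =
      -(q.2 ^ 2)⁻¹ * v.2 * w.2 - 2 * Real.pi * Complex.I *
        (fderiv ℝ (fun y => a y ![w.1]) q.1 v.1 : ℝ) := fun v w => by
    have e1 : (fun q => oneFormEquiv (E × ℂ) ℂ (modelConnection a q) ![w]) =
        fun q : E × ℂ => q.2⁻¹ * w.2 - 2 * Real.pi * Complex.I * ((a q.1 ![w.1] : ℝ) : ℂ) := by
      funext q
      exact modelConnection_apply a q w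
    have hline : HasDerivAt (fun t : ℝ => q + t • v) v 0 := by
      have h := ((hasDerivAt_id (0 : ℝ)).smul_const v).const_add q
      rwa [one_smul] at h
    have hdd : DifferentiableAt ℝ
        (fun q => oneFormEquiv (E × ℂ) ℂ (modelConnection a q) ![w]) q :=
      (ContinuousAlternatingMap.apply ℝ (E × ℂ) ℂ ![w]).differentiableAt.comp q hd
    have h1 := HasFDerivAt.comp_hasDerivAt (f := fun t : ℝ => q + t • v) 0
      (by simp only [zero_smul, add_zero]; exact hdd.hasFDerivAt) hline
    have h2 : HasDerivAt (fun t : ℝ => q.2 + t • v.2) v.2 0 := by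
      have h := ((hasDerivAt_id (0 : ℝ)).smul_const v.2).const_add q.2
      rwa [one_smul] at h
    have h3 : HasDerivAt (fun t : ℝ => q.1 + t • v.1) v.1 0 := by
      have h := ((hasDerivAt_id (0 : ℝ)).smul_const v.1).const_add q.1
      rwa [one_smul] at h
    have hda : DifferentiableAt ℝ (fun y => a y ![w.1]) q.1 :=
      (ContinuousAlternatingMap.apply ℝ E ℝ ![w.1]).differentiableAt.comp q.1 had
    have h4 := HasFDerivAt.comp_hasDerivAt (f := fun t : ℝ => q.1 + t • v.1) 0
      (by simp only [zero_smul, add_zero]; exact hda.hasFDerivAt) h3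
    have h5 := ((h2.fun_inv (by simpa using hq)).mul_const w.2).sub
      (h4.ofReal_comp.const_mul (2 * Real.pi * Complex.I : ℂ))
    rw [e1] at h1 ⊢
    refine (h1.unique h5).trans ?_
    simp only [zero_smul, add_zero]
    ring
  rw [key, key]
  simp only [Fin.val_zero, Fin.val_one, pow_zero, pow_one, one_smul, neg_smul]
  push_cast
  ring

variable {E' : Type} [NormedAddCommGroup E'] [NormedSpace ℝ E']

/-- This is gauge covariance: replacing ζ by gζ adds dg/g = 2πi β to ζ⁻¹dζ, which is exactly the
change of -2πi a. -/
theorem modelConnection_comp {a : E → E [⋀^Fin 1]→L[ℝ] ℝ} {a' : E' → E' [⋀^Fin 1]→L[ℝ] ℝ}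
    {T : E → E'} {T' : E →L[ℝ] E'} {g : E → ℂ} {β : E →L[ℝ] ℝ} {q : E × ℂ}
    (hT : HasFDerivAt T T' q.1)
    (hg : HasFDerivAt g (β.smulRight (2 * Real.pi * Complex.I * g q.1)) q.1)
    (hβ : ∀ v, β v = a' (T q.1) ![T' v] - a q.1 ![v]) (hq : q.2 ≠ 0) (hgq : g q.1 ≠ 0) :
    ∃ G' : E × ℂ →L[ℝ] E' × ℂ, HasFDerivAt (fun q : E × ℂ => (T q.1, g q.1 * q.2)) G' q ∧
      (modelConnection a' (T q.1, g q.1 * q.2)).comp G' = modelConnection a q := by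
  have h1 : HasFDerivAt (fun q : E × ℂ => T q.1) (T'.comp (.fst ℝ E ℂ)) q :=
    hT.comp q hasFDerivAt_fst
  have h2 := (hg.comp q hasFDerivAt_fst).mul (hasFDerivAt_snd (𝕜 := ℝ) (E := E) (F := ℂ) (p := q))
  refine ⟨_, h1.prodMk h2, ?_⟩
  refine ContinuousLinearMap.ext fun v => ?_
  rw [ContinuousLinearMap.comp_apply, modelConnection_apply, modelConnection_apply]
  simp [hβ]
  field_simp
  ring

end ConnectionModel

/-! ### The global connection form and lifts that preserve it -/

section Connection

open Filter Topology

theorem contMDiff_coe_circle : ContMDiff (𝓡 1) 𝓘(ℝ, ℂ) ∞ (fun z : Circle => (z : ℂ)) :=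
  haveI : Fact (Module.finrank ℝ ℂ = 1 + 1) := Complex.finrank_real_complex_fact
  contMDiff_coe_sphere (E := ℂ) (n := 1)

variable {n : ℕ} {M : Type u} [TopologicalSpace M] [ChartedSpace (EuclideanSpace ℝ (Fin n)) M]
  [IsManifold (𝓡 n) ∞ M] {B : M → M → Circle} {hB : HasSmoothRatios n B}

/-- The coordinates on the total space over `chartNhd n i`. -/
def totalCoord (hB : HasSmoothRatios n B) (i : M) (p : CircleTotal hB) :
    EuclideanSpace ℝ (Fin n) × ℂ :=
  (extChartAt (𝓡 n) i p.proj, (fibreCoord hB i p : ℂ))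

theorem contMDiffAt_totalCoord {i : M} {p : CircleTotal hB} (hp : p.proj ∈ chartNhd n i) :
    ContMDiffAt (bundleModel n) 𝓘(ℝ, EuclideanSpace ℝ (Fin n) × ℂ) ∞ (totalCoord hB i) p := by
  refine ContMDiffAt.prodMk_space ?_ ?_
  · refine (contMDiffAt_extChartAt' (n := ∞) ?_).comp p contMDiff_circleProj.contMDiffAt
    have := hp.1
    rwa [extChartAt_source] at this
  · exact contMDiff_coe_circle.contMDiffAt.comp p (contMDiffAt_fibreCoord hp)

theorem eventually_mem_chartNhd {i : M} {p : CircleTotal hB} (hp : p.proj ∈ chartNhd n i) :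
    ∀ᶠ q in 𝓝 p, q.proj ∈ chartNhd n i :=
  contMDiff_circleProj.continuous.continuousAt.eventually ((isOpen_chartNhd n i).mem_nhds hp)

/-- The local connection form. -/
def localConnection (a : M → EuclideanSpace ℝ (Fin n) → EuclideanSpace ℝ (Fin n) [⋀^Fin 1]→L[ℝ] ℝ)
    (i : M) (q : EuclideanSpace ℝ (Fin n) × ℂ) : (EuclideanSpace ℝ (Fin n) × ℂ) [⋀^Fin 1]→L[ℝ] ℂ :=
  oneFormEquiv _ ℂ (modelConnection (a i) q)

/-- The connection form. -/
def connectionForm (hB : HasSmoothRatios n B)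
    (a : M → EuclideanSpace ℝ (Fin n) → EuclideanSpace ℝ (Fin n) [⋀^Fin 1]→L[ℝ] ℝ) :
    DiffForm (bundleModel n) (CircleTotal hB) 1 ℂ := fun p =>
  DiffForm.pullback (bundleModel n) 𝓘(ℝ, EuclideanSpace ℝ (Fin n) × ℂ) (totalCoord hB p.proj)
    (localConnection a p.proj) p

/-- A lift of `f` which multiplies fibres by `u`. -/
structure IsBundleLift (hB : HasSmoothRatios n B) (f : C(M, M)) (u : M → Circle)
    (F : CircleTotal hB → CircleTotal hB) : Prop where
  proj : ∀ p, (F p).proj = f p.proj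
  coord : ∀ i j p, fibreCoord hB j (F p) = transitionFun B f u i j p.proj * fibreCoord hB i p

theorem isBundleLift_id : IsBundleLift hB (ContinuousMap.id M) (fun _ => 1) id where
  proj _ := rfl
  coord i j p := by
    rw [transitionFun, mul_one]
    exact fibreCoord_eq i j p

theorem isBundleLift_smul (z : Circle) :
    IsBundleLift hB (ContinuousMap.id M) (fun _ => z) fun p => z • p where
  proj _ := rfl
  coord i j p := by
    rw [fibreCoord_smul, fibreCoord_eq i j p, transitionFun, ← mul_assoc, ← mul_assoc, mul_comm z]
    rfl

/-- The lift of `f` determined by `u`. -/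
def bundleLift (hB : HasSmoothRatios n B) (f : C(M, M)) (u : M → Circle) (p : CircleTotal hB) :
    CircleTotal hB :=
  ⟨f p.proj, (transitionFun B f u p.proj (f p.proj) p.proj * fibreCoord hB p.proj p : Circle)⟩

theorem isBundleLift_bundleLift (f : C(M, M)) (u : M → Circle) :
    IsBundleLift hB f u (bundleLift hB f u) where
  proj _ := rfl
  coord i j p := by
    have h : fibreCoord hB j (bundleLift hB f u p) = B (f p.proj) (f p.proj) *
      (B j (f p.proj))⁻¹ * (transitionFun B f u p.proj (f p.proj) p.proj * fibreCoord hB p.proj p) :=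
      rfl
    rw [h, fibreCoord_eq i p.proj p]
    simp only [transitionFun]
    generalize fibreCoord hB i p = c
    apply Additive.ofMul.injective
    simp only [ofMul_mul, ofMul_inv]
    abel

variable {α : DiffForm (𝓡 n) M 2 ℝ}
  {a : M → EuclideanSpace ℝ (Fin n) → EuclideanSpace ℝ (Fin n) [⋀^Fin 1]→L[ℝ] ℝ}
  {b : SingularSimplex 1 M → ℝ} {f : C(M, M)} {u : M → Circle} {F : CircleTotal hB → CircleTotal hB}

theorem IsBundleLift.contMDiff (hF : IsBundleLift hB f u F) (ha : IsPotential α a B b)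
    (hf : ContMDiff (𝓡 n) (𝓡 n) ∞ f) (hu : IsHolonomyRatio n b f u) :
    ContMDiff (bundleModel n) (bundleModel n) ∞ F := fun p => by
  have hp := mem_chartNhd n p.proj
  have hfp := mem_chartNhd n (f p.proj)
  have h1 : ContMDiffAt (bundleModel n) (𝓡 n) ∞ (fun q => (F q).proj) p := by
    simp only [hF.proj]
    exact (hf.comp contMDiff_circleProj).contMDiffAt
  refine contMDiffAt_circleTotal (i := f p.proj) h1 (by rw [hF.proj]; exact hfp) ?_
  simp only [hF.coord p.proj (f p.proj)]
  refine ContMDiffAt.mul ?_ (contMDiffAt_fibreCoord hp)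
  refine ContMDiffAt.comp (g := transitionFun B f u p.proj (f p.proj)) p ?_
    contMDiff_circleProj.contMDiffAt
  exact (contMDiffOn_transitionFun ha hf hu _ _).contMDiffAt
    (((isOpen_chartNhd n _).inter ((isOpen_chartNhd n _).preimage f.continuous)).mem_nhds ⟨hp, hfp⟩)

/-- Lifts intertwine the local connection forms. -/
theorem IsBundleLift.pullback_localConnection (hF : IsBundleLift hB f u F)
    (ha : IsPotential α a B b) (hf : ContMDiff (𝓡 n) (𝓡 n) ∞ f) (hu : IsHolonomyRatio n b f u)
    {i j : M} {p : CircleTotal hB} (hi : p.proj ∈ chartNhd n i) (hj : f p.proj ∈ chartNhd n j) :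
    DiffForm.pullback (bundleModel n) 𝓘(ℝ, EuclideanSpace ℝ (Fin n) × ℂ) (totalCoord hB j ∘ F)
      (localConnection a j) p =
    DiffForm.pullback (bundleModel n) 𝓘(ℝ, EuclideanSpace ℝ (Fin n) × ℂ) (totalCoord hB i)
      (localConnection a i) p := by
  have hx : (extChartAt (𝓡 n) i).symm (extChartAt (𝓡 n) i p.proj) = p.proj :=
    (extChartAt (𝓡 n) i).left_inv hi.1
  have hy : extChartAt (𝓡 n) i p.proj ∈ chartDomain n f i j :=
    ⟨hi.2, by rw [mem_preimage, hx]; exact hj⟩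
  obtain ⟨G', hG', hcomp⟩ := modelConnection_comp (a := a i) (a' := a j) (q := totalCoord hB i p)
    (((contDiffOn_chartExpr hf i j).contDiffAt
      ((isOpen_chartDomain f i j).mem_nhds hy)).differentiableAt (by simp)).hasFDerivAt
    (contMDiffAt_transitionFun_symm ha hf hu i j hy).2 (potentialDiff_apply i j _)
    (Circle.coe_ne_zero _) (Circle.coe_ne_zero _)
  -- In coordinates the lift is the gauge transformation of `modelConnection_comp`.
  have hev : ∀ᶠ q in 𝓝 p, (totalCoord hB j ∘ F) q = ((fun q : EuclideanSpace ℝ (Fin n) × ℂ =>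
      (chartExpr n f i j q.1, (transitionFun B f u i j ((extChartAt (𝓡 n) i).symm q.1) : ℂ) * q.2)) ∘
        totalCoord hB i) q := by
    filter_upwards [eventually_mem_chartNhd hi] with q hq
    simp only [Function.comp_apply, totalCoord, chartExpr, (extChartAt (𝓡 n) i).left_inv hq.1,
      hF.proj, hF.coord i j, Circle.coe_mul]
  have hΨ := (contMDiffAt_totalCoord hi).mdifferentiableAt (by simp)
  have h1 := (hG'.hasMFDerivAt.comp p hΨ.hasMFDerivAt).congr_of_eventuallyEq hev
  ext v
  change modelConnection (a j) ((totalCoord hB j ∘ F) p) (mfderiv (bundleModel n)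
    𝓘(ℝ, EuclideanSpace ℝ (Fin n) × ℂ) (totalCoord hB j ∘ F) p (v 0)) = _
  rw [h1.mfderiv, hev.self_of_nhds]
  have h2 := DFunLike.congr_fun hcomp (mfderiv (bundleModel n) 𝓘(ℝ, EuclideanSpace ℝ (Fin n) × ℂ)
    (totalCoord hB i) p (v 0))
  exact h2

/-- The definition uses a different chart at every point; regarding the identity as a lift shows
that any chart around the point gives the same form. -/
theorem connectionForm_eq (ha : IsPotential α a B b) {i : M} {p : CircleTotal hB}
    (hi : p.proj ∈ chartNhd n i) : connectionForm hB a p =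
    DiffForm.pullback (bundleModel n) 𝓘(ℝ, EuclideanSpace ℝ (Fin n) × ℂ) (totalCoord hB i)
      (localConnection a i) p :=
  isBundleLift_id.pullback_localConnection ha contMDiff_id (isHolonomyRatio_one b) hi
    (mem_chartNhd n p.proj)

theorem IsBundleLift.pullback_connectionForm (hF : IsBundleLift hB f u F)
    (ha : IsPotential α a B b) (hf : ContMDiff (𝓡 n) (𝓡 n) ∞ f) (hu : IsHolonomyRatio n b f u) :
    (connectionForm hB a).pullback (bundleModel n) (bundleModel n) F = connectionForm hB a := by
  funext p
  have hp := mem_chartNhd n p.proj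
  have hfp := mem_chartNhd n (f p.proj)
  have hFp : (F p).proj ∈ chartNhd n (f p.proj) := by rw [hF.proj]; exact hfp
  ext v
  rw [connectionForm_eq ha hp]
  refine Eq.trans ?_ (DFunLike.congr_fun (hF.pullback_localConnection ha hf hu hp hfp) v)
  change connectionForm hB a (F p) (fun k => mfderiv (bundleModel n) (bundleModel n) F p (v k)) =
    localConnection a (f p.proj) (totalCoord hB (f p.proj) (F p)) fun k => mfderiv (bundleModel n)
      𝓘(ℝ, EuclideanSpace ℝ (Fin n) × ℂ) (totalCoord hB (f p.proj) ∘ F) p (v k)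
  rw [connectionForm_eq ha hFp,
    mfderiv_comp p ((contMDiffAt_totalCoord hFp).mdifferentiableAt (by simp))
      ((hF.contMDiff ha hf hu p).mdifferentiableAt (by simp))]
  rfl

theorem contDiffAt_localConnection (ha : IsPotential α a B b) {i : M}
    {q : EuclideanSpace ℝ (Fin n) × ℂ} (h1 : q.1 ∈ chartBall n i) (h2 : q.2 ≠ 0) :
    ContDiffAt ℝ ∞ (localConnection a i) q :=
  (oneFormEquiv (EuclideanSpace ℝ (Fin n) × ℂ) ℂ).contDiff.contDiffAt.comp q
    (contDiffAt_modelConnection ((ha.smooth i).contDiffAt (Metric.isOpen_ball.mem_nhds h1)) h2)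

theorem isSmooth_connectionForm (ha : IsPotential α a B b) : (connectionForm hB a).IsSmooth := by
  intro p₀ y hy
  have hx := (extChartAt (bundleModel n) p₀).map_target hy
  set p := (extChartAt (bundleModel n) p₀).symm y with hp_def
  have hp := mem_chartNhd n p.proj
  have hs : ContMDiffAt 𝓘(ℝ, _) (bundleModel n) ∞ (extChartAt (bundleModel n) p₀).symm y :=
    (contMDiffOn_extChartAt_symm p₀).contMDiffAt ((isOpen_extChartAt_target p₀).mem_nhds hy)
  have hΦ : ContDiffAt ℝ ∞ (totalCoord hB p.proj ∘ (extChartAt (bundleModel n) p₀).symm) y := by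
    rw [← contMDiffAt_iff_contDiffAt]
    exact (contMDiffAt_totalCoord hp).comp y hs
  have hL : ContDiffAt ℝ ∞ (modelConnection (a p.proj))
      ((totalCoord hB p.proj ∘ (extChartAt (bundleModel n) p₀).symm) y) :=
    contDiffAt_modelConnection ((ha.smooth _).contDiffAt (Metric.isOpen_ball.mem_nhds hp.2))
      (Circle.coe_ne_zero _)
  have hev : (connectionForm hB a).inChart p₀ =ᶠ[𝓝 y] fun z => oneFormEquiv _ ℂ
      ((modelConnection (a p.proj)
        ((totalCoord hB p.proj ∘ (extChartAt (bundleModel n) p₀).symm) z)).comp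
        (fderiv ℝ (totalCoord hB p.proj ∘ (extChartAt (bundleModel n) p₀).symm) z)) := by
    filter_upwards [hs.continuousAt.eventually (eventually_mem_chartNhd hp),
      (isOpen_extChartAt_target p₀).mem_nhds hy] with z hz hz'
    exact DiffForm.inChart_eq_of_pullback hz'
      ((contMDiffAt_totalCoord hz).mdifferentiableAt (by simp)) (connectionForm_eq ha hz)
  refine ContDiffAt.contDiffWithinAt (ContDiffAt.congr_of_eventuallyEq ?_ hev)
  exact (oneFormEquiv (EuclideanSpace ℝ (Fin n) × EuclideanSpace ℝ (Fin 1)) ℂ).contDiff.contDiffAt.comp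
    y (ContDiffAt.clm_comp (hL.comp y hΦ) (hΦ.fderiv_right (m := ∞) (by simp)))

end Connection

/-! ### Normalization and curvature of the connection -/

section Prequantum

open Filter Topology

variable {n : ℕ} {M : Type u} [TopologicalSpace M] [ChartedSpace (EuclideanSpace ℝ (Fin n)) M]
  [IsManifold (𝓡 n) ∞ M] {B : M → M → Circle} {hB : HasSmoothRatios n B}
  {α : DiffForm (𝓡 n) M 2 ℝ}
  {a : M → EuclideanSpace ℝ (Fin n) → EuclideanSpace ℝ (Fin n) [⋀^Fin 1]→L[ℝ] ℝ}
  {b : SingularSimplex 1 M → ℝ}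

/-- The derivative of the coordinates on the total space. -/
def totalDeriv (hB : HasSmoothRatios n B) (i : M) (p : CircleTotal hB) :
    EuclideanSpace ℝ (Fin n) × EuclideanSpace ℝ (Fin 1) →L[ℝ] EuclideanSpace ℝ (Fin n) × ℂ :=
  mfderiv (bundleModel n) 𝓘(ℝ, EuclideanSpace ℝ (Fin n) × ℂ) (totalCoord hB i) p

theorem connectionForm_apply (p : CircleTotal hB) (v : TangentSpace (bundleModel n) p) :
    connectionForm hB a p ![v] = (totalCoord hB p.proj p).2⁻¹ * (totalDeriv hB p.proj p v).2 -
      2 * Real.pi * Complex.I *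
        (a p.proj (totalCoord hB p.proj p).1 ![(totalDeriv hB p.proj p v).1] : ℝ) :=
  modelConnection_apply _ _ _

/-- Differentiating |ζ|² = 1 shows that conj(ζ)dζ is imaginary, and conj(ζ) = ζ⁻¹ on the circle. -/
theorem connectionForm_re (p : CircleTotal hB) (v : TangentSpace (bundleModel n) p) :
    (connectionForm hB a p ![v]).re = 0 := by
  have hΨ := ((contMDiffAt_totalCoord (mem_chartNhd n p.proj)).mdifferentiableAt
    (by simp)).hasMFDerivAt
  set ζ : ℂ := (fibreCoord hB p.proj p : ℂ) with hζ
  have h1 : HasFDerivAt (fun q : EuclideanSpace ℝ (Fin n) × ℂ => ‖q.2‖ ^ 2) _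
      (totalCoord hB p.proj p) :=
    (hasStrictFDerivAt_norm_sq (totalCoord hB p.proj p).2).hasFDerivAt.comp
      (totalCoord hB p.proj p) hasFDerivAt_snd
  have h2 := h1.hasMFDerivAt.comp p hΨ
  have h3 : ((fun q : EuclideanSpace ℝ (Fin n) × ℂ => ‖q.2‖ ^ 2) ∘ totalCoord hB p.proj) =
      fun _ => (1 : ℝ) := by
    funext q
    simp only [Function.comp_apply, totalCoord]
    rw [Circle.norm_coe, one_pow]
  rw [h3] at h2
  have h4 := hasMFDerivAt_unique h2 (hasMFDerivAt_const (1 : ℝ) p)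
  have h5 : (2 • (innerSL ℝ) ζ) (totalDeriv hB p.proj p v).2 = 0 := DFunLike.congr_fun h4 v
  have h7 : (totalCoord hB p.proj p).2⁻¹ = (starRingEnd ℂ) ζ := by
    rw [hζ, ← Circle.coe_inv_eq_conj, Circle.coe_inv]
    rfl
  have h8 : ((starRingEnd ℂ) ζ * (totalDeriv hB p.proj p v).2).re = 0 := by
    simp at h5 ⊢
    linarith
  rw [connectionForm_apply, h7, Complex.sub_re, h8]
  simp

variable [T2Space M]

theorem connectionForm_generator (p : CircleTotal hB) :
    connectionForm hB a p ![(circleBundle hB).generator p] = Complex.I := by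
  have h0 : Circle.exp 0 • p = p := by rw [Circle.exp_zero, one_smul]
  let c : ℝ → CircleTotal hB := fun t => Circle.exp t • p
  have hc : MDifferentiableAt 𝓘(ℝ, ℝ) (bundleModel n) c 0 := by
    have h1 : ContMDiff 𝓘(ℝ, ℝ) ((𝓡 1).prod (bundleModel n)) ∞ fun t : ℝ => (Circle.exp t, p) :=
      contMDiff_circleExp.prodMk contMDiff_const
    have h2 : ContMDiff ((𝓡 1).prod (bundleModel n)) (bundleModel n) ∞
        fun q : Circle × CircleTotal hB => q.1 • q.2 := ContMDiffSMul.contMDiff_smul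
    exact (h2.comp h1).mdifferentiable (by simp) 0
  have hΨ : MDifferentiableAt (bundleModel n) 𝓘(ℝ, EuclideanSpace ℝ (Fin n) × ℂ)
      (totalCoord hB p.proj) (c 0) :=
    (contMDiffAt_totalCoord (p := c 0) (mem_chartNhd n p.proj)).mdifferentiableAt (by simp)
  have h3 := mfderiv_comp (0 : ℝ) hΨ hc
  have h4 : totalCoord hB p.proj ∘ c = fun t : ℝ => (extChartAt (𝓡 n) p.proj p.proj,
      Complex.exp (t * Complex.I) * (fibreCoord hB p.proj p : ℂ)) := by
    funext t
    simp only [Function.comp_apply, c, totalCoord, proj_smul, fibreCoord_smul, Circle.coe_mul,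
      Circle.coe_exp]
  have h5 : HasDerivAt (fun t : ℝ => (extChartAt (𝓡 n) p.proj p.proj,
      Complex.exp (t * Complex.I) * (fibreCoord hB p.proj p : ℂ)))
      (0, Complex.I * (fibreCoord hB p.proj p : ℂ)) 0 := by
    refine (hasDerivAt_const _ _).prodMk ?_
    have h : HasDerivAt (fun t : ℝ => (t : ℂ) * Complex.I) Complex.I 0 := by
      simpa using ((hasDerivAt_id (0 : ℝ)).ofReal_comp).mul_const Complex.I
    simpa using h.cexp.mul_const (fibreCoord hB p.proj p : ℂ)
  rw [h4, mfderiv_eq_fderiv] at h3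
  have h6 := DFunLike.congr_fun h3 (1 : ℝ)
  -- The derivative of the orbit is taken at `Circle.exp 0 • p`. The type of `totalDeriv` does not
  -- involve the point, so it can be compared with its value at `p`.
  have h7 : ∀ q : CircleTotal hB, q = p → totalDeriv hB p.proj q = totalDeriv hB p.proj p := by
    rintro _ rfl
    rfl
  have h8 : totalDeriv hB p.proj p ((circleBundle hB).generator p) =
      (0, Complex.I * (fibreCoord hB p.proj p : ℂ)) := by
    rw [← h7 _ h0]
    refine h6.symm.trans ?_
    rw [h5.hasFDerivAt.fderiv]
    exact one_smul ℝ _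
  refine (connectionForm_apply p _).trans ?_
  rw [h8]
  have h9 : a p.proj (totalCoord hB p.proj p).1 ![(0 : EuclideanSpace ℝ (Fin n))] = 0 :=
    (a p.proj _).map_coord_zero 0 rfl
  have h10 : (fibreCoord hB p.proj p : ℂ) ≠ 0 := Circle.coe_ne_zero _
  have h11 : (totalCoord hB p.proj p).2⁻¹ * (Complex.I * (fibreCoord hB p.proj p : ℂ)) =
      Complex.I := by
    rw [mul_left_comm]
    exact (congrArg (Complex.I * ·) (inv_mul_cancel₀ h10)).trans (mul_one _)
  refine (congrArg₂ (fun (z : ℂ) (r : ℝ) => z - 2 * Real.pi * Complex.I * (r : ℂ)) h11 h9).trans ?_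
  simp only [Complex.ofReal_zero, mul_zero, sub_zero]

theorem totalDeriv_fst (p : CircleTotal hB)
    (v : EuclideanSpace ℝ (Fin n) × EuclideanSpace ℝ (Fin 1)) :
    (totalDeriv hB p.proj p v).1 =
      mfderiv (𝓡 n) 𝓘(ℝ, EuclideanSpace ℝ (Fin n)) (extChartAt (𝓡 n) p.proj) p.proj
        (mfderiv (bundleModel n) (𝓡 n) (Bundle.TotalSpace.proj : CircleTotal hB → M) p v) := by
  have hΨ := contMDiffAt_totalCoord (hB := hB) (mem_chartNhd n p.proj)
  have hproj := ((contMDiff_circleProj (hB := hB)).contMDiffAt (x := p)).mdifferentiableAt (by simp)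
  have hext : MDifferentiableAt (𝓡 n) 𝓘(ℝ, EuclideanSpace ℝ (Fin n)) (extChartAt (𝓡 n) p.proj)
      p.proj := (contMDiffAt_extChartAt (n := ∞)).mdifferentiableAt (by simp)
  have k0 : HasFDerivAt (Prod.fst : EuclideanSpace ℝ (Fin n) × ℂ → EuclideanSpace ℝ (Fin n))
    (ContinuousLinearMap.fst ℝ (EuclideanSpace ℝ (Fin n)) ℂ) (totalCoord hB p.proj p) :=
    hasFDerivAt_fst
  have k1 := k0.hasMFDerivAt.comp p (hΨ.mdifferentiableAt (by simp)).hasMFDerivAt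
  have k2 := hext.hasMFDerivAt.comp p hproj.hasMFDerivAt
  exact DFunLike.congr_fun (hasMFDerivAt_unique k1 k2) v

theorem IsPotential.extDeriv_localConnection (ha : IsPotential α a B b) {i : M}
    {q : EuclideanSpace ℝ (Fin n) × ℂ} (h1 : q.1 ∈ chartBall n i) (h2 : q.2 ≠ 0)
    (v w : EuclideanSpace ℝ (Fin n) × ℂ) :
    _root_.extDeriv (localConnection a i) q ![v, w] =
      -(2 * Real.pi * Complex.I) * (α.inChart i q.1 ![v.1, w.1] : ℝ) := by
  have hn := (ha.smooth i).contDiffAt (Metric.isOpen_ball.mem_nhds h1)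
  have h3 := extDeriv_modelConnection hn h2 v w
  rw [ha.extDeriv i q.1 h1] at h3
  exact h3

theorem IsPotential.differentiableAt_localConnection (ha : IsPotential α a B b) {i : M}
    {q : EuclideanSpace ℝ (Fin n) × ℂ} (h1 : q.1 ∈ chartBall n i) (h2 : q.2 ≠ 0) :
    DifferentiableAt ℝ (localConnection a i) q :=
  (contDiffAt_localConnection ha h1 h2).differentiableAt (by simp)

theorem extDeriv_connectionForm_eq (ha : IsPotential α a B b) (p : CircleTotal hB) :
    (connectionForm hB a).extDeriv p =
      DiffForm.pullback (bundleModel n) 𝓘(ℝ, EuclideanSpace ℝ (Fin n) × ℂ) (totalCoord hB p.proj)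
        (_root_.extDeriv (localConnection a p.proj)) p := by
  have hp := mem_chartNhd n p.proj
  have hq : (totalCoord hB p.proj p).2 ≠ 0 := Circle.coe_ne_zero _
  have hev := eventually_mem_chartNhd (hB := hB) hp
  exact DiffForm.extDeriv_eq_of_pullback (α := connectionForm hB a)
    (Φ := totalCoord hB p.proj) (l := localConnection a p.proj) (x := p)
    (hev.mono fun q hq => contMDiffAt_totalCoord hq)
    (ha.differentiableAt_localConnection hp.2 hq)
    (hev.mono fun q hq => connectionForm_eq ha hq)

theorem extDeriv_connectionForm (ha : IsPotential α a B b) (p : CircleTotal hB)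
    (v w : TangentSpace (bundleModel n) p) :
    (connectionForm hB a).extDeriv p ![v, w] = -(2 * Real.pi * Complex.I) *
      (α.inChart p.proj (totalCoord hB p.proj p).1
        ![(totalDeriv hB p.proj p v).1, (totalDeriv hB p.proj p w).1] : ℝ) := by
  rw [extDeriv_connectionForm_eq ha]
  refine Eq.trans ?_ (ha.extDeriv_localConnection (q := totalCoord hB p.proj p)
    (mem_chartNhd n p.proj).2 (Circle.coe_ne_zero _) (totalDeriv hB p.proj p v)
    (totalDeriv hB p.proj p w))
  refine congrArg (_root_.extDeriv (localConnection a p.proj) (totalCoord hB p.proj p)) ?_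
  ext1 j
  fin_cases j <;> rfl

/-- The first component of the bundle coordinates is the chart composed with the projection, so the
chain rule identifies the curvature computed in coordinates with the pulled-back form. -/
theorem inChart_totalDeriv (p : CircleTotal hB) (v w : TangentSpace (bundleModel n) p) :
    α.inChart p.proj (totalCoord hB p.proj p).1
        ![(totalDeriv hB p.proj p v).1, (totalDeriv hB p.proj p w).1] =
      α.pullback (bundleModel n) (𝓡 n) (Bundle.TotalSpace.proj : CircleTotal hB → M) p ![v, w] := by
  rw [DiffForm.pullback, α.eq_pullback_inChart (mem_extChartAt_source (I := 𝓡 n) p.proj)]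
  refine congrArg (α.inChart p.proj (totalCoord hB p.proj p).1) ?_
  ext1 j
  fin_cases j
  · exact totalDeriv_fst p v
  · exact totalDeriv_fst p w

theorem isPrequantumConnection_connectionForm (ha : IsPotential α a B b) :
    (circleBundle hB).IsPrequantumConnection α (connectionForm hB a) := by
  refine ⟨⟨isSmooth_connectionForm ha, connectionForm_re, fun z => ?_, connectionForm_generator⟩,
    fun p v w => ?_⟩
  · refine (isBundleLift_smul z).pullback_connectionForm ha contMDiff_id ?_
    intro i j γ Y Z _ _
    simp
  · refine (extDeriv_connectionForm ha p v w).trans ?_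
    have h : ∀ r : ℝ, -(2 * Real.pi * Complex.I) * (r : ℂ) = -Complex.I * (2 * Real.pi) * r :=
      fun r => by ring
    exact (congrArg (fun r : ℝ => -(2 * Real.pi * Complex.I) * (r : ℂ))
      (inChart_totalDeriv p v w)).trans (h _)

theorem IsBundleLift.map_smul {f : C(M, M)} {u : M → Circle} {F : CircleTotal hB → CircleTotal hB}
    (hF : IsBundleLift hB f u F) (z : Circle) (p : CircleTotal hB) : F (z • p) = z • F p := by
  refine ext_fibreCoord p.proj ((hF.proj _).trans (hF.proj p).symm) ?_
  rw [fibreCoord_smul, hF.coord p.proj, hF.coord p.proj, fibreCoord_smul]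
  exact mul_left_comm _ _ _

theorem IsPotential.hasSmoothRatios (ha : IsPotential α a B b) : HasSmoothRatios n B := fun i j => by
  have h := contMDiffOn_transitionFun ha (f := ContinuousMap.id M) contMDiff_id
    (isHolonomyRatio_one b) i j
  refine h.congr fun x _ => ?_
  rw [transitionFun, mul_one]
  rfl

end Prequantum

end

/-! ### The prequantum bundle and the lift of f -/

theorem mainTheorem11 (d : ℕ) (M : Type u) [TopologicalSpace M]
    [ChartedSpace (EuclideanSpace ℝ (Fin (2 * d))) M] [IsManifold (𝓡 (2 * d)) ∞ M]
    [T2Space M] [CompactSpace M] [ConnectedSpace M]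
    (Ω : DiffForm (𝓡 (2 * d)) M 2 ℝ) (hΩ : IsSymplecticForm Ω) (hint : HasIntegralClass Ω) :
    ∃ B : CircleBundle (2 * d) M,
      (∃ A : DiffForm (bundleModel (2 * d)) B.P 1 ℂ, B.IsPrequantumConnection Ω A) ∧
      ∀ f : M ≃ₘ^∞⟮𝓡 (2 * d), 𝓡 (2 * d)⟯ M,
        Ω.pullback (𝓡 (2 * d)) (𝓡 (2 * d)) f = Ω →
        HomologyAssumption (⟨f, f.continuous⟩ : C(M, M)) →
        ∃ A : DiffForm (bundleModel (2 * d)) B.P 1 ℂ, B.IsPrequantumConnection Ω A ∧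
          ∃ F : B.P → B.P, B.IsPrequantumMap A f F := by
  obtain ⟨c, -, b, hb⟩ := hint
  have ha := isPotential_chartPrimitive hΩ.smooth hΩ.closed hb
  refine ⟨circleBundle ha.hasSmoothRatios, ⟨_, isPrequantumConnection_connectionForm ha⟩,
    fun f hfΩ hH => ?_⟩
  have hf : ContMDiff (𝓡 (2 * d)) (𝓡 (2 * d)) ∞ (⟨f, f.continuous⟩ : C(M, M)) := f.contMDiff
  -- The new potentials belong to the same functions `B`, so the new connection lives on the bundle
  -- chosen before `f`.
  obtain ⟨a', b', v, ha', hv⟩ := exists_potential_isHolonomyRatio hΩ.smooth hΩ.closed hb hf hfΩ hH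
  have hF := isBundleLift_bundleLift (hB := ha.hasSmoothRatios) ⟨f, f.continuous⟩ v
  refine ⟨_, isPrequantumConnection_connectionForm ha', _,
    ⟨hF.contMDiff ha' hf hv, hF.proj, fun t p => hF.map_smul (Circle.exp t) p,
      hF.pullback_connectionForm ha' hf hv⟩⟩
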